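/- For a real $3\times 6$ matrix $M$ and a 3-subset $I$ of the six column labels, let $p_I(M)$ be the maximal minor of $M$ on the columns $I$ in increasing order. Let $X(3,6)$ be the 4-dimensional real manifold of all real $3\times 6$ matrices with no vanishing maximal minor, modulo $GL_3(\mathbb R)$ acting by row operations and $(\mathbb R^\times)^6$ rescaling the columns. A sign vector $\chi\in\{\pm1\}^{\binom{6}{3}}$ is a *uniform realizable chirotope* if $\chi_I=\operatorname{sign}p_I(M)$ for all $I$ and some $M$; its *chirotopal configuration space* $X^\chi(3,6)\subset X(3,6)$ is the open set of classes of such $M$. A *(generalized) cross-ratio* is $\pm$ a Laurent monomial in the $p_I$ in which every label has total exponent $0$; it is a nowhere vanishing function on $X(3,6)$. Let $I_{3,6}\subset\mathbb Z[p_I]$ be the Plücker ideal. For $g\in I_{3,6}$ let $g^\chi_+$, $g^\chi_-$ be the sums of the terms of $g$ that are positive, respectively negative, at $\chi$, and put $\operatorname{Trop}^\chi G(3,6)=\{\pi\in\mathbb R^{\binom63}:\operatorname{Trop}(g^\chi_+)(\pi)=\operatorname{Trop}(g^\chi_-)(\pi)\ \forall g\in I_{3,6}\}$ (minimum convention, an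 empty minimum being $+\infty$). Its fan structure: two points lie in the same relatively open cone iff in every three-term Plücker relation $p_{lab}p_{lcd}-p_{lac}p_{lbd}+p_{lad}p_{lbc}$ the same terms attain the tropical minimum, i.e. iff they split the octahedral faces of the hypersimplex in the same way. All cones are taken modulo lineality. **Theorem.** There are exactly 372 distinct chirotopal configuration spaces $X^\chi(3,6)$. For every rank-3 uniform realizable chirotope $\chi$ on 6 elements one can choose a $3\times6$ matrix $A^\chi$ of rational functions over $\mathbb R$ in $y_1,\dots,y_4$ and four cross-ratios $c^\chi=(c^\chi_1,\dots,c^\chi_4)$ such that: 1. $y\mapsto[A^\chi(y)]$ is a birational map $\mathbb R^4\dashrightarrow X(3,6)$ with inverse $c^\chi$: the two maps are mutually inverse between the nonempty Zariski-open set $D\subset\mathbb R^4$, on which all entries of $A^\chi$ are regular and no maximal minor vanishes, and $(c^\chi)^{-1}(D)\subset X(3,6)$. 2. $\mathbb R^4_{>0}\subset D$, and the birational map restricts to a diffeomorphism $\Phi:\mathbb R^4_{>0}\to X^\chi(3,6)$ with inverse $c^\chi$. 3. The logarithmic form $\Omega^\chi=d\log c^\chi_1\wedge d\log c^\chi_2\wedge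 d\log c^\chi_3\wedge d\log c^\chi_4$ on $X^\chi(3,6)$ satisfies $\Phi^*\Omega^\chi=d\log y_1\wedge\cdots\wedge d\log y_4$. It is canonical: if permuting the six labels by some $\sigma\in S_6$ maps $X^\chi(3,6)$ onto $X^{\chi'}(3,6)$, then $\sigma^*\Omega^{\chi'}=\pm\Omega^\chi$ on $X^\chi(3,6)$. In particular, up to sign, $\Omega^\chi$ depends only on the space and is invariant under its relabeling symmetries. 4. Let $P^\chi\subset\mathbb R^4$ be the Newton polytope of the product of all irreducible polynomials (up to constants) that divide the numerator or the denominator, in lowest terms, of a maximal minor of $A^\chi$. Then $X^\chi(3,6)$ is diffeomorphic to the interior of $P^\chi$, and the inner normal fan of $P^\chi$ is combinatorially isomorphic to the fan $\operatorname{Trop}^\chi G(3,6)$: their posets of cones, ordered by inclusion, are isomorphic. -/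

import Mathlib

open Set TopologicalSpace
open scoped Manifold ContDiff Matrix

noncomputable section

namespace Chirotopal

/-! ### Pluecker coordinates and the configuration space `X(3,6)` -/

/-- Euclidean 4-space. -/
abbrev E4 : Type := EuclideanSpace ℝ (Fin 4)

/-- The 3-element subsets of the ground set `{0, ..., 5}`. -/
abbrev Triple : Type := {I : Finset (Fin 6) // I.card = 3}

/-- The Pluecker coordinate `p_I` of a `3 × 6` matrix: the maximal minor on the columns in `I`,
taken in increasing order. -/
def minor {R : Type*} [CommRing R] (M : Matrix (Fin 3) (Fin 6) R) (I : Triple) : R :=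
  (M.submatrix id (I.1.orderEmbOfFin I.2)).det

/-- No maximal minor vanishes: the row space lies in the open Grassmannian. -/
def Generic (M : Matrix (Fin 3) (Fin 6) ℝ) : Prop := ∀ I : Triple, minor M I ≠ 0

/-- `3 × 6` matrices representing points of the real open Grassmannian. -/
abbrev GenMat : Type := {M : Matrix (Fin 3) (Fin 6) ℝ // Generic M}

/-- Two matrices give the same configuration when they differ by row operations
(same point of the Grassmannian) and by a rescaling of the columns (the torus action). -/
def SameConfig (M N : Matrix (Fin 3) (Fin 6) ℝ) : Prop :=
  ∃ (g : GL (Fin 3) ℝ) (t : Fin 6 → ℝˣ),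
    N = g.1 * M * Matrix.diagonal fun j => ((t j : ℝˣ) : ℝ)

lemma SameConfig.refl (M : Matrix (Fin 3) (Fin 6) ℝ) : SameConfig M M :=
  ⟨1, 1, by simp⟩

lemma SameConfig.symm {M N : Matrix (Fin 3) (Fin 6) ℝ} (h : SameConfig M N) :
    SameConfig N M := by
  obtain ⟨g, t, rfl⟩ := h
  refine ⟨g⁻¹, t⁻¹, ?_⟩
  have h1 : (g⁻¹ : GL (Fin 3) ℝ).1 * g.1 = 1 := by
    rw [← Units.val_mul]; simp
  have h2 : (Matrix.diagonal fun j => ((t j : ℝˣ) : ℝ)) *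
      (Matrix.diagonal fun j => (((t⁻¹) j : ℝˣ) : ℝ)) = 1 := by
    simp [Matrix.diagonal_mul_diagonal]
  calc M = ((g⁻¹ : GL (Fin 3) ℝ).1 * g.1) * M * ((Matrix.diagonal fun j => ((t j : ℝˣ) : ℝ)) *
      (Matrix.diagonal fun j => (((t⁻¹) j : ℝˣ) : ℝ))) := by rw [h1, h2]; simp
    _ = _ := by simp only [Matrix.mul_assoc]

lemma SameConfig.trans {M N P : Matrix (Fin 3) (Fin 6) ℝ} (h : SameConfig M N)
    (h' : SameConfig N P) : SameConfig M P := by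
  obtain ⟨g, t, rfl⟩ := h
  obtain ⟨g', t', rfl⟩ := h'
  refine ⟨g' * g, t * t', ?_⟩
  have h2 : (Matrix.diagonal fun j => ((t j : ℝˣ) : ℝ)) *
      (Matrix.diagonal fun j => ((t' j : ℝˣ) : ℝ)) =
      Matrix.diagonal fun j => (((t * t') j : ℝˣ) : ℝ) := by
    simp [Matrix.diagonal_mul_diagonal]
  rw [← h2, Units.val_mul]
  simp only [Matrix.mul_assoc]

instance configSetoid : Setoid GenMat where
  r M N := SameConfig M.1 N.1
  iseqv := ⟨fun M => SameConfig.refl M.1, fun h => h.symm, fun h h' => h.trans h'⟩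

/-- The real configuration space `X(3,6) = G°(3,6) / (ℝˣ)^6`. -/
abbrev X36 : Type := Quotient configSetoid

/-- The configuration represented by a generic matrix. -/
def mk (M : Matrix (Fin 3) (Fin 6) ℝ) (h : Generic M) : X36 := Quotient.mk configSetoid ⟨M, h⟩

/-! ### Behaviour of minors under the group actions -/

/-- The determinant of three arbitrary columns. -/
def det3 {R : Type*} [CommRing R] (M : Matrix (Fin 3) (Fin 6) R) (f : Fin 3 → Fin 6) : R :=
  (M.submatrix id f).det

lemma det3_act (g : Matrix (Fin 3) (Fin 3) ℝ) (M : Matrix (Fin 3) (Fin 6) ℝ)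
    (t : Fin 6 → ℝ) (f : Fin 3 → Fin 6) :
    det3 (g * M * Matrix.diagonal t) f = g.det * det3 M f * ∏ k, t (f k) := by
  have : (g * M * Matrix.diagonal t).submatrix id f =
      g * M.submatrix id f * Matrix.diagonal (fun k => t (f k)) := by
    ext i j
    simp only [Matrix.submatrix_apply, Matrix.mul_diagonal, id_eq]
    rfl
  rw [det3, this, Matrix.det_mul, Matrix.det_mul, Matrix.det_diagonal]
  rfl

lemma minor_act (g : Matrix (Fin 3) (Fin 3) ℝ) (M : Matrix (Fin 3) (Fin 6) ℝ)
    (t : Fin 6 → ℝ) (I : Triple) :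
    minor (g * M * Matrix.diagonal t) I = g.det * minor M I * ∏ j ∈ I.1, t j := by
  have h := det3_act g M t (I.1.orderEmbOfFin I.2)
  have h2 : ∏ k, t (I.1.orderEmbOfFin I.2 k) = ∏ j ∈ I.1, t j := by
    conv_rhs => rw [← Finset.map_orderEmbOfFin_univ I.1 I.2, Finset.prod_map]
    rfl
  rw [h2] at h
  exact h

lemma Generic.det3_ne {M : Matrix (Fin 3) (Fin 6) ℝ} (h : Generic M) {f : Fin 3 → Fin 6}
    (hf : Function.Injective f) : det3 M f ≠ 0 := by
  have hcard : (Finset.univ.image f).card = 3 := by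
    rw [Finset.card_image_of_injective _ hf]; simp
  set I : Triple := ⟨Finset.univ.image f, hcard⟩ with hI
  have hmem : ∀ k, ∃ l, I.1.orderEmbOfFin I.2 l = f k := by
    intro k
    have : f k ∈ Set.range (I.1.orderEmbOfFin I.2) := by
      rw [Finset.range_orderEmbOfFin]; simp [hI]
    exact this
  choose u hu using hmem
  have huinj : Function.Injective u := fun a b hab => hf (by rw [← hu, ← hu, hab])
  let v : Equiv.Perm (Fin 3) := Equiv.ofBijective u (Finite.injective_iff_bijective.mp huinj)
  have hsub : M.submatrix id f = (M.submatrix id (I.1.orderEmbOfFin I.2)).submatrix id v := by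
    ext i j
    simp [v, hu]
  have hI' := h I
  rw [det3, hsub, Matrix.det_permute']
  refine mul_ne_zero ?_ hI'
  exact_mod_cast (Equiv.Perm.sign v).ne_zero

/-! ### The smooth structure of `X(3,6)`

Every configuration has a unique representative whose first four columns are the standard
projective frame and whose last row is constant.  The four remaining entries form a global chart,
which identifies the quotient with an open subset of Euclidean space. -/

/-- The representative of a configuration in the standard projective frame. -/
def normalForm (v : E4) : Matrix (Fin 3) (Fin 6) ℝ :=
  !![1, 0, 0, 1, v 0, v 2;
     0, 1, 0, 1, v 1, v 3;
     0, 0, 1, 1, 1, 1]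

/-- The coordinates of the representative in the standard projective frame. -/
def coordMat (M : Matrix (Fin 3) (Fin 6) ℝ) : E4 :=
  !₂[det3 M ![4, 1, 2] * det3 M ![0, 1, 3] / (det3 M ![3, 1, 2] * det3 M ![0, 1, 4]),
     det3 M ![0, 4, 2] * det3 M ![0, 1, 3] / (det3 M ![0, 3, 2] * det3 M ![0, 1, 4]),
     det3 M ![5, 1, 2] * det3 M ![0, 1, 3] / (det3 M ![3, 1, 2] * det3 M ![0, 1, 5]),
     det3 M ![0, 5, 2] * det3 M ![0, 1, 3] / (det3 M ![0, 3, 2] * det3 M ![0, 1, 5])]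

lemma coordMat_eq_of_sameConfig {M N : Matrix (Fin 3) (Fin 6) ℝ} (h : SameConfig M N) :
    coordMat M = coordMat N := by
  obtain ⟨g, t, rfl⟩ := h
  have hg : g.1.det ≠ 0 := by
    have := (Matrix.isUnit_iff_isUnit_det g.1).mp g.isUnit
    exact this.ne_zero
  have ht : ∀ j, ((t j : ℝˣ) : ℝ) ≠ 0 := fun j => (t j).ne_zero
  have key : ∀ a b c d k x0 x1 x2 x3 x4 : ℝ, k ≠ 0 → x0 ≠ 0 → x1 ≠ 0 → x2 ≠ 0 → x3 ≠ 0 → x4 ≠ 0 →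
      ∀ n m : ℝ, n = k ^ 2 * x0 * x1 * x2 * x3 * x4 * (a * b) →
      m = k ^ 2 * x0 * x1 * x2 * x3 * x4 * (c * d) → n / m = a * b / (c * d) := by
    intro a b c d k x0 x1 x2 x3 x4 hk h0 h1 h2 h3 h4 n m hn hm
    rw [hn, hm, mul_div_mul_left]
    positivity
  simp only [coordMat, det3_act, Fin.prod_univ_three, Matrix.cons_val]
  congr 1
  ext i
  fin_cases i <;> simp only [Fin.zero_eta, Fin.mk_one, Fin.reduceFinMk, Matrix.cons_val]
  · refine (key _ _ _ _ _ _ _ _ _ _ hg (ht 0) (mul_ne_zero (ht 1) (ht 1)) (ht 2) (ht 3) (ht 4)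
      _ _ ?_ ?_).symm <;> ring
  · refine (key _ _ _ _ _ _ _ _ _ _ hg (mul_ne_zero (ht 0) (ht 0)) (ht 1) (ht 2) (ht 3) (ht 4)
      _ _ ?_ ?_).symm <;> ring
  · refine (key _ _ _ _ _ _ _ _ _ _ hg (ht 0) (mul_ne_zero (ht 1) (ht 1)) (ht 2) (ht 3) (ht 5)
      _ _ ?_ ?_).symm <;> ring
  · refine (key _ _ _ _ _ _ _ _ _ _ hg (mul_ne_zero (ht 0) (ht 0)) (ht 1) (ht 2) (ht 3) (ht 5)
      _ _ ?_ ?_).symm <;> ring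

lemma coordMat_normalForm (v : E4) : coordMat (normalForm v) = v := by
  ext i
  fin_cases i <;> simp [coordMat, det3, normalForm, Matrix.det_fin_three]

lemma sameConfig_normalForm {M : Matrix (Fin 3) (Fin 6) ℝ} (h : Generic M) :
    SameConfig M (normalForm (coordMat M)) := by
  have n012 : det3 M ![0, 1, 2] ≠ 0 := h.det3_ne (by decide)
  have n312 : det3 M ![3, 1, 2] ≠ 0 := h.det3_ne (by decide)
  have n032 : det3 M ![0, 3, 2] ≠ 0 := h.det3_ne (by decide)
  have n013 : det3 M ![0, 1, 3] ≠ 0 := h.det3_ne (by decide)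
  have n014 : det3 M ![0, 1, 4] ≠ 0 := h.det3_ne (by decide)
  have n015 : det3 M ![0, 1, 5] ≠ 0 := h.det3_ne (by decide)
  have hadj : (M.submatrix id ![0, 1, 2]).adjugate * M =
      Matrix.of ![fun j => det3 M ![j, 1, 2], fun j => det3 M ![0, j, 2],
        fun j => det3 M ![0, 1, j]] := by
    ext i j
    fin_cases i <;>
      simp [Matrix.mul_apply, Fin.sum_univ_three, Matrix.adjugate_fin_three, det3,
        Matrix.det_fin_three] <;> ring
  have hz : ∀ f : Fin 3 → Fin 6, ∀ a b, a ≠ b → f a = f b → det3 M f = 0 := by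
    intro f a b hab hf
    exact Matrix.det_zero_of_column_eq hab fun k => by simp [hf]
  let d : Fin 3 → ℝ := ![(det3 M ![3, 1, 2])⁻¹, (det3 M ![0, 3, 2])⁻¹, (det3 M ![0, 1, 3])⁻¹]
  have hdet : (Matrix.diagonal d * (M.submatrix id ![0, 1, 2]).adjugate).det ≠ 0 := by
    rw [Matrix.det_mul, Matrix.det_diagonal, Matrix.det_adjugate]
    refine mul_ne_zero ?_ (pow_ne_zero _ n012)
    simp [d, Fin.prod_univ_three, n312, n032, n013]
  refine ⟨Matrix.GeneralLinearGroup.mkOfDetNeZero _ hdet,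
    ![Units.mk0 (det3 M ![3, 1, 2] / det3 M ![0, 1, 2]) (div_ne_zero n312 n012),
      Units.mk0 (det3 M ![0, 3, 2] / det3 M ![0, 1, 2]) (div_ne_zero n032 n012),
      Units.mk0 (det3 M ![0, 1, 3] / det3 M ![0, 1, 2]) (div_ne_zero n013 n012),
      1,
      Units.mk0 (det3 M ![0, 1, 3] / det3 M ![0, 1, 4]) (div_ne_zero n013 n014),
      Units.mk0 (det3 M ![0, 1, 3] / det3 M ![0, 1, 5]) (div_ne_zero n013 n015)], ?_⟩
  have hg : (Matrix.GeneralLinearGroup.mkOfDetNeZero _ hdet).1 =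
      Matrix.diagonal d * (M.submatrix id ![0, 1, 2]).adjugate := rfl
  rw [hg, Matrix.mul_assoc (Matrix.diagonal d), hadj]
  have z1 : det3 M ![1, 1, 2] = 0 := hz _ 0 1 (by decide) rfl
  have z2 : det3 M ![2, 1, 2] = 0 := hz _ 0 2 (by decide) rfl
  have z3 : det3 M ![0, 0, 2] = 0 := hz _ 0 1 (by decide) rfl
  have z4 : det3 M ![0, 2, 2] = 0 := hz _ 1 2 (by decide) rfl
  have z5 : det3 M ![0, 1, 0] = 0 := hz _ 0 2 (by decide) rfl
  have z6 : det3 M ![0, 1, 1] = 0 := hz _ 1 2 (by decide) rfl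
  ext i j
  rw [Matrix.mul_diagonal, Matrix.diagonal_mul]
  fin_cases i <;> fin_cases j <;>
    simp [normalForm, coordMat, d, z1, z2, z3, z4, z5, z6] <;> field_simp

/-- The global chart of `X(3,6)`. -/
def coord : X36 → E4 :=
  Quotient.lift (fun M : GenMat => coordMat M.1) fun _ _ h => coordMat_eq_of_sameConfig h

lemma continuous_det3 (f : Fin 3 → Fin 6) :
    Continuous fun M : Matrix (Fin 3) (Fin 6) ℝ => det3 M f :=
  (continuous_id.matrix_submatrix id f).matrix_det

lemma continuous_coord : Continuous coord := by
  refine Continuous.quotient_lift ?_ _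
  have hc : ∀ f : Fin 3 → Fin 6, Continuous fun M : GenMat => det3 M.1 f :=
    fun f => (continuous_det3 f).comp continuous_subtype_val
  have hn : ∀ f : Fin 3 → Fin 6, Function.Injective f → ∀ M : GenMat, det3 M.1 f ≠ 0 :=
    fun f hf M => M.2.det3_ne hf
  refine (PiLp.continuous_toLp 2 _).comp (continuous_pi fun i => ?_)
  fin_cases i
  · exact ((hc _).mul (hc _)).div ((hc _).mul (hc _)) fun M =>
      mul_ne_zero (hn _ (by decide) M) (hn _ (by decide) M)
  · exact ((hc _).mul (hc _)).div ((hc _).mul (hc _)) fun M =>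
      mul_ne_zero (hn _ (by decide) M) (hn _ (by decide) M)
  · exact ((hc _).mul (hc _)).div ((hc _).mul (hc _)) fun M =>
      mul_ne_zero (hn _ (by decide) M) (hn _ (by decide) M)
  · exact ((hc _).mul (hc _)).div ((hc _).mul (hc _)) fun M =>
      mul_ne_zero (hn _ (by decide) M) (hn _ (by decide) M)

lemma injective_coord : Function.Injective coord := by
  intro x y
  induction x using Quotient.inductionOn with | _ M
  induction y using Quotient.inductionOn with | _ N
  intro h
  have h' : coordMat M.1 = coordMat N.1 := h
  refine Quotient.sound ?_
  have h1 := sameConfig_normalForm M.2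
  rw [h'] at h1
  exact h1.trans (sameConfig_normalForm N.2).symm

lemma generic_of_sameConfig {M N : Matrix (Fin 3) (Fin 6) ℝ} (h : SameConfig M N)
    (hM : Generic M) : Generic N := by
  obtain ⟨g, t, rfl⟩ := h
  intro I
  rw [minor_act]
  have hg : g.1.det ≠ 0 := ((Matrix.isUnit_iff_isUnit_det g.1).mp g.isUnit).ne_zero
  exact mul_ne_zero (mul_ne_zero hg (hM I)) (Finset.prod_ne_zero_iff.mpr fun j _ => (t j).ne_zero)

lemma continuous_normalForm : Continuous normalForm := by
  refine continuous_matrix fun i j => ?_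
  fin_cases i <;> fin_cases j <;> simp [normalForm] <;> fun_prop

lemma isOpen_generic : IsOpen {M : Matrix (Fin 3) (Fin 6) ℝ | Generic M} := by
  simp only [Generic, Set.ofPred_forall]
  exact isOpen_iInter_of_finite fun I => isOpen_ne_fun (continuous_det3 _) continuous_const

lemma isOpenEmbedding_coord : Topology.IsOpenEmbedding coord := by
  refine .of_continuous_injective_isOpenMap continuous_coord injective_coord fun U hU => ?_
  obtain ⟨W, hW, hWU⟩ := isOpen_induced_iff.mp (hU.preimage continuous_quotient_mk')
  have himage : coord '' U = normalForm ⁻¹' (W ∩ {M | Generic M}) := by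
    ext v
    constructor
    · rintro ⟨x, hx, rfl⟩
      induction x using Quotient.inductionOn with | _ M
      have hs := sameConfig_normalForm M.2
      have hgen : Generic (normalForm (coordMat M.1)) := generic_of_sameConfig hs M.2
      refine ⟨?_, hgen⟩
      have hq : (Quotient.mk configSetoid M : X36) =
          Quotient.mk configSetoid ⟨_, hgen⟩ := Quotient.sound hs
      rw [hq] at hx
      have : (⟨_, hgen⟩ : GenMat) ∈ Subtype.val ⁻¹' W := by rw [hWU]; exact hx
      exact this
    · rintro ⟨hv, hgen⟩
      refine ⟨Quotient.mk configSetoid ⟨normalForm v, hgen⟩, ?_, coordMat_normalForm v⟩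
      have : (⟨_, hgen⟩ : GenMat) ∈ Subtype.val ⁻¹' W := hv
      rw [hWU] at this
      exact this
  rw [himage]
  exact (hW.inter isOpen_generic).preimage continuous_normalForm

lemma exists_generic : ∃ M : Matrix (Fin 3) (Fin 6) ℝ, Generic M := by
  refine ⟨Matrix.of fun i j => ((j : ℕ) : ℝ) ^ (i : ℕ), fun I => ?_⟩
  have : (Matrix.of fun (i : Fin 3) (j : Fin 6) => ((j : ℕ) : ℝ) ^ (i : ℕ)).submatrix id
      (I.1.orderEmbOfFin I.2) =
      (Matrix.vandermonde fun k => (((I.1.orderEmbOfFin I.2 k : Fin 6) : ℕ) : ℝ))ᵀ := by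
    ext i j
    simp [Matrix.vandermonde_apply]
  rw [minor, this, Matrix.det_transpose, Matrix.det_vandermonde_ne_zero_iff]
  intro a b hab
  have h1 : ((I.1.orderEmbOfFin I.2 a : Fin 6) : ℕ) = (I.1.orderEmbOfFin I.2 b : Fin 6) := by
    exact Nat.cast_injective (R := ℝ) hab
  exact (I.1.orderEmbOfFin I.2).injective (Fin.ext h1)

instance : Nonempty X36 := ⟨mk _ exists_generic.choose_spec⟩

instance : ChartedSpace E4 X36 := isOpenEmbedding_coord.singletonChartedSpace

instance : IsManifold 𝓘(ℝ, E4) ∞ X36 := isOpenEmbedding_coord.isManifold_singleton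

/-! ### Chirotopes and their realization spaces -/

/-- Sign vectors indexed by the 3-element subsets of a 6-element set. -/
abbrev SignVector : Type := Triple → ℤˣ

/-- The sign vector of the Pluecker coordinates of `M` is `χ`. -/
def HasSigns (χ : SignVector) (M : Matrix (Fin 3) (Fin 6) ℝ) : Prop :=
  ∀ I, SignType.sign (minor M I) = SignType.sign ((χ I : ℤˣ) : ℤ)

lemma HasSigns.generic {χ : SignVector} {M : Matrix (Fin 3) (Fin 6) ℝ} (h : HasSigns χ M) :
    Generic M := by
  intro I h0
  have := h I
  rw [h0, sign_zero] at this
  exact (χ I).ne_zero (sign_eq_zero_iff.mp this.symm)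

/-- `χ` is a uniform realizable chirotope of rank 3 on 6 elements. -/
def IsRealizable (χ : SignVector) : Prop := ∃ M, HasSigns χ M

lemma isOpen_hasSigns (χ : SignVector) : IsOpen {M | HasSigns χ M} := by
  simp only [HasSigns, Set.ofPred_forall]
  refine isOpen_iInter_of_finite fun I => ?_
  have hc : Continuous fun M : Matrix (Fin 3) (Fin 6) ℝ => minor M I := continuous_det3 _
  rcases Int.units_eq_one_or (χ I) with h | h
  · simpa [h, sign_eq_one_iff] using isOpen_lt continuous_const hc
  · simpa [h, sign_eq_neg_one_iff] using isOpen_lt hc continuous_const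

/-- The chirotopal configuration space `X^χ(3,6)`: the open set of configurations that have a
representative whose Pluecker coordinates have signs `χ`. -/
def realizationSpace (χ : SignVector) : Opens X36 where
  carrier := {x | ∃ (M : Matrix (Fin 3) (Fin 6) ℝ) (h : HasSigns χ M), mk M h.generic = x}
  is_open' := by
    rw [← isQuotientMap_quotient_mk'.isOpen_preimage, isOpen_induced_iff]
    refine ⟨⋃ (g : GL (Fin 3) ℝ) (t : Fin 6 → ℝˣ),
      (fun M => g.1 * M * Matrix.diagonal fun j => ((t j : ℝˣ) : ℝ)) ⁻¹' {M | HasSigns χ M},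
      ?_, ?_⟩
    · refine isOpen_iUnion fun g => isOpen_iUnion fun t => (isOpen_hasSigns χ).preimage ?_
      fun_prop
    · ext M
      simp only [Set.mem_preimage, Set.mem_iUnion]
      constructor
      · rintro ⟨g, t, h⟩
        exact ⟨_, h, Quotient.sound (SameConfig.symm ⟨g, t, rfl⟩)⟩
      · rintro ⟨N, h, hN⟩
        obtain ⟨g, t, hgt⟩ := SameConfig.symm (Quotient.exact hN)
        exact ⟨g, t, by rw [← hgt]; exact h⟩

/-- The configuration obtained by permuting the six labelled points. -/
def relabel (σ : Equiv.Perm (Fin 6)) : X36 → X36 :=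
  Quotient.map (fun M : GenMat => ⟨M.1.submatrix id σ, fun I =>
      M.2.det3_ne (f := σ ∘ I.1.orderEmbOfFin I.2)
        (σ.injective.comp (I.1.orderEmbOfFin I.2).injective)⟩) <| by
    rintro M N ⟨g, t, h⟩
    refine ⟨g, t ∘ σ, ?_⟩
    change N.1.submatrix id σ = _
    rw [h]
    ext i j
    simp only [Matrix.submatrix_apply, Matrix.mul_diagonal, id_eq]
    rfl

/-! ### Cross-ratios -/

/-- A (generalized, signed) cross-ratio: a Laurent monomial in the Pluecker coordinates, up to
sign, in which every label occurs equally often in the numerator and in the denominator. -/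
structure CrossRatio where
  sign : ℤˣ
  expo : Triple → ℤ
  balanced : ∀ j : Fin 6, ∑ I : Triple with j ∈ I.1, expo I = 0

/-- The value of a cross-ratio at a matrix. -/
def CrossRatio.evalMat (c : CrossRatio) (M : Matrix (Fin 3) (Fin 6) ℝ) : ℝ :=
  ((c.sign : ℤ) : ℝ) * ∏ I, minor M I ^ c.expo I

lemma CrossRatio.evalMat_eq (c : CrossRatio) {M N : Matrix (Fin 3) (Fin 6) ℝ}
    (h : SameConfig M N) : c.evalMat M = c.evalMat N := by
  obtain ⟨g, t, rfl⟩ := h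
  have hz : ∀ (u : ℝˣ) (s : Finset Triple), ∏ I ∈ s, u ^ c.expo I = u ^ ∑ I ∈ s, c.expo I := by
    intro u s
    induction s using Finset.induction_on with
    | empty => simp
    | insert a s ha ih => rw [Finset.prod_insert ha, Finset.sum_insert ha, ih, zpow_add]
  have hsum : ∑ I, c.expo I = 0 := by
    have h1 : ∑ j : Fin 6, ∑ I : Triple with j ∈ I.1, c.expo I = 0 :=
      Finset.sum_eq_zero fun j _ => c.balanced j
    simp only [Finset.sum_filter] at h1
    rw [Finset.sum_comm] at h1
    have h2 : ∀ I : Triple, ∑ j : Fin 6, (if j ∈ I.1 then c.expo I else 0) = 3 * c.expo I := by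
      intro I
      rw [← Finset.sum_filter, Finset.filter_mem_eq_inter, Finset.univ_inter, Finset.sum_const,
        I.2]
      simp
    simp only [h2, ← Finset.mul_sum] at h1
    omega
  have hdet : ∏ I : Triple, g.1.det ^ c.expo I = 1 := by
    have := hz (Matrix.GeneralLinearGroup.det g) Finset.univ
    rw [hsum, zpow_zero] at this
    have h3 := congrArg (Units.val) this
    simpa using h3
  have htor : ∏ I : Triple, (∏ j ∈ I.1, ((t j : ℝˣ) : ℝ)) ^ c.expo I = 1 := by
    have : ∏ I : Triple, (∏ j ∈ I.1, t j) ^ c.expo I = 1 := by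
      have h4 : ∀ I : Triple, (∏ j ∈ I.1, t j) ^ c.expo I =
          ∏ j : Fin 6, if j ∈ I.1 then t j ^ c.expo I else 1 := by
        intro I
        rw [← Finset.prod_zpow, ← Finset.prod_filter, Finset.filter_mem_eq_inter,
          Finset.univ_inter]
      simp only [h4]
      rw [Finset.prod_comm]
      refine Finset.prod_eq_one fun j _ => ?_
      rw [← Finset.prod_filter, hz, c.balanced j, zpow_zero]
    have h3 := congrArg (Units.val) this
    simpa using h3
  simp only [CrossRatio.evalMat, minor_act, mul_zpow, Finset.prod_mul_distrib, hdet, htor,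
    one_mul, mul_one]

/-- A cross-ratio as a function on the configuration space. -/
def CrossRatio.eval (c : CrossRatio) : X36 → ℝ :=
  Quotient.lift (fun M : GenMat => c.evalMat M.1) fun _ _ h => c.evalMat_eq h

/-- The map to `ℝ^4` given by four cross-ratios. -/
def crossRatioMap (c : Fin 4 → CrossRatio) (x : X36) : E4 :=
  WithLp.toLp 2 fun i => (c i).eval x

/-! ### Rational parametrizations -/

/-- Polynomials in four variables. -/
abbrev Poly4 : Type := MvPolynomial (Fin 4) ℝ

/-- Rational functions in four variables. -/
abbrev Rat4 : Type := FractionRing Poly4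

/-- The numerator of a rational function, in lowest terms. -/
def numer (r : Rat4) : Poly4 := IsFractionRing.num Poly4 r

/-- The denominator of a rational function, in lowest terms. -/
def denom (r : Rat4) : Poly4 := (IsFractionRing.den Poly4 r : Poly4)

/-- The value of a rational function at a point where its denominator does not vanish. -/
def evalRat (r : Rat4) (y : E4) : ℝ :=
  MvPolynomial.eval (fun i => y i) (numer r) / MvPolynomial.eval (fun i => y i) (denom r)

/-- The entrywise value of a matrix of rational functions. -/
def evalMatrix (A : Matrix (Fin 3) (Fin 6) Rat4) (y : E4) : Matrix (Fin 3) (Fin 6) ℝ :=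
  A.map fun r => evalRat r y

/-- The Zariski-open domain on which a matrix of rational functions defines a configuration. -/
def paramDomain (A : Matrix (Fin 3) (Fin 6) Rat4) : Set E4 :=
  {y | (∀ i j, MvPolynomial.eval (fun k => y k) (denom (A i j)) ≠ 0) ∧ Generic (evalMatrix A y)}

/-- The rational map from `ℝ^4` to `X(3,6)` given by a matrix of rational functions. -/
def paramMap (A : Matrix (Fin 3) (Fin 6) Rat4) (y : paramDomain A) : X36 :=
  mk (evalMatrix A y) y.2.2

/-- The rational map given by `A` and the map given by four cross-ratios are mutually inverse
between the nonempty Zariski-open set `paramDomain A` and its preimage in `X(3,6)`. -/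
def IsBirationalPair (A : Matrix (Fin 3) (Fin 6) Rat4) (c : Fin 4 → CrossRatio) : Prop :=
  (paramDomain A).Nonempty ∧
  (∀ y : paramDomain A, crossRatioMap c (paramMap A y) = y) ∧
  ∀ (x : X36) (h : crossRatioMap c x ∈ paramDomain A), paramMap A ⟨crossRatioMap c x, h⟩ = x

/-- The open positive orthant of `ℝ^4`. -/
def posOrthant : Opens E4 where
  carrier := {y | ∀ i, 0 < y i}
  is_open' := by
    simp only [Set.ofPred_forall]
    exact isOpen_iInter_of_finite fun i => isOpen_lt continuous_const (by fun_prop)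

/-! ### Logarithmic forms -/

/-- The wedge product `dlog c₀ ∧ dlog c₁ ∧ dlog c₂ ∧ dlog c₃` on the manifold `X(3,6)`.  Note that
`Real.log` is the logarithm of the absolute value, and cross-ratios vanish nowhere. -/
def logForm (c : Fin 4 → CrossRatio) (x : X36) : TangentSpace 𝓘(ℝ, E4) x [⋀^Fin 4]→ₗ[ℝ] ℝ :=
  (Matrix.detRowAlternating : (Fin 4 → ℝ) [⋀^Fin 4]→ₗ[ℝ] ℝ).compLinearMap
    (LinearMap.pi fun i =>
      (mfderiv 𝓘(ℝ, E4) 𝓘(ℝ, ℝ) (fun z => Real.log ((c i).eval z)) x :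
        TangentSpace 𝓘(ℝ, E4) x →L[ℝ] ℝ).toLinearMap)

/-- The canonical form `dlog y₀ ∧ dlog y₁ ∧ dlog y₂ ∧ dlog y₃` of the positive orthant. -/
def orthantForm (y : posOrthant) : TangentSpace 𝓘(ℝ, E4) y [⋀^Fin 4]→ₗ[ℝ] ℝ :=
  (Matrix.detRowAlternating : (Fin 4 → ℝ) [⋀^Fin 4]→ₗ[ℝ] ℝ).compLinearMap
    (LinearMap.pi fun i =>
      (mfderiv 𝓘(ℝ, E4) 𝓘(ℝ, ℝ) (fun z : posOrthant => Real.log ((z : E4) i)) y :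
        TangentSpace 𝓘(ℝ, E4) y →L[ℝ] ℝ).toLinearMap)

/-! ### Newton polytopes and normal fans -/

/-- The Newton polytope of a polynomial: the convex hull of its exponent vectors. -/
def newtonPolytope (f : Poly4) : Set E4 :=
  convexHull ℝ {x | ∃ m ∈ f.support, x = WithLp.toLp 2 fun i => ((m i : ℕ) : ℝ)}

/-- The interior of a set in Euclidean space, as an open submanifold. -/
def interiorOpens (P : Set E4) : Opens E4 := ⟨interior P, isOpen_interior⟩

/-- The face of `P` on which the linear functional `w` is minimal. -/
def face (P : Set E4) (w : E4) : Set E4 :=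
  {x ∈ P | ∀ z ∈ P, inner ℝ w x ≤ inner ℝ w z}

/-- The cones of the (inner) normal fan of `P`. -/
def normalFan (P : Set E4) : Set (Set E4) :=
  {C | ∃ w, C = {u | face P w ⊆ face P u}}

/-- `f` is an irreducible polynomial that occurs in the maximal minors of `A`: it divides the
numerator or the denominator of one of them. -/
def OccursInMinors (A : Matrix (Fin 3) (Fin 6) Rat4) (f : Poly4) : Prop :=
  Irreducible f ∧ ∃ I, f ∣ numer (minor A I) ∨ f ∣ denom (minor A I)

/-- `F` lists the irreducible polynomials occurring in the minors of `A`, each exactly once up to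
a constant factor. -/
def ListsFactors (A : Matrix (Fin 3) (Fin 6) Rat4) (F : Finset Poly4) : Prop :=
  (∀ f ∈ F, OccursInMinors A f) ∧ ∀ f, OccursInMinors A f → ∃! g, g ∈ F ∧ Associated f g

/-! ### The chirotropical Grassmannian -/

/-- The Pluecker ideal: all polynomial relations between the maximal minors of a `3 × 6` matrix
with indeterminate entries. -/
def plueckerIdeal : Ideal (MvPolynomial Triple ℤ) :=
  RingHom.ker (MvPolynomial.aeval (R := ℤ)
    (fun I => minor (Matrix.mvPolynomialX (Fin 3) (Fin 6) ℤ) I)).toRingHom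

/-- The value at `χ` of the term of `g` with exponent vector `m`. -/
def termAt (χ : SignVector) (g : MvPolynomial Triple ℤ) (m : Triple →₀ ℕ) : ℤ :=
  g.coeff m * m.prod fun I k => ((χ I : ℤˣ) : ℤ) ^ k

/-- The tropical polynomial: the minimum over a finite set of exponents, which is `⊤` if the set
is empty. -/
def tropMin (s : Finset (Triple →₀ ℕ)) (π : Triple → ℝ) : WithTop ℝ :=
  s.inf fun m => ((m.sum fun I k => (k : ℝ) * π I : ℝ) : WithTop ℝ)

/-- The chirotropical hypersurface of `g`: the minimum over the terms that are positive at `χ`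
agrees with the minimum over the terms that are negative at `χ`. -/
def chiroHypersurface (χ : SignVector) (g : MvPolynomial Triple ℤ) : Set (Triple → ℝ) :=
  {π | tropMin (g.support.filter fun m => 0 < termAt χ g m) π =
    tropMin (g.support.filter fun m => termAt χ g m < 0) π}

/-- The chirotropical Grassmannian `Trop^χ G(3,6)`. -/
def chiroGrassmannian (χ : SignVector) : Set (Triple → ℝ) :=
  {π | ∀ g ∈ plueckerIdeal, π ∈ chiroHypersurface χ g}

/-- The coordinate `π_{lab}`, for distinct `l`, `a`, `b`. -/
def coordAt (π : Triple → ℝ) (l a b : Fin 6) : ℝ :=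
  if h : ({l, a, b} : Finset (Fin 6)).card = 3 then π ⟨{l, a, b}, h⟩ else 0

/-- In the three-term Pluecker relation
`p_{lab} p_{lcd} - p_{lac} p_{lbd} + p_{lad} p_{lbc} = 0`, the term `p_{lab} p_{lcd}` attains the
tropical minimum at `π`. -/
def AttainsMin (π : Triple → ℝ) (l a b c d : Fin 6) : Prop :=
  coordAt π l a b + coordAt π l c d ≤ coordAt π l a c + coordAt π l b d ∧
  coordAt π l a b + coordAt π l c d ≤ coordAt π l a d + coordAt π l b c

/-- The cone of `Trop^χ G(3,6)` whose relative interior contains `π`: all points at which every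
three-term Pluecker relation attains its tropical minimum at least at the same terms as at `π`. -/
def chiroCone (χ : SignVector) (π : Triple → ℝ) : Set (Triple → ℝ) :=
  {ρ ∈ chiroGrassmannian χ | ∀ l a b c d : Fin 6, [l, a, b, c, d].Nodup →
    AttainsMin π l a b c d → AttainsMin ρ l a b c d}

/-- The cones of the polyhedral fan `Trop^χ G(3,6)`.  Two points lie in the same relatively open
cone exactly when they induce the same splits of the octahedral faces of the hypersimplex.  All
cones contain the lineality space, so this is also the set of cones modulo lineality. -/
def chiroFan (χ : SignVector) : Set (Set (Triple → ℝ)) :=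
  {C | ∃ π ∈ chiroGrassmannian χ, C = chiroCone χ π}

end Chirotopal

end

open Set TopologicalSpace
open scoped Manifold ContDiff Matrix

noncomputable section

namespace Chirotopal

/-! ### Ordered triples of labels -/

/-- The 3-subset `{a, b, c}`, with a junk value if the labels are not distinct. -/
def tri (a b c : Fin 6) : Triple :=
  if h : ({a, b, c} : Finset (Fin 6)).card = 3 then ⟨{a, b, c}, h⟩ else ⟨{0, 1, 2}, by decide⟩

/-- The sign of the permutation that sorts three distinct labels. -/
def sgn3 (a b c : Fin 6) : ℤˣ :=
  (if a < b then 1 else -1) * (if a < c then 1 else -1) * (if b < c then 1 else -1)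

/-- The alternating extension of a sign vector to ordered triples. -/
def ochi (χ : SignVector) (a b c : Fin 6) : ℤˣ := sgn3 a b c * χ (tri a b c)

lemma tri_eq {a b c : Fin 6} (h : ({a, b, c} : Finset (Fin 6)).card = 3) :
    tri a b c = ⟨{a, b, c}, h⟩ := dif_pos h

lemma card_insert_three {a b c : Fin 6} (hab : a ≠ b) (hac : a ≠ c) (hbc : b ≠ c) :
    ({a, b, c} : Finset (Fin 6)).card = 3 := by
  rw [Finset.card_eq_three]; exact ⟨a, b, c, hab, hac, hbc, rfl⟩

lemma tri_val {a b c : Fin 6} (hab : a ≠ b) (hac : a ≠ c) (hbc : b ≠ c) :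
    (tri a b c).1 = {a, b, c} := by rw [tri_eq (card_insert_three hab hac hbc)]

lemma tri_swap12 (a b c : Fin 6) : tri a b c = tri b a c := by
  have : ({a, b, c} : Finset (Fin 6)) = {b, a, c} := Finset.insert_comm a b {c}
  unfold tri; simp only [this]

lemma tri_swap23 (a b c : Fin 6) : tri a b c = tri a c b := by
  have : ({a, b, c} : Finset (Fin 6)) = {a, c, b} := by rw [Finset.pair_comm b c]
  unfold tri; simp only [this]

lemma exists_tri (I : Triple) : ∃ a b c : Fin 6, a < b ∧ b < c ∧ I = tri a b c := by
  refine ⟨I.1.orderEmbOfFin I.2 0, I.1.orderEmbOfFin I.2 1, I.1.orderEmbOfFin I.2 2,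
    (I.1.orderEmbOfFin I.2).strictMono (by decide), (I.1.orderEmbOfFin I.2).strictMono (by decide), ?_⟩
  have h : I.1 = {I.1.orderEmbOfFin I.2 0, I.1.orderEmbOfFin I.2 1, I.1.orderEmbOfFin I.2 2} := by
    ext x
    have hx : x ∈ I.1 ↔ ∃ k, I.1.orderEmbOfFin I.2 k = x := by
      rw [← Finset.mem_coe, ← Finset.range_orderEmbOfFin I.1 I.2, Set.mem_range]
    rw [hx, Fin.exists_fin_succ, Fin.exists_fin_succ, Fin.exists_fin_succ]
    simp only [Finset.mem_insert, Finset.mem_singleton, eq_comm (b := x), IsEmpty.exists_iff,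
      or_false]
    rfl
  apply Subtype.ext
  rw [tri_val]
  · exact h
  · exact (I.1.orderEmbOfFin I.2).injective.ne (by decide)
  · exact (I.1.orderEmbOfFin I.2).injective.ne (by decide)
  · exact (I.1.orderEmbOfFin I.2).injective.ne (by decide)

lemma minor_tri {R : Type*} [CommRing R] (M : Matrix (Fin 3) (Fin 6) R) {a b c : Fin 6}
    (hab : a < b) (hbc : b < c) : minor M (tri a b c) = det3 M ![a, b, c] := by
  have hac := hab.trans hbc
  have : ⇑((tri a b c).1.orderEmbOfFin (tri a b c).2) = ![a, b, c] := by
    refine (Finset.orderEmbOfFin_unique (tri a b c).2 (f := ![a, b, c]) ?_ ?_).symm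
    · intro x
      rw [tri_val hab.ne hac.ne hbc.ne]
      fin_cases x <;> simp
    · intro x y hxy
      fin_cases x <;> fin_cases y <;> simp_all
  rw [minor, this, det3]

lemma det3_swap12 {R : Type*} [CommRing R] (M : Matrix (Fin 3) (Fin 6) R) (a b c : Fin 6) :
    det3 M ![a, b, c] = - det3 M ![b, a, c] := by
  simp [det3, Matrix.det_fin_three]; ring

lemma det3_swap23 {R : Type*} [CommRing R] (M : Matrix (Fin 3) (Fin 6) R) (a b c : Fin 6) :
    det3 M ![a, b, c] = - det3 M ![a, c, b] := by
  simp [det3, Matrix.det_fin_three]; ring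

lemma sgn3_swap12 {a b : Fin 6} (c : Fin 6) (h : a ≠ b) : sgn3 a b c = - sgn3 b a c := by
  revert a b c; decide

lemma sgn3_swap23 (a : Fin 6) {b c : Fin 6} (h : b ≠ c) : sgn3 a b c = - sgn3 a c b := by
  revert a b c; decide

lemma ochi_swap12 (χ : SignVector) {a b : Fin 6} (c : Fin 6) (h : a ≠ b) :
    ochi χ a b c = - ochi χ b a c := by
  rw [ochi, ochi, sgn3_swap12 c h, tri_swap12, neg_mul]

lemma ochi_swap23 (χ : SignVector) (a : Fin 6) {b c : Fin 6} (h : b ≠ c) :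
    ochi χ a b c = - ochi χ a c b := by
  rw [ochi, ochi, sgn3_swap23 a h, tri_swap23, neg_mul]

/-- To prove a statement about all ordered triples of distinct labels, one may sort them. -/
lemma sorted_induction {p : Fin 6 → Fin 6 → Fin 6 → Prop}
    (h12 : ∀ a b c, a ≠ b → a ≠ c → b ≠ c → p b a c → p a b c)
    (h23 : ∀ a b c, a ≠ b → a ≠ c → b ≠ c → p a c b → p a b c)
    (h : ∀ a b c, a < b → b < c → p a b c) {a b c : Fin 6}
    (hab : a ≠ b) (hac : a ≠ c) (hbc : b ≠ c) : p a b c := by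
  rcases lt_or_gt_of_ne hab with h1 | h1 <;> rcases lt_or_gt_of_ne hac with h2 | h2 <;>
    rcases lt_or_gt_of_ne hbc with h3 | h3
  · exact h _ _ _ h1 h3
  · exact h23 _ _ _ hab hac hbc (h _ _ _ h2 h3)
  · exact absurd (h1.trans h3) h2.not_gt
  · exact h23 _ _ _ hab hac hbc (h12 _ _ _ hac hab hbc.symm (h _ _ _ h2 h1))
  · exact h12 _ _ _ hab hac hbc (h _ _ _ h1 h2)
  · exact absurd (h1.trans h2) h3.not_gt
  · exact h12 _ _ _ hab hac hbc (h23 _ _ _ hab.symm hbc hac (h _ _ _ h3 h2))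
  · exact h12 _ _ _ hab hac hbc (h23 _ _ _ hab.symm hbc hac
      (h12 _ _ _ hbc hab.symm hac.symm (h _ _ _ h3 h1)))

lemma det3_eq {R : Type*} [CommRing R] (M : Matrix (Fin 3) (Fin 6) R) {a b c : Fin 6}
    (hab : a ≠ b) (hac : a ≠ c) (hbc : b ≠ c) :
    det3 M ![a, b, c] = ((sgn3 a b c : ℤ) : R) * minor M (tri a b c) := by
  refine sorted_induction (p := fun a b c => det3 M ![a, b, c] =
    ((sgn3 a b c : ℤ) : R) * minor M (tri a b c)) ?_ ?_ ?_ hab hac hbc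
  · intro a b c h1 h2 h3 h
    rw [det3_swap12, h, sgn3_swap12 c h1, tri_swap12 a b c]; simp
  · intro a b c h1 h2 h3 h
    rw [det3_swap23, h, sgn3_swap23 a h3, tri_swap23 a b c]; simp
  · intro a b c h1 h2
    rw [minor_tri M h1 h2, sgn3]; simp [h1, h2, h1.trans h2]

lemma det3_pluecker {R : Type*} [CommRing R] (M : Matrix (Fin 3) (Fin 6) R) (l a b c d : Fin 6) :
    det3 M ![l, a, b] * det3 M ![l, c, d] - det3 M ![l, a, c] * det3 M ![l, b, d] +
      det3 M ![l, a, d] * det3 M ![l, b, c] = 0 := by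
  simp [det3, Matrix.det_fin_three]; ring

/-- The three-term relations in the sign-adjusted Pluecker coordinates `P_I = χ_I p_I`: the term
whose sign is opposite to the two others equals their sum. -/
def ThreeTerm (χ : SignVector) {S : Type*} [Mul S] [Add S] (P : Triple → S) : Prop :=
  ∀ l a b c d : Fin 6, [l, a, b, c, d].Nodup →
    ochi χ l a b * ochi χ l c d = ochi χ l a c * ochi χ l b d →
    ochi χ l a b * ochi χ l c d = -(ochi χ l a d * ochi χ l b c) →
    P (tri l a b) * P (tri l c d) = P (tri l a c) * P (tri l b d) + P (tri l a d) * P (tri l b c)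

lemma det3_eq_ochi {R : Type*} [CommRing R] (χ : SignVector) (M : Matrix (Fin 3) (Fin 6) R)
    {a b c : Fin 6} (hab : a ≠ b) (hac : a ≠ c) (hbc : b ≠ c) :
    det3 M ![a, b, c] =
      ((ochi χ a b c : ℤ) : R) * (((χ (tri a b c) : ℤ) : R) * minor M (tri a b c)) := by
  rw [det3_eq M hab hac hbc, ochi]
  rcases Int.units_eq_one_or (χ (tri a b c)) with h | h <;> simp [h]

lemma threeTerm_minor {R : Type*} [CommRing R] (χ : SignVector)
    (M : Matrix (Fin 3) (Fin 6) R) : ThreeTerm χ fun I => ((χ I : ℤ) : R) * minor M I := by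
  intro l a b c d hn h1 h2
  have hp := det3_pluecker M l a b c d
  simp only [List.nodup_cons, List.mem_cons, List.not_mem_nil, or_false, not_or] at hn
  obtain ⟨⟨hla, hlb, hlc, hld⟩, ⟨hab, hac, had⟩, ⟨hbc, hbd⟩, hcd, -⟩ := hn
  rw [det3_eq_ochi χ M hla hlb hab, det3_eq_ochi χ M hlc hld hcd, det3_eq_ochi χ M hla hlc hac,
    det3_eq_ochi χ M hlb hld hbd, det3_eq_ochi χ M hla hld had, det3_eq_ochi χ M hlb hlc hbc] at hp
  have e1 : ((ochi χ l a b : ℤ) : R) * ((ochi χ l c d : ℤ) : R) =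
      ((ochi χ l a c : ℤ) : R) * ((ochi χ l b d : ℤ) : R) := by
    exact_mod_cast congrArg (fun u : ℤˣ => ((u : ℤ) : R)) h1
  have e2 : ((ochi χ l a b : ℤ) : R) * ((ochi χ l c d : ℤ) : R) =
      -(((ochi χ l a d : ℤ) : R) * ((ochi χ l b c : ℤ) : R)) := by
    have := congrArg (fun u : ℤˣ => ((u : ℤ) : R)) h2
    push_cast at this
    exact this
  have e3 : (((ochi χ l a b : ℤ) : R) * ((ochi χ l c d : ℤ) : R)) ^ 2 = 1 := by
    rcases Int.units_eq_one_or (ochi χ l a b) with h | h <;>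
      rcases Int.units_eq_one_or (ochi χ l c d) with h' | h' <;> simp [h, h']
  set u := ((ochi χ l a b : ℤ) : R) * ((ochi χ l c d : ℤ) : R)
  beta_reduce
  generalize ((χ (tri l a b) : ℤ) : R) * minor M (tri l a b) = p1 at *
  generalize ((χ (tri l c d) : ℤ) : R) * minor M (tri l c d) = p2 at *
  generalize ((χ (tri l a c) : ℤ) : R) * minor M (tri l a c) = p3 at *
  generalize ((χ (tri l b d) : ℤ) : R) * minor M (tri l b d) = p4 at *
  generalize ((χ (tri l a d) : ℤ) : R) * minor M (tri l a d) = p5 at *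
  generalize ((χ (tri l b c) : ℤ) : R) * minor M (tri l b c) = p6 at *
  have hp' : u * (p1 * p2 - p3 * p4 - p5 * p6) = 0 := by
    linear_combination hp - p3 * p4 * e1 - p5 * p6 * e2
  linear_combination u * hp' - (p1 * p2 - p3 * p4 - p5 * p6) * e3

/-- The twenty 3-subsets in lexicographic order. -/
def triple : Fin 20 → Triple :=
  ![tri 0 1 2, tri 0 1 3, tri 0 1 4, tri 0 1 5, tri 0 2 3, tri 0 2 4, tri 0 2 5, tri 0 3 4,
    tri 0 3 5, tri 0 4 5, tri 1 2 3, tri 1 2 4, tri 1 2 5, tri 1 3 4, tri 1 3 5, tri 1 4 5,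
    tri 2 3 4, tri 2 3 5, tri 2 4 5, tri 3 4 5]

lemma triple_injective : Function.Injective triple := by decide

lemma triple_bijective : Function.Bijective triple :=
  (Fintype.bijective_iff_injective_and_card _).mpr ⟨triple_injective, by
    rw [Fintype.card_finset_len]; simp; decide⟩

/-- The enumeration of the 3-subsets as an equivalence. -/
def tripleEquiv : Fin 20 ≃ Triple := Equiv.ofBijective triple triple_bijective

lemma forall_triple {p : Triple → Prop} : (∀ I, p I) ↔ ∀ n, p (triple n) :=
  ⟨fun h n => h _, fun h I => by obtain ⟨n, rfl⟩ := triple_bijective.2 I; exact h n⟩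

/-! ### Tropical values of polynomials -/

section TropVal

variable {R : Type*} [CommSemiring R]

lemma weight_eq (u : Fin 4 → ℝ) (m : Fin 4 →₀ ℕ) :
    Finsupp.weight u m = ∑ i, (m i : ℝ) * u i := by
  rw [Finsupp.weight_apply, Finsupp.sum_fintype _ _ fun i => zero_smul ℕ (u i)]
  simp only [nsmul_eq_mul]

/-- The tropical value of a polynomial: the minimal weight of its monomials. -/
def tropVal (f : MvPolynomial (Fin 4) R) (u : Fin 4 → ℝ) : ℝ :=
  sInf (Finsupp.weight u '' (f.support : Set (Fin 4 →₀ ℕ)))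

lemma tropVal_le {f : MvPolynomial (Fin 4) R} {m : Fin 4 →₀ ℕ} (h : m ∈ f.support)
    (u : Fin 4 → ℝ) : tropVal f u ≤ Finsupp.weight u m :=
  csInf_le (f.support.finite_toSet.image _).bddBelow ⟨m, h, rfl⟩

lemma exists_tropVal {f : MvPolynomial (Fin 4) R} (hf : f ≠ 0) (u : Fin 4 → ℝ) :
    ∃ m ∈ f.support, Finsupp.weight u m = tropVal f u := by
  have hne : (Finsupp.weight u '' (f.support : Set (Fin 4 →₀ ℕ))).Nonempty :=
    Set.Nonempty.image _ (by simpa [Finset.nonempty_iff_ne_empty] using hf)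
  obtain ⟨m, hm, h⟩ := hne.csInf_mem (f.support.finite_toSet.image _)
  exact ⟨m, hm, h⟩

lemma tropVal_eq_of {f : MvPolynomial (Fin 4) R} {u : Fin 4 → ℝ} {r : ℝ}
    (h : ∃ m ∈ f.support, Finsupp.weight u m = r) (h' : ∀ m ∈ f.support, r ≤ Finsupp.weight u m) :
    tropVal f u = r := by
  obtain ⟨m, hm, rfl⟩ := h
  refine le_antisymm (tropVal_le hm u) (le_csInf ⟨_, m, hm, rfl⟩ ?_)
  rintro _ ⟨n, hn, rfl⟩
  exact h' n hn

lemma tropVal_mul [NoZeroDivisors R] {f g : MvPolynomial (Fin 4) R} (hf : f ≠ 0) (hg : g ≠ 0)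
    (u : Fin 4 → ℝ) : tropVal (f * g) u = tropVal f u + tropVal g u := by
  classical
  have key : ∀ d m n : Fin 4 →₀ ℕ, m + n = d →
      Finsupp.weight u d = tropVal f u + tropVal g u → m ∈ f.support → n ∈ g.support →
      Finsupp.weight u m = tropVal f u ∧ Finsupp.weight u n = tropVal g u := by
    intro d m n h hd hm hn
    rw [← h, map_add] at hd
    constructor <;> linarith [tropVal_le hm u, tropVal_le hn u]
  set f' := MvPolynomial.weightedHomogeneousComponent u (tropVal f u) f
  set g' := MvPolynomial.weightedHomogeneousComponent u (tropVal g u) g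
  have hf' : f' ≠ 0 := by
    obtain ⟨m, hm, h⟩ := exists_tropVal hf u
    intro h0
    have := congrArg (MvPolynomial.coeff m) h0
    rw [MvPolynomial.coeff_weightedHomogeneousComponent, if_pos h, MvPolynomial.coeff_zero] at this
    exact MvPolynomial.mem_support_iff.mp hm this
  have hg' : g' ≠ 0 := by
    obtain ⟨m, hm, h⟩ := exists_tropVal hg u
    intro h0
    have := congrArg (MvPolynomial.coeff m) h0
    rw [MvPolynomial.coeff_weightedHomogeneousComponent, if_pos h, MvPolynomial.coeff_zero] at this
    exact MvPolynomial.mem_support_iff.mp hm this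
  obtain ⟨d, hd⟩ := MvPolynomial.ne_zero_iff.mp (mul_ne_zero hf' hg')
  have hwd : Finsupp.weight u d = tropVal f u + tropVal g u := by
    obtain ⟨⟨m, n⟩, hmn, hne⟩ := Finset.exists_ne_zero_of_sum_ne_zero (by rwa [MvPolynomial.coeff_mul] at hd)
    rw [Finset.HasAntidiagonal.mem_antidiagonal] at hmn
    have h1 := left_ne_zero_of_mul hne
    have h2 := right_ne_zero_of_mul hne
    simp only [f', g', MvPolynomial.coeff_weightedHomogeneousComponent, ne_eq, ite_eq_right_iff,
      Classical.not_imp] at h1 h2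
    rw [← hmn, map_add, h1.1, h2.1]
  have hcoeff : MvPolynomial.coeff d (f * g) = MvPolynomial.coeff d (f' * g') := by
    rw [MvPolynomial.coeff_mul, MvPolynomial.coeff_mul]
    refine Finset.sum_congr rfl fun ⟨m, n⟩ hmn => ?_
    rw [Finset.HasAntidiagonal.mem_antidiagonal] at hmn
    simp only [f', g', MvPolynomial.coeff_weightedHomogeneousComponent]
    by_cases hm : m ∈ f.support
    · by_cases hn : n ∈ g.support
      · obtain ⟨h1, h2⟩ := key d m n hmn hwd hm hn
        rw [if_pos h1, if_pos h2]
      · rw [MvPolynomial.notMem_support_iff] at hn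
        simp [hn]
    · rw [MvPolynomial.notMem_support_iff] at hm
      simp [hm]
  refine tropVal_eq_of ⟨d, ?_, hwd⟩ fun k hk => ?_
  · rw [MvPolynomial.mem_support_iff, hcoeff]; exact hd
  · obtain ⟨m, hm, n, hn, rfl⟩ := Finset.mem_add.mp (MvPolynomial.support_mul f g hk)
    rw [map_add]
    exact add_le_add (tropVal_le hm u) (tropVal_le hn u)

lemma tropVal_add_le {f : MvPolynomial (Fin 4) R} (hf : f ≠ 0) (w u : Fin 4 → ℝ) :
    tropVal f w + tropVal f u ≤ tropVal f (w + u) := by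
  obtain ⟨m, hm, h⟩ := exists_tropVal hf (w + u)
  have : Finsupp.weight (w + u) m = Finsupp.weight w m + Finsupp.weight u m := by
    simp only [weight_eq, Pi.add_apply, mul_add, Finset.sum_add_distrib]
  rw [← h, this]
  exact add_le_add (tropVal_le hm w) (tropVal_le hm u)

lemma weight_smul (c : ℝ) (u : Fin 4 → ℝ) (m : Fin 4 →₀ ℕ) :
    Finsupp.weight (c • u) m = c * Finsupp.weight u m := by
  simp only [weight_eq, Pi.smul_apply, smul_eq_mul, Finset.mul_sum]
  exact Finset.sum_congr rfl fun i _ => by ring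

lemma weight_sub (w u : Fin 4 → ℝ) (m : Fin 4 →₀ ℕ) :
    Finsupp.weight (w - u) m = Finsupp.weight w m - Finsupp.weight u m := by
  simp only [weight_eq, Pi.sub_apply, mul_sub, Finset.sum_sub_distrib]

lemma tropVal_smul {f : MvPolynomial (Fin 4) R} (hf : f ≠ 0) {c : ℝ} (hc : 0 ≤ c)
    (u : Fin 4 → ℝ) : tropVal f (c • u) = c * tropVal f u := by
  obtain ⟨m, hm, h⟩ := exists_tropVal hf u
  refine tropVal_eq_of ⟨m, hm, by rw [weight_smul, h]⟩ fun k hk => ?_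
  rw [weight_smul]
  exact mul_le_mul_of_nonneg_left (tropVal_le hk u) hc

/-- Every monomial of minimal weight at `w` has minimal weight at `u`. -/
def FaceIncl (f : MvPolynomial (Fin 4) R) (w u : Fin 4 → ℝ) : Prop :=
  ∀ m ∈ f.support, Finsupp.weight w m = tropVal f w → Finsupp.weight u m = tropVal f u

lemma FaceIncl.of_eq {f : MvPolynomial (Fin 4) R} {w u : Fin 4 → ℝ} {ε : ℝ}
    (hε : 0 < ε) (h : tropVal f (w - ε • u) + ε * tropVal f u = tropVal f w) : FaceIncl f w u := by
  intro m hm hw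
  have h1 := tropVal_le hm (w - ε • u)
  rw [weight_sub, weight_smul] at h1
  have h2 : ε * Finsupp.weight u m ≤ ε * tropVal f u := by linarith
  exact le_antisymm (le_of_mul_le_mul_left h2 hε) (tropVal_le hm u)

lemma FaceIncl.exists_eq {f : MvPolynomial (Fin 4) R} {w u : Fin 4 → ℝ} (h : FaceIncl f w u)
    (hf : f ≠ 0) : ∃ δ > 0, ∀ ε, 0 < ε → ε ≤ δ →
      tropVal f (w - ε • u) + ε * tropVal f u = tropVal f w := by
  have h1 : ∀ m ∈ f.support, ∃ δ > 0, ∀ ε, 0 < ε → ε ≤ δ →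
      tropVal f w - ε * tropVal f u ≤ Finsupp.weight w m - ε * Finsupp.weight u m := by
    intro m hm
    rcases (tropVal_le hm w).eq_or_lt with hw | hw
    · refine ⟨1, one_pos, fun ε _ _ => ?_⟩
      rw [h m hm hw.symm, hw]
    · set a := Finsupp.weight w m - tropVal f w
      have ha : 0 < a := sub_pos.mpr hw
      set b := Finsupp.weight u m - tropVal f u
      have hb : 0 ≤ b := sub_nonneg.mpr (tropVal_le hm u)
      refine ⟨a / (b + 1), by positivity, fun ε h0 hle => ?_⟩
      rw [le_div_iff₀ (by positivity)] at hle
      have : ε * b ≤ a := by nlinarith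
      simp only [a, b] at this
      linarith
  choose! δ hδ hδ' using h1
  obtain ⟨m₀, hm₀, hw₀⟩ := exists_tropVal hf w
  have hne : f.support.Nonempty := ⟨m₀, hm₀⟩
  refine ⟨f.support.inf' hne δ, (Finset.lt_inf'_iff hne).mpr fun m hm => hδ m hm,
    fun ε h0 hle => ?_⟩
  rw [Finset.le_inf'_iff] at hle
  have : tropVal f (w - ε • u) = tropVal f w - ε * tropVal f u := by
    refine tropVal_eq_of ⟨m₀, hm₀, ?_⟩ fun m hm => ?_
    · rw [weight_sub, weight_smul, hw₀, h m₀ hm₀ hw₀]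
    · rw [weight_sub, weight_smul]
      exact hδ' m hm ε h0 (hle m hm)
  rw [this]; ring

lemma faceIncl_mul [NoZeroDivisors R] {f g : MvPolynomial (Fin 4) R} (hf : f ≠ 0) (hg : g ≠ 0)
    {w u : Fin 4 → ℝ} : FaceIncl (f * g) w u ↔ FaceIncl f w u ∧ FaceIncl g w u := by
  constructor
  · intro h
    obtain ⟨ε, hε, h1⟩ := h.exists_eq (mul_ne_zero hf hg)
    have h2 := h1 ε hε le_rfl
    rw [tropVal_mul hf hg, tropVal_mul hf hg, tropVal_mul hf hg] at h2
    have hs : ∀ f : MvPolynomial (Fin 4) R, f ≠ 0 →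
        tropVal f (w - ε • u) + ε * tropVal f u ≤ tropVal f w := by
      intro f hf
      have := tropVal_add_le hf (w - ε • u) (ε • u)
      rwa [tropVal_smul hf hε.le, sub_add_cancel] at this
    have h3 := hs f hf
    have h4 := hs g hg
    exact ⟨.of_eq hε (by linarith), .of_eq hε (by linarith)⟩
  · rintro ⟨h1, h2⟩ d hd hw
    obtain ⟨m, hm, n, hn, rfl⟩ := Finset.mem_add.mp (MvPolynomial.support_mul f g hd)
    rw [tropVal_mul hf hg, map_add] at *
    have h3 := tropVal_le hm w
    have h4 := tropVal_le hn w
    rw [h1 m hm (by linarith), h2 n hn (by linarith)]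

lemma FaceIncl.of_dvd [NoZeroDivisors R] {f g : MvPolynomial (Fin 4) R} (hg : g ≠ 0) (h : f ∣ g)
    {w u : Fin 4 → ℝ} (hw : FaceIncl g w u) : FaceIncl f w u := by
  obtain ⟨k, rfl⟩ := h
  exact ((faceIncl_mul (left_ne_zero_of_mul hg) (right_ne_zero_of_mul hg)).mp hw).1

end TropVal

/-- Polynomials with natural coefficients evaluate in the tropical semiring to their tropical
values. -/
lemma aeval_trop {Q : MvPolynomial (Fin 4) ℕ} (hQ : Q ≠ 0) (u : Fin 4 → ℝ) :
    MvPolynomial.aeval (fun i => Tropical.trop ((u i : ℝ) : WithTop ℝ)) Q =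
      Tropical.trop ((tropVal Q u : ℝ) : WithTop ℝ) := by
  have hmono : ∀ m : Fin 4 →₀ ℕ, ∏ i, Tropical.trop ((u i : ℝ) : WithTop ℝ) ^ m i =
      Tropical.trop ((Finsupp.weight u m : ℝ) : WithTop ℝ) := by
    intro m
    apply Tropical.untrop_injective
    rw [untrop_prod, weight_eq]
    simp only [Tropical.untrop_pow, Tropical.untrop_trop, ← nsmul_eq_mul]
    push_cast
    rfl
  have hcast : ∀ n : ℕ, n ≠ 0 → ((n : ℕ) : Tropical (WithTop ℝ)) = 1 := by
    intro n hn
    induction n with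
    | zero => exact absurd rfl hn
    | succ k ih =>
      rcases eq_or_ne k 0 with rfl | hk
      · simp
      · rw [Nat.cast_succ, ih hk, Tropical.add_self]
  rw [MvPolynomial.aeval_def, MvPolynomial.eval₂_eq']
  apply Tropical.untrop_injective
  rw [Finset.untrop_sum', Tropical.untrop_trop]
  apply le_antisymm
  · obtain ⟨m, hm, h⟩ := exists_tropVal hQ u
    refine (Finset.inf_le hm).trans ?_
    rw [Function.comp_apply, hmono, eq_natCast, hcast _ (MvPolynomial.mem_support_iff.mp hm),
      one_mul, Tropical.untrop_trop, h]
  · refine Finset.le_inf fun m hm => ?_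
    rw [Function.comp_apply, hmono, eq_natCast, hcast _ (MvPolynomial.mem_support_iff.mp hm),
      one_mul, Tropical.untrop_trop]
    exact_mod_cast tropVal_le hm u

lemma tropVal_add_nat {f g : MvPolynomial (Fin 4) ℕ} (hf : f ≠ 0) (hg : g ≠ 0) (u : Fin 4 → ℝ) :
    tropVal (f + g) u = min (tropVal f u) (tropVal g u) := by
  have hfg : f + g ≠ 0 := fun h => hf (by
    ext m
    have := congrArg (MvPolynomial.coeff m) h
    simp only [MvPolynomial.coeff_add, MvPolynomial.coeff_zero] at this ⊢
    omega)
  have h := aeval_trop hfg u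
  rw [map_add, aeval_trop hf, aeval_trop hg] at h
  have h' := congrArg Tropical.untrop h
  rw [Tropical.untrop_add] at h'
  simp only [Tropical.untrop_trop] at h'
  exact_mod_cast h'.symm

lemma tropVal_X (i : Fin 4) (u : Fin 4 → ℝ) :
    tropVal (MvPolynomial.X i : MvPolynomial (Fin 4) ℕ) u = u i := by
  have h := aeval_trop (MvPolynomial.X_ne_zero (R := ℕ) i) u
  rw [MvPolynomial.aeval_X] at h
  have h' := congrArg Tropical.untrop h
  simp only [Tropical.untrop_trop] at h'
  exact_mod_cast h'.symm

lemma tropVal_one (u : Fin 4 → ℝ) : tropVal (1 : MvPolynomial (Fin 4) ℕ) u = 0 := by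
  have h := aeval_trop (one_ne_zero (α := MvPolynomial (Fin 4) ℕ)) u
  rw [map_one] at h
  have h' := congrArg Tropical.untrop h
  simp only [Tropical.untrop_trop, Tropical.untrop_one] at h'
  exact_mod_cast h'.symm

lemma support_map_nat (Q : MvPolynomial (Fin 4) ℕ) :
    (MvPolynomial.map (Nat.castRingHom ℝ) Q).support = Q.support :=
  MvPolynomial.support_map_of_injective _ Nat.cast_injective

/-! ### Faces of Newton polytopes -/

lemma inner_toLp_weight (w : E4) (m : Fin 4 →₀ ℕ) :
    inner ℝ w (WithLp.toLp 2 fun i => ((m i : ℕ) : ℝ)) = Finsupp.weight (fun i => w i) m := by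
  simp [PiLp.inner_apply, weight_eq]

lemma le_inner_of_mem_newtonPolytope {f : Poly4} {x : E4} (hx : x ∈ newtonPolytope f) (w : E4) :
    tropVal f (fun i => w i) ≤ inner ℝ w x := by
  have hconv : Convex ℝ {x : E4 | tropVal f (fun i => w i) ≤ inner ℝ w x} :=
    convex_halfSpace_ge (IsLinearMap.mk (inner_add_right w) fun c y => inner_smul_right w y c) _
  refine convexHull_min ?_ hconv hx
  rintro _ ⟨m, hm, rfl⟩
  rw [Set.mem_ofPred_eq, inner_toLp_weight]
  exact tropVal_le hm _

lemma vertex_mem_newtonPolytope {f : Poly4} {m : Fin 4 →₀ ℕ} (hm : m ∈ f.support) :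
    (WithLp.toLp 2 fun i => ((m i : ℕ) : ℝ)) ∈ newtonPolytope f :=
  subset_convexHull ℝ _ ⟨m, hm, rfl⟩

lemma mem_face_iff {f : Poly4} (hf : f ≠ 0) {w x : E4} : x ∈ face (newtonPolytope f) w ↔
    x ∈ newtonPolytope f ∧ inner ℝ w x = tropVal f (fun i => w i) := by
  constructor
  · rintro ⟨hx, h⟩
    refine ⟨hx, le_antisymm ?_ (le_inner_of_mem_newtonPolytope hx w)⟩
    obtain ⟨m, hm, hw⟩ := exists_tropVal hf fun i => w i
    rw [← hw, ← inner_toLp_weight]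
    exact h _ (vertex_mem_newtonPolytope hm)
  · rintro ⟨hx, h⟩
    refine ⟨hx, fun z hz => ?_⟩
    rw [h]
    exact le_inner_of_mem_newtonPolytope hz w

lemma face_subset_iff {f : Poly4} (hf : f ≠ 0) (w u : E4) :
    face (newtonPolytope f) w ⊆ face (newtonPolytope f) u ↔
      FaceIncl f (fun i => w i) (fun i => u i) := by
  constructor
  · intro h m hm hw
    have h1 : (WithLp.toLp 2 fun i => ((m i : ℕ) : ℝ)) ∈ face (newtonPolytope f) w :=
      (mem_face_iff hf).mpr ⟨vertex_mem_newtonPolytope hm, by rw [inner_toLp_weight, hw]⟩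
    rw [← inner_toLp_weight]
    exact ((mem_face_iff hf).mp (h h1)).2
  · intro h x hx
    obtain ⟨ε, hε, he⟩ := h.exists_eq hf
    have he := he ε hε le_rfl
    rw [mem_face_iff hf] at hx ⊢
    refine ⟨hx.1, le_antisymm ?_ (le_inner_of_mem_newtonPolytope hx.1 u)⟩
    have h1 := le_inner_of_mem_newtonPolytope hx.1 (w - ε • u)
    rw [inner_sub_left, inner_smul_left, hx.2] at h1
    have h2 : (fun i => (w - ε • u) i) = (fun i => w i) - ε • fun i => u i := rfl
    rw [h2] at h1
    simp only [conj_trivial] at h1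
    have : ε * inner ℝ u x ≤ ε * tropVal f (fun i => u i) := by linarith
    exact le_of_mul_le_mul_left this hε

/-! ### Positive charts -/

/-- A positive chart for the sign vector `χ`: a matrix of polynomials whose minors are, up to the
signs `χ`, polynomials `Q` with natural coefficients, and four cross-ratio exponents `e` that invert
the parametrization.  The field `recon` is stated over all semirings, so that it covers both real
configurations and tropical Pluecker vectors. -/
structure PosChart (χ : SignVector) (A : Matrix (Fin 3) (Fin 6) Poly4) (e : Fin 4 → Triple → ℤ)
    (Q : Triple → MvPolynomial (Fin 4) ℕ) : Prop where
  minor_eq : ∀ I, minor A I = ((χ I : ℤ) : Poly4) * MvPolynomial.map (Nat.castRingHom ℝ) (Q I)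
  ne_zero : ∀ I, Q I ≠ 0
  balanced : ∀ i (j : Fin 6), ∑ I : Triple with j ∈ I.1, e i I = 0
  section_eq : ∀ i, ∏ I, Q I ^ (e i I).toNat = MvPolynomial.X i * ∏ I, Q I ^ (-e i I).toNat
  tie : ∀ i (ρ : Triple → ℝ), (∀ l a b c d : Fin 6, [l, a, b, c, d].Nodup →
    ρ (tri l a b) + ρ (tri l c d) = ρ (tri l a c) + ρ (tri l b d)) → ∑ I, (e i I : ℝ) * ρ I = 0
  recon : ∀ (S : Type) [CommSemiring S] (P : Triple → Sˣ), ThreeTerm χ (fun I => (P I : S)) →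
    ∃ (k : S) (t : Fin 6 → S), ∀ I,
      MvPolynomial.aeval (fun i => ((∏ J, P J ^ e i J : Sˣ) : S)) (Q I) = P I * k * ∏ j ∈ I.1, t j
  rigid : ∀ (w u : Fin 4 → ℝ) (k : ℝ) (t : Fin 6 → ℝ),
    (∀ I : Triple, tropVal (Q I) (w + u) = tropVal (Q I) w + tropVal (Q I) u + (k + ∑ j ∈ I.1, t j)) →
    ∀ I : Triple, k + ∑ j ∈ I.1, t j = 0

/-! ### Tropical three-term relations -/

lemma threeTerm_trop_iff (χ : SignVector) (ρ : Triple → ℝ) :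
    ThreeTerm χ (fun I => Tropical.trop ((ρ I : ℝ) : WithTop ℝ)) ↔
    ∀ l a b c d : Fin 6, [l, a, b, c, d].Nodup →
    ochi χ l a b * ochi χ l c d = ochi χ l a c * ochi χ l b d →
    ochi χ l a b * ochi χ l c d = -(ochi χ l a d * ochi χ l b c) →
    ρ (tri l a b) + ρ (tri l c d) =
      min (ρ (tri l a c) + ρ (tri l b d)) (ρ (tri l a d) + ρ (tri l b c)) := by
  have key : ∀ a b c d e f : ℝ,
      (Tropical.trop (a : WithTop ℝ) * Tropical.trop (b : WithTop ℝ) =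
        Tropical.trop (c : WithTop ℝ) * Tropical.trop (d : WithTop ℝ) +
        Tropical.trop (e : WithTop ℝ) * Tropical.trop (f : WithTop ℝ)) ↔
      a + b = min (c + d) (e + f) := by
    intro a b c d e f
    rw [← Tropical.untrop_inj_iff]
    simp only [Tropical.untrop_mul, Tropical.untrop_add, Tropical.untrop_trop]
    exact_mod_cast Iff.rfl
  simp only [ThreeTerm, key]

lemma nodup_five {l a b c d : Fin 6} (h : [l, a, b, c, d].Nodup) :
    (l ≠ a ∧ l ≠ b ∧ l ≠ c ∧ l ≠ d) ∧ (a ≠ b ∧ a ≠ c ∧ a ≠ d) ∧ (b ≠ c ∧ b ≠ d) ∧ c ≠ d := by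
  simpa [not_or] using h

lemma coordAt_eq (π : Triple → ℝ) {a b c : Fin 6} (hab : a ≠ b) (hac : a ≠ c) (hbc : b ≠ c) :
    coordAt π a b c = π (tri a b c) := by
  have h := card_insert_three hab hac hbc
  rw [coordAt, dif_pos h, tri_eq h]

lemma attainsMin_iff (π : Triple → ℝ) {l a b c d : Fin 6} (h : [l, a, b, c, d].Nodup) :
    AttainsMin π l a b c d ↔
      π (tri l a b) + π (tri l c d) ≤ π (tri l a c) + π (tri l b d) ∧
      π (tri l a b) + π (tri l c d) ≤ π (tri l a d) + π (tri l b c) := by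
  obtain ⟨⟨h1, h2, h3, h4⟩, ⟨h5, h6, h7⟩, ⟨h8, h9⟩, h10⟩ := nodup_five h
  rw [AttainsMin, coordAt_eq π h1 h2 h5, coordAt_eq π h3 h4 h10, coordAt_eq π h1 h3 h6,
    coordAt_eq π h2 h4 h9, coordAt_eq π h1 h4 h7, coordAt_eq π h2 h3 h8]

/-- Every three-term relation attaining its minimum at a term at `π` also does so at `ρ`. -/
def Refines (π ρ : Triple → ℝ) : Prop :=
  ∀ l a b c d : Fin 6, [l, a, b, c, d].Nodup → AttainsMin π l a b c d → AttainsMin ρ l a b c d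

/-- Exactly one of the three terms of a three-term relation is opposite in sign to the others. -/
lemma odd_term (u v w : ℤˣ) (h : ¬(u = -v ∧ u = w)) :
    (u = v ∧ u = -w) ∨ (v = u ∧ v = w) ∨ (w = v ∧ w = -u) := by
  revert u v w; decide

lemma ochi_pluecker {χ : SignVector} (hχ : ∀ l a b c d : Fin 6, [l, a, b, c, d].Nodup →
      ¬(ochi χ l a b * ochi χ l c d = -(ochi χ l a c * ochi χ l b d) ∧
        ochi χ l a b * ochi χ l c d = ochi χ l a d * ochi χ l b c))
    {ρ : Triple → ℝ} (h : ThreeTerm χ (fun I => Tropical.trop ((ρ I : ℝ) : WithTop ℝ)))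
    {l a b c d : Fin 6} (hn : [l, a, b, c, d].Nodup) :
    ρ (tri l a b) + ρ (tri l c d) =
      min (ρ (tri l a c) + ρ (tri l b d)) (ρ (tri l a d) + ρ (tri l b c)) ∧
      (ochi χ l a b * ochi χ l c d = ochi χ l a c * ochi χ l b d ∧
        ochi χ l a b * ochi χ l c d = -(ochi χ l a d * ochi χ l b c)) ∨
    ρ (tri l a c) + ρ (tri l b d) =
      min (ρ (tri l a b) + ρ (tri l c d)) (ρ (tri l a d) + ρ (tri l b c)) ∧
      (ochi χ l a c * ochi χ l b d = ochi χ l a b * ochi χ l c d ∧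
        ochi χ l a c * ochi χ l b d = ochi χ l a d * ochi χ l b c) ∨
    ρ (tri l a d) + ρ (tri l b c) =
      min (ρ (tri l a b) + ρ (tri l c d)) (ρ (tri l a c) + ρ (tri l b d)) ∧
      (ochi χ l a d * ochi χ l b c = ochi χ l a c * ochi χ l b d ∧
        ochi χ l a d * ochi χ l b c = -(ochi χ l a b * ochi χ l c d)) := by
  rw [threeTerm_trop_iff] at h
  obtain ⟨⟨h1, h2, h3, h4⟩, ⟨h5, h6, h7⟩, ⟨h8, h9⟩, h10⟩ := nodup_five hn
  rcases odd_term _ _ _ (hχ l a b c d hn) with ⟨e1, e2⟩ | ⟨e1, e2⟩ | ⟨e1, e2⟩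
  · exact Or.inl ⟨h l a b c d hn e1 e2, e1, e2⟩
  · refine Or.inr (Or.inl ⟨?_, e1, e2⟩)
    have := h l a c b d (by simp_all [eq_comm]) e1 (by rw [ochi_swap23 χ l h8.symm, e2]; simp)
    rw [this, tri_swap23 l c b]
  · refine Or.inr (Or.inr ⟨?_, e1, e2⟩)
    have := h l a d b c (by simp_all [eq_comm])
      (by rw [ochi_swap23 χ l h10.symm, e2]; simp)
      (by rw [ochi_swap23 χ l h9.symm, e1]; simp)
    rw [this, tri_swap23 l d c, tri_swap23 l d b]

namespace PosChart

variable {χ : SignVector} {A : Matrix (Fin 3) (Fin 6) Poly4} {e : Fin 4 → Triple → ℤ}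
  {Q : Triple → MvPolynomial (Fin 4) ℕ}

/-- The value of a polynomial with natural coefficients at the point `(1, ..., 1)` is positive. -/
lemma eval_pos {q : MvPolynomial (Fin 4) ℕ} (hq : q ≠ 0) {y : Fin 4 → ℝ} (hy : ∀ i, 0 < y i) :
    0 < MvPolynomial.aeval y q := by
  rw [MvPolynomial.aeval_def, MvPolynomial.eval₂_eq']
  refine Finset.sum_pos (fun m hm => ?_) (by simpa [Finset.nonempty_iff_ne_empty] using hq)
  have : 0 < q.coeff m := Nat.pos_of_ne_zero (MvPolynomial.mem_support_iff.mp hm)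
  have h2 : ∀ i, 0 < y i ^ m i := fun i => pow_pos (hy i) _
  rw [eq_natCast]
  exact mul_pos (by exact_mod_cast this) (Finset.prod_pos fun i _ => h2 i)

lemma minor_eval (h : PosChart χ A e Q) (y : Fin 4 → ℝ) (I : Triple) :
    minor (A.map (MvPolynomial.eval y)) I = ((χ I : ℤ) : ℝ) * MvPolynomial.aeval y (Q I) := by
  have h1 : minor (A.map (MvPolynomial.eval y)) I = MvPolynomial.eval y (minor A I) := by
    rw [minor, minor, RingHom.map_det]
    rfl
  rw [h1, h.minor_eq, map_mul, map_intCast, MvPolynomial.eval_map]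
  rfl

lemma hasSigns (h : PosChart χ A e Q) {y : Fin 4 → ℝ} (hy : ∀ i, 0 < y i) :
    HasSigns χ (A.map (MvPolynomial.eval y)) := by
  intro I
  rw [h.minor_eval]
  have := eval_pos (h.ne_zero I) hy
  rcases Int.units_eq_one_or (χ I) with h1 | h1
  · simp [h1, sign_pos this]
  · simp [h1, this]

lemma isRealizable (h : PosChart χ A e Q) : IsRealizable χ :=
  ⟨_, h.hasSigns (y := fun _ => 1) fun _ => one_pos⟩

end PosChart

lemma hasSigns_iff_pos {χ : SignVector} {M : Matrix (Fin 3) (Fin 6) ℝ} :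
    HasSigns χ M ↔ ∀ I, 0 < ((χ I : ℤ) : ℝ) * minor M I := by
  refine forall_congr' fun I => ?_
  rcases Int.units_eq_one_or (χ I) with h1 | h1
  · simp [h1, sign_eq_one_iff]
  · simp [h1, sign_eq_neg_one_iff]

lemma IsRealizable.not_all_same {χ : SignVector} (h : IsRealizable χ) (l a b c d : Fin 6)
    (hn : [l, a, b, c, d].Nodup) :
    ¬(ochi χ l a b * ochi χ l c d = -(ochi χ l a c * ochi χ l b d) ∧
        ochi χ l a b * ochi χ l c d = ochi χ l a d * ochi χ l b c) := by
  rintro ⟨e1, e2⟩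
  obtain ⟨M, hM⟩ := h
  rw [hasSigns_iff_pos] at hM
  have hp := det3_pluecker M l a b c d
  obtain ⟨⟨h1, h2, h3, h4⟩, ⟨h5, h6, h7⟩, ⟨h8, h9⟩, h10⟩ := nodup_five hn
  rw [det3_eq_ochi χ M h1 h2 h5, det3_eq_ochi χ M h3 h4 h10, det3_eq_ochi χ M h1 h3 h6,
    det3_eq_ochi χ M h2 h4 h9, det3_eq_ochi χ M h1 h4 h7, det3_eq_ochi χ M h2 h3 h8] at hp
  have p1 := mul_pos (hM (tri l a b)) (hM (tri l c d))
  have p2 := mul_pos (hM (tri l a c)) (hM (tri l b d))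
  have p3 := mul_pos (hM (tri l a d)) (hM (tri l b c))
  generalize ((χ (tri l a b) : ℤ) : ℝ) * minor M (tri l a b) = q1 at *
  generalize ((χ (tri l c d) : ℤ) : ℝ) * minor M (tri l c d) = q2 at *
  generalize ((χ (tri l a c) : ℤ) : ℝ) * minor M (tri l a c) = q3 at *
  generalize ((χ (tri l b d) : ℤ) : ℝ) * minor M (tri l b d) = q4 at *
  generalize ((χ (tri l a d) : ℤ) : ℝ) * minor M (tri l a d) = q5 at *
  generalize ((χ (tri l b c) : ℤ) : ℝ) * minor M (tri l b c) = q6 at *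
  have f1 : ((ochi χ l a b : ℤ) : ℝ) * ((ochi χ l c d : ℤ) : ℝ) =
      -(((ochi χ l a c : ℤ) : ℝ) * ((ochi χ l b d : ℤ) : ℝ)) := by
    have := congrArg (fun u : ℤˣ => ((u : ℤ) : ℝ)) e1
    push_cast at this
    exact this
  have f2 : ((ochi χ l a b : ℤ) : ℝ) * ((ochi χ l c d : ℤ) : ℝ) =
      ((ochi χ l a d : ℤ) : ℝ) * ((ochi χ l b c : ℤ) : ℝ) := by
    have := congrArg (fun u : ℤˣ => ((u : ℤ) : ℝ)) e2
    push_cast at this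
    exact this
  have f3 : ((ochi χ l a b : ℤ) : ℝ) * ((ochi χ l c d : ℤ) : ℝ) ≠ 0 := by
    have : ∀ v : ℤˣ, ((v : ℤ) : ℝ) ≠ 0 := fun v => by exact_mod_cast v.ne_zero
    exact mul_ne_zero (this _) (this _)
  have : ((ochi χ l a b : ℤ) : ℝ) * ((ochi χ l c d : ℤ) : ℝ) * (q1 * q2 + q3 * q4 + q5 * q6) = 0 := by
    linear_combination hp + q3 * q4 * f1 + q5 * q6 * f2
  rcases mul_eq_zero.mp this with h0 | h0
  · exact f3 h0
  · linarith

/-! ### Points of the chirotropical Grassmannian -/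

lemma pluecker_mem (l a b c d : Fin 6) (hn : [l, a, b, c, d].Nodup) :
    (MvPolynomial.C ((sgn3 l a b * sgn3 l c d : ℤˣ) : ℤ) * MvPolynomial.X (tri l a b) *
        MvPolynomial.X (tri l c d) -
      MvPolynomial.C ((sgn3 l a c * sgn3 l b d : ℤˣ) : ℤ) * MvPolynomial.X (tri l a c) *
        MvPolynomial.X (tri l b d) +
      MvPolynomial.C ((sgn3 l a d * sgn3 l b c : ℤˣ) : ℤ) * MvPolynomial.X (tri l a d) *
        MvPolynomial.X (tri l b c) : MvPolynomial Triple ℤ) ∈ plueckerIdeal := by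
  obtain ⟨⟨h1, h2, h3, h4⟩, ⟨h5, h6, h7⟩, ⟨h8, h9⟩, h10⟩ := nodup_five hn
  rw [plueckerIdeal, RingHom.mem_ker]
  have hp := det3_pluecker (Matrix.mvPolynomialX (Fin 3) (Fin 6) ℤ) l a b c d
  rw [det3_eq _ h1 h2 h5, det3_eq _ h3 h4 h10, det3_eq _ h1 h3 h6,
    det3_eq _ h2 h4 h9, det3_eq _ h1 h4 h7, det3_eq _ h2 h3 h8] at hp
  simp only [AlgHom.toRingHom_eq_coe, RingHom.coe_coe, map_add, map_sub, map_mul,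
    MvPolynomial.aeval_X, MvPolynomial.aeval_C]
  rw [← hp]
  simp only [eq_intCast, Units.val_mul, Int.cast_mul]
  ring

lemma tropMin_singleton (m : Triple →₀ ℕ) (π : Triple → ℝ) :
    tropMin {m} π = ((m.sum fun I k => (k : ℝ) * π I : ℝ) : WithTop ℝ) := by
  simp [tropMin]

lemma tropMin_pair (m n : Triple →₀ ℕ) (π : Triple → ℝ) :
    tropMin {m, n} π = ((min (m.sum fun I k => (k : ℝ) * π I)
      (n.sum fun I k => (k : ℝ) * π I) : ℝ) : WithTop ℝ) := by
  simp [tropMin]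

/-- The exponent vector of `p_I p_J`. -/
def pairExp (I J : Triple) : Triple →₀ ℕ := Finsupp.single I 1 + Finsupp.single J 1

lemma pairExp_sum (I J : Triple) (π : Triple → ℝ) :
    ((pairExp I J).sum fun I k => (k : ℝ) * π I) = π I + π J := by
  rw [pairExp, Finsupp.sum_add_index' (by simp) (by intros; push_cast; ring)]
  simp

lemma pairExp_prod (χ : SignVector) (I J : Triple) :
    ((pairExp I J).prod fun I k => ((χ I : ℤˣ) : ℤ) ^ k) = χ I * χ J := by
  rw [pairExp, Finsupp.prod_add_index' (by simp) (by intros; rw [pow_add])]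
  simp

lemma mem_of_pairExp_eq {I J K L : Triple} (h : pairExp I J = pairExp K L) : I = K ∨ I = L := by
  by_contra! hc
  have := DFunLike.congr_fun h I
  simp [pairExp, Finsupp.single_apply, hc.1.symm, hc.2.symm] at this

lemma tri_ne {a b c a' b' c' : Fin 6} (h1 : a ≠ b) (h2 : a ≠ c) (h3 : b ≠ c) (h1' : a' ≠ b')
    (h2' : a' ≠ c') (h3' : b' ≠ c') (x : Fin 6) (hx : x = a ∨ x = b ∨ x = c)
    (hx' : x ≠ a' ∧ x ≠ b' ∧ x ≠ c') : tri a b c ≠ tri a' b' c' := by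
  intro h
  have h0 := congrArg Subtype.val h
  rw [tri_val h1 h2 h3, tri_val h1' h2' h3'] at h0
  have : x ∈ ({a', b', c'} : Finset (Fin 6)) := by rw [← h0]; simpa using hx
  simp only [Finset.mem_insert, Finset.mem_singleton] at this
  tauto

lemma threeTerm_of_mem {χ : SignVector} {π : Triple → ℝ} (hπ : π ∈ chiroGrassmannian χ) :
    ThreeTerm χ (fun I => Tropical.trop ((π I : ℝ) : WithTop ℝ)) := by
  classical
  rw [threeTerm_trop_iff]
  intro l a b c d hn e1 e2
  obtain ⟨⟨h1, h2, h3, h4⟩, ⟨h5, h6, h7⟩, ⟨h8, h9⟩, h10⟩ := nodup_five hn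
  have hg := hπ _ (pluecker_mem l a b c d hn)
  set s1 : ℤˣ := sgn3 l a b * sgn3 l c d
  set s2 : ℤˣ := sgn3 l a c * sgn3 l b d
  set s3 : ℤˣ := sgn3 l a d * sgn3 l b c
  set m1 := pairExp (tri l a b) (tri l c d)
  set m2 := pairExp (tri l a c) (tri l b d)
  set m3 := pairExp (tri l a d) (tri l b c)
  have n12 : m1 ≠ m2 := fun h => (mem_of_pairExp_eq h).elim
    (tri_ne h1 h2 h5 h1 h3 h6 b (by simp) ⟨h2.symm, h5.symm, h8⟩)
    (tri_ne h1 h2 h5 h2 h4 h9 a (by simp) ⟨h1.symm, h5, h7⟩)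
  have n13 : m1 ≠ m3 := fun h => (mem_of_pairExp_eq h).elim
    (tri_ne h1 h2 h5 h1 h4 h7 b (by simp) ⟨h2.symm, h5.symm, h9⟩)
    (tri_ne h1 h2 h5 h2 h3 h8 a (by simp) ⟨h1.symm, h5, h6⟩)
  have n23 : m2 ≠ m3 := fun h => (mem_of_pairExp_eq h).elim
    (tri_ne h1 h3 h6 h1 h4 h7 c (by simp) ⟨h3.symm, h6.symm, h10⟩)
    (tri_ne h1 h3 h6 h2 h3 h8 a (by simp) ⟨h1.symm, h5, h6⟩)
  have hmon : ∀ (s : ℤˣ) (I J : Triple), (MvPolynomial.C ((s : ℤˣ) : ℤ) * MvPolynomial.X I *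
      MvPolynomial.X J : MvPolynomial Triple ℤ) = MvPolynomial.monomial (pairExp I J) (s : ℤ) := by
    intro s I J
    rw [pairExp, mul_assoc, MvPolynomial.X, MvPolynomial.X, MvPolynomial.monomial_mul,
      MvPolynomial.C_mul_monomial]
    simp
  rw [hmon, hmon, hmon] at hg
  set g : MvPolynomial Triple ℤ := MvPolynomial.monomial m1 (s1 : ℤ) -
    MvPolynomial.monomial m2 (s2 : ℤ) + MvPolynomial.monomial m3 (s3 : ℤ) with hgdef
  have c1 : g.coeff m1 = s1 := by
    simp [hgdef, MvPolynomial.coeff_monomial, n12.symm, n13.symm]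
  have c2 : g.coeff m2 = -s2 := by
    simp [hgdef, MvPolynomial.coeff_monomial, n12, n23.symm]
  have c3 : g.coeff m3 = s3 := by
    simp [hgdef, MvPolynomial.coeff_monomial, n13, n23]
  have hsupp : g.support = {m1, m2, m3} := by
    ext m
    simp only [MvPolynomial.mem_support_iff, Finset.mem_insert, Finset.mem_singleton]
    constructor
    · intro h
      by_contra! hc
      apply h
      simp [hgdef, MvPolynomial.coeff_monomial, hc.1.symm, hc.2.1.symm, hc.2.2.symm]
    · rintro (rfl | rfl | rfl)
      · rw [c1]; exact s1.ne_zero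
      · rw [c2]; exact neg_ne_zero.mpr s2.ne_zero
      · rw [c3]; exact s3.ne_zero
  set ε : ℤˣ := ochi χ l a b * ochi χ l c d with hε
  have t1 : termAt χ g m1 = ε := by
    rw [termAt, c1, pairExp_prod, hε]; simp only [ochi, s1, Units.val_mul]; ring
  have t2 : termAt χ g m2 = -ε := by
    rw [termAt, c2, pairExp_prod, e1]; simp only [ochi, s2, Units.val_mul]; ring
  have t3 : termAt χ g m3 = -ε := by
    rw [termAt, c3, pairExp_prod, e2]
    simp only [ochi, s3, Units.val_mul, Units.val_neg]; ring
  have hg' : tropMin (g.support.filter fun m => 0 < termAt χ g m) π =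
    tropMin (g.support.filter fun m => termAt χ g m < 0) π := hg
  rw [hsupp] at hg'
  have goal : tropMin {m1} π = tropMin {m2, m3} π := by
    rcases Int.units_eq_one_or ε with h | h
    · have f1 : ({m1, m2, m3} : Finset (Triple →₀ ℕ)).filter (fun m => 0 < termAt χ g m) = {m1} := by
        ext m
        simp only [Finset.mem_filter, Finset.mem_insert, Finset.mem_singleton]
        constructor
        · rintro ⟨rfl | rfl | rfl, hm⟩
          · rfl
          · rw [t2, h] at hm; norm_num at hm
          · rw [t3, h] at hm; norm_num at hm
        · rintro rfl; rw [t1, h]; simp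
      have f2 : ({m1, m2, m3} : Finset (Triple →₀ ℕ)).filter (fun m => termAt χ g m < 0) =
          {m2, m3} := by
        ext m
        simp only [Finset.mem_filter, Finset.mem_insert, Finset.mem_singleton]
        constructor
        · rintro ⟨rfl | rfl | rfl, hm⟩
          · rw [t1, h] at hm; norm_num at hm
          · simp
          · simp
        · rintro (rfl | rfl)
          · rw [t2, h]; simp
          · rw [t3, h]; simp
      rwa [f1, f2] at hg'
    · have f1 : ({m1, m2, m3} : Finset (Triple →₀ ℕ)).filter (fun m => termAt χ g m < 0) = {m1} := by
        ext m
        simp only [Finset.mem_filter, Finset.mem_insert, Finset.mem_singleton]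
        constructor
        · rintro ⟨rfl | rfl | rfl, hm⟩
          · rfl
          · rw [t2, h] at hm; norm_num at hm
          · rw [t3, h] at hm; norm_num at hm
        · rintro rfl; rw [t1, h]; simp
      have f2 : ({m1, m2, m3} : Finset (Triple →₀ ℕ)).filter (fun m => 0 < termAt χ g m) =
          {m2, m3} := by
        ext m
        simp only [Finset.mem_filter, Finset.mem_insert, Finset.mem_singleton]
        constructor
        · rintro ⟨rfl | rfl | rfl, hm⟩
          · rw [t1, h] at hm; norm_num at hm
          · simp
          · simp
        · rintro (rfl | rfl)
          · rw [t2, h]; simp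
          · rw [t3, h]; simp
      rw [f1, f2] at hg'; exact hg'.symm
  rw [tropMin_singleton, tropMin_pair, pairExp_sum, pairExp_sum, pairExp_sum] at goal
  exact_mod_cast goal

namespace PosChart

variable {χ : SignVector} {A : Matrix (Fin 3) (Fin 6) Poly4} {e : Fin 4 → Triple → ℤ}
  {Q : Triple → MvPolynomial (Fin 4) ℕ}

lemma mem_chiroGrassmannian (h : PosChart χ A e Q) (u : Fin 4 → ℝ) :
    (fun I => tropVal (Q I) u) ∈ chiroGrassmannian χ := by
  classical
  intro g hg
  have hmono : ∀ m : Triple →₀ ℕ, ∏ I, (Tropical.trop ((tropVal (Q I) u : ℝ) : WithTop ℝ)) ^ m I =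
      Tropical.trop ((m.sum fun I k => (k : ℝ) * tropVal (Q I) u : ℝ) : WithTop ℝ) := by
    intro m
    apply Tropical.untrop_injective
    rw [untrop_prod, Finsupp.sum_fintype _ _ fun I => by simp]
    simp only [Tropical.untrop_pow, Tropical.untrop_trop, ← nsmul_eq_mul]
    push_cast
    rfl
  have hcast : ∀ n : ℕ, n ≠ 0 → ((n : ℕ) : Tropical (WithTop ℝ)) = 1 := by
    intro n hn
    induction n with
    | zero => exact absurd rfl hn
    | succ k ih =>
      rcases eq_or_ne k 0 with rfl | hk
      · simp
      · rw [Nat.cast_succ, ih hk, Tropical.add_self]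
  have htrop : ∀ s : Finset (Triple →₀ ℕ), (∀ m ∈ s, termAt χ g m ≠ 0) →
      MvPolynomial.aeval (fun i => Tropical.trop ((u i : ℝ) : WithTop ℝ))
        (∑ m ∈ s, ((termAt χ g m).natAbs : MvPolynomial (Fin 4) ℕ) * ∏ I, Q I ^ m I) =
      Tropical.trop (tropMin s fun I => tropVal (Q I) u) := by
    intro s hs
    apply Tropical.untrop_injective
    rw [map_sum, Finset.untrop_sum', Tropical.untrop_trop, tropMin]
    refine Finset.inf_congr rfl fun m hm => ?_
    rw [Function.comp_apply, map_mul, map_natCast, hcast _ (Int.natAbs_ne_zero.mpr (hs m hm)),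
      one_mul, map_prod]
    simp only [map_pow, aeval_trop (h.ne_zero _)]
    rw [hmono, Tropical.untrop_trop]
  have hzero : ∑ m ∈ g.support, ((termAt χ g m : ℤ) : Poly4) *
      ∏ I, MvPolynomial.map (Nat.castRingHom ℝ) (Q I) ^ m I = 0 := by
    have h1 : MvPolynomial.aeval (R := ℤ) (fun I => minor A I) g = 0 := by
      have h2 : MvPolynomial.aeval (R := ℤ)
          (fun I => minor (Matrix.mvPolynomialX (Fin 3) (Fin 6) ℤ) I) g = 0 := hg
      have h3 := congrArg (MvPolynomial.aeval (R := ℤ) (S₁ := Poly4)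
        fun p : Fin 3 × Fin 6 => A p.1 p.2) h2
      rw [map_zero, ← AlgHom.comp_apply, MvPolynomial.comp_aeval] at h3
      rw [← h3]
      congr 2
      funext I
      rw [minor, minor, AlgHom.map_det]
      congr 1
      ext i j
      simp [Matrix.mvPolynomialX]
    rw [MvPolynomial.aeval_def, MvPolynomial.eval₂_eq'] at h1
    rw [← h1]
    refine Finset.sum_congr rfl fun m _ => ?_
    simp only [h.minor_eq, mul_pow, Finset.prod_mul_distrib, termAt]
    rw [Finsupp.prod_fintype _ _ fun I => by simp]
    push_cast
    rw [eq_intCast]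
    ring
  have hsplit : (∑ m ∈ g.support.filter (fun m => 0 < termAt χ g m),
      ((termAt χ g m).natAbs : MvPolynomial (Fin 4) ℕ) * ∏ I, Q I ^ m I) =
      ∑ m ∈ g.support.filter (fun m => termAt χ g m < 0),
      ((termAt χ g m).natAbs : MvPolynomial (Fin 4) ℕ) * ∏ I, Q I ^ m I := by
    apply MvPolynomial.map_injective (Nat.castRingHom ℝ) Nat.cast_injective
    simp only [map_sum, map_mul, map_natCast, map_prod, map_pow]
    rw [← sub_eq_zero, ← hzero, Finset.sum_filter, Finset.sum_filter, ← Finset.sum_sub_distrib]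
    refine Finset.sum_congr rfl fun m _ => ?_
    rcases lt_trichotomy (termAt χ g m) 0 with h0 | h0 | h0
    · rw [if_neg h0.not_gt, if_pos h0]
      have : (((termAt χ g m).natAbs : ℕ) : Poly4) = -((termAt χ g m : ℤ) : Poly4) := by
        rw [← Int.cast_natCast, Int.ofNat_natAbs_of_nonpos h0.le]; push_cast; rfl
      rw [this]; ring
    · rw [if_neg h0.not_gt, if_neg h0.not_lt, h0]; simp
    · rw [if_pos h0, if_neg h0.not_gt]
      have : (((termAt χ g m).natAbs : ℕ) : Poly4) = ((termAt χ g m : ℤ) : Poly4) := by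
        rw [← Int.cast_natCast, Int.natAbs_of_nonneg h0.le]
      rw [this]; ring
  have e1 := htrop (g.support.filter fun m => 0 < termAt χ g m)
    fun m hm => (Finset.mem_filter.mp hm).2.ne'
  have e2 := htrop (g.support.filter fun m => termAt χ g m < 0)
    fun m hm => (Finset.mem_filter.mp hm).2.ne
  rw [hsplit, e2] at e1
  exact (Tropical.trop_injective e1).symm

end PosChart

/-! ### Tropical charts and the normal fan -/

/-- Real numbers as units of the tropical semiring. -/
def tropUnit : Multiplicative ℝ →* (Tropical (WithTop ℝ))ˣ :=
  Units.map {
      toFun := fun r : Multiplicative ℝ =>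
        (Tropical.trop ((r.toAdd : ℝ) : WithTop ℝ) : Tropical (WithTop ℝ))
      map_one' := rfl
      map_mul' := fun _ _ => rfl } |>.comp (toUnits (G := Multiplicative ℝ)).toMonoidHom

lemma tropUnit_val (r : ℝ) :
    (tropUnit (Multiplicative.ofAdd r) : Tropical (WithTop ℝ)) = Tropical.trop (r : WithTop ℝ) := rfl

/-- The tropicalization of the cross-ratios with exponents `e`. -/
def tcoord (e : Fin 4 → Triple → ℤ) (ρ : Triple → ℝ) (i : Fin 4) : ℝ := ∑ I, (e i I : ℝ) * ρ I

lemma tropUnit_prod (e : Fin 4 → Triple → ℤ) (ρ : Triple → ℝ) (i : Fin 4) :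
    ((∏ I, tropUnit (Multiplicative.ofAdd (ρ I)) ^ e i I : (Tropical (WithTop ℝ))ˣ) :
      Tropical (WithTop ℝ)) = Tropical.trop ((tcoord e ρ i : ℝ) : WithTop ℝ) := by
  simp only [← map_zpow, ← map_prod]
  rw [← tropUnit_val]
  congr 2
  simp only [← ofAdd_zsmul, tcoord, zsmul_eq_mul]
  exact (ofAdd_sum _ _).symm

lemma tcoord_add (e : Fin 4 → Triple → ℤ) (ρ ρ' : Triple → ℝ) :
    tcoord e (ρ + ρ') = tcoord e ρ + tcoord e ρ' := by
  funext i; simp [tcoord, mul_add, Finset.sum_add_distrib]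

lemma tcoord_smul (e : Fin 4 → Triple → ℤ) (c : ℝ) (ρ : Triple → ℝ) :
    tcoord e (c • ρ) = c • tcoord e ρ := by
  funext i
  simp only [tcoord, Pi.smul_apply, smul_eq_mul, Finset.mul_sum]
  exact Finset.sum_congr rfl fun I _ => by ring

lemma exists_mem_triple (j : Fin 6) : ∃ I : Triple, j ∈ I.1 := by
  revert j; decide

lemma refines_of_eq {π ρ : Triple → ℝ} {k : ℝ} {t : Fin 6 → ℝ}
    (h : ∀ I : Triple, ρ I = π I + (k + ∑ j ∈ I.1, t j)) : Refines π ρ := by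
  intro l a b c d hn
  rw [attainsMin_iff π hn, attainsMin_iff ρ hn]
  have hs : ∀ a b c : Fin 6, a ≠ b → a ≠ c → b ≠ c →
      ρ (tri a b c) = π (tri a b c) + (k + (t a + t b + t c)) := by
    intro a b c h1 h2 h3
    rw [h, tri_val h1 h2 h3, Finset.sum_insert (by simp [h1, h2]), Finset.sum_pair h3, add_assoc (t a)]
  obtain ⟨⟨h1, h2, h3, h4⟩, ⟨h5, h6, h7⟩, ⟨h8, h9⟩, h10⟩ := nodup_five hn
  rw [hs _ _ _ h1 h2 h5, hs _ _ _ h3 h4 h10, hs _ _ _ h1 h3 h6, hs _ _ _ h2 h4 h9,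
    hs _ _ _ h1 h4 h7, hs _ _ _ h2 h3 h8]
  rintro ⟨e1, e2⟩
  constructor <;> linarith

lemma Refines.trans {π ρ τ : Triple → ℝ} (h : Refines π ρ) (h' : Refines ρ τ) : Refines π τ :=
  fun l a b c d hn ha => h' l a b c d hn (h l a b c d hn ha)

lemma AttainsMin.swap_bc {π : Triple → ℝ} {l a b c d : Fin 6} (hn : [l, a, b, c, d].Nodup) :
    AttainsMin π l a c b d ↔ π (tri l a c) + π (tri l b d) ≤ π (tri l a b) + π (tri l c d) ∧
      π (tri l a c) + π (tri l b d) ≤ π (tri l a d) + π (tri l b c) := by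
  rw [attainsMin_iff π (by simp_all [eq_comm]), tri_swap23 l c b]

lemma AttainsMin.swap_bd {π : Triple → ℝ} {l a b c d : Fin 6} (hn : [l, a, b, c, d].Nodup) :
    AttainsMin π l a d b c ↔ π (tri l a d) + π (tri l b c) ≤ π (tri l a b) + π (tri l c d) ∧
      π (tri l a d) + π (tri l b c) ≤ π (tri l a c) + π (tri l b d) := by
  rw [attainsMin_iff π (by simp_all [eq_comm]), tri_swap23 l d c, tri_swap23 l d b]

namespace PosChart

variable {χ : SignVector} {A : Matrix (Fin 3) (Fin 6) Poly4} {e : Fin 4 → Triple → ℤ}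
  {Q : Triple → MvPolynomial (Fin 4) ℕ}

/-- The tropicalization of the parametrization. -/
abbrev tparam (Q : Triple → MvPolynomial (Fin 4) ℕ) (u : Fin 4 → ℝ) (I : Triple) : ℝ :=
  tropVal (Q I) u

lemma tropRecon (h : PosChart χ A e Q) {ρ : Triple → ℝ}
    (hρ : ThreeTerm χ (fun I => Tropical.trop ((ρ I : ℝ) : WithTop ℝ))) :
    ∃ (k : ℝ) (t : Fin 6 → ℝ), ∀ I, tparam Q (tcoord e ρ) I = ρ I + (k + ∑ j ∈ I.1, t j) := by
  obtain ⟨k, t, hkt⟩ := h.recon (Tropical (WithTop ℝ))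
    (fun I => tropUnit (Multiplicative.ofAdd (ρ I))) hρ
  simp only [tropUnit_prod] at hkt
  have hkt' : ∀ I : Triple, ((tparam Q (tcoord e ρ) I : ℝ) : WithTop ℝ) =
      (ρ I : WithTop ℝ) + Tropical.untrop k + ∑ j ∈ I.1, Tropical.untrop (t j) := by
    intro I
    have h1 := congrArg Tropical.untrop (hkt I)
    rw [aeval_trop (h.ne_zero I), tropUnit_val, Tropical.untrop_mul, Tropical.untrop_mul,
      untrop_prod] at h1
    exact h1
  have hk : Tropical.untrop k ≠ ⊤ := by
    intro h0
    have := hkt' (tri 0 1 2)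
    rw [h0] at this
    simp at this
  have ht : ∀ j, Tropical.untrop (t j) ≠ ⊤ := by
    intro j h0
    obtain ⟨I, hI⟩ := exists_mem_triple j
    have := hkt' I
    rw [← Finset.add_sum_erase _ _ hI, h0] at this
    simp at this
  obtain ⟨k', hk'⟩ := WithTop.ne_top_iff_exists.mp hk
  choose t' ht' using fun j => WithTop.ne_top_iff_exists.mp (ht j)
  refine ⟨k', t', fun I => ?_⟩
  have := hkt' I
  rw [← hk', Finset.sum_congr rfl fun j _ => (ht' j).symm] at this
  rw [← add_assoc]
  exact_mod_cast this

lemma tcoord_tparam (h : PosChart χ A e Q) (u : Fin 4 → ℝ) : tcoord e (tparam Q u) = u := by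
  funext i
  have hprod : ∀ n : Triple → ℕ, (∏ I, Q I ^ n I ≠ 0) ∧
      tropVal (∏ I, Q I ^ n I) u = ∑ I, (n I : ℝ) * tropVal (Q I) u := by
    intro n
    have hne : ∏ I, Q I ^ n I ≠ 0 :=
      Finset.prod_ne_zero_iff.mpr fun I _ => pow_ne_zero _ (h.ne_zero I)
    refine ⟨hne, ?_⟩
    have h1 := aeval_trop hne u
    simp only [map_prod, map_pow, aeval_trop (h.ne_zero _)] at h1
    have h2 := congrArg Tropical.untrop h1
    rw [untrop_prod] at h2
    simp only [Tropical.untrop_pow, Tropical.untrop_trop, ← WithTop.coe_nsmul,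
      ← WithTop.coe_sum, nsmul_eq_mul] at h2
    exact (WithTop.coe_injective h2).symm
  have h1 := congrArg (fun q => tropVal q u) (h.section_eq i)
  rw [(hprod _).2, tropVal_mul (MvPolynomial.X_ne_zero i) (hprod _).1, (hprod _).2, tropVal_X] at h1
  have h2 : tcoord e (tparam Q u) i = ∑ I, (((e i I).toNat : ℕ) : ℝ) * tropVal (Q I) u -
      ∑ I, (((-e i I).toNat : ℕ) : ℝ) * tropVal (Q I) u := by
    rw [tcoord, ← Finset.sum_sub_distrib]
    refine Finset.sum_congr rfl fun I _ => ?_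
    rw [← sub_mul]
    congr 1
    have := Int.toNat_sub_toNat_neg (e i I)
    exact_mod_cast this.symm
  rw [h2, h1]; ring

lemma threeTerm_tparam (h : PosChart χ A e Q) (u : Fin 4 → ℝ) :
    ThreeTerm χ (fun I => Tropical.trop ((tparam Q u I : ℝ) : WithTop ℝ)) :=
  threeTerm_of_mem (h.mem_chiroGrassmannian u)

lemma refines_tparam (h : PosChart χ A e Q) {w u : Fin 4 → ℝ}
    (hf : ∀ I, FaceIncl (Q I) w u) : Refines (tparam Q w) (tparam Q u) := by
  choose δ hδ hδ' using fun I => (hf I).exists_eq (h.ne_zero I)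
  obtain ⟨ε, hε, hadd⟩ : ∃ ε > 0, ∀ I,
      tropVal (Q I) (w - ε • u) + ε * tropVal (Q I) u = tropVal (Q I) w := by
    have hne : (Finset.univ : Finset Triple).Nonempty := ⟨tri 0 1 2, Finset.mem_univ _⟩
    have hpos : 0 < Finset.univ.inf' hne δ := (Finset.lt_inf'_iff hne).mpr fun I _ => hδ I
    exact ⟨_, hpos, fun I => hδ' I _ hpos (Finset.inf'_le _ (Finset.mem_univ I))⟩
  intro l a b c d hn ha
  have hall := h.isRealizable.not_all_same
  have e1 := ochi_pluecker hall (h.threeTerm_tparam w) hn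
  have e2 := ochi_pluecker hall (h.threeTerm_tparam (w - ε • u)) hn
  have e3 := ochi_pluecker hall (h.threeTerm_tparam u) hn
  rw [attainsMin_iff _ hn] at ha ⊢
  have a1 := hadd (tri l a b)
  have a2 := hadd (tri l c d)
  have a3 := hadd (tri l a c)
  have a4 := hadd (tri l b d)
  have a5 := hadd (tri l a d)
  have a6 := hadd (tri l b c)
  have hz : ∀ v : ℤˣ, v ≠ -v := by decide
  simp only [tparam] at *
  generalize hx1 : ochi χ l a b * ochi χ l c d = x1 at *
  generalize hx2 : ochi χ l a c * ochi χ l b d = x2 at *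
  generalize hx3 : ochi χ l a d * ochi χ l b c = x3 at *
  rcases e1 with ⟨e1, f1, f2⟩ | ⟨e1, f1, f2⟩ | ⟨e1, f1, f2⟩
  · rcases e3 with ⟨e3, -⟩ | ⟨-, g1, g2⟩ | ⟨-, g1, g2⟩
    · rw [e3]; exact ⟨min_le_left _ _, min_le_right _ _⟩
    · exact absurd ((f1.trans g2).symm.trans f2) (hz _)
    · exfalso; subst f1; subst g1; exact hz _ f2
  · rcases e2 with ⟨-, g1, g2⟩ | ⟨e2, -⟩ | ⟨-, g1, g2⟩
    · exfalso; subst f1; subst f2; exact hz _ g2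
    · rcases e3 with ⟨-, g1, g2⟩ | ⟨e3, -⟩ | ⟨-, g1, g2⟩
      · exfalso; subst f1; subst f2; exact hz _ g2
      · have b1 := min_le_left (tropVal (Q (tri l a b)) (w - ε • u) + tropVal (Q (tri l c d)) (w - ε • u))
          (tropVal (Q (tri l a d)) (w - ε • u) + tropVal (Q (tri l b c)) (w - ε • u))
        rw [← e2] at b1
        have b2 := min_le_right (tropVal (Q (tri l a b)) u + tropVal (Q (tri l c d)) u)
          (tropVal (Q (tri l a d)) u + tropVal (Q (tri l b c)) u)
        rw [← e3] at b2
        have : ε * (tropVal (Q (tri l a b)) u + tropVal (Q (tri l c d)) u) ≤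
            ε * (tropVal (Q (tri l a c)) u + tropVal (Q (tri l b d)) u) := by
          linarith [ha.1]
        have := le_of_mul_le_mul_left this hε
        exact ⟨this, this.trans b2⟩
      · exfalso; subst f1; subst f2; exact hz _ g2
    · exfalso; subst f1; subst f2; exact hz _ g2
  · rcases e2 with ⟨-, g1, g2⟩ | ⟨-, g1, g2⟩ | ⟨e2, -⟩
    · exfalso; subst g1; subst f1; exact hz _ f2
    · exfalso; subst g1; subst g2; exact hz _ f2
    · rcases e3 with ⟨-, g1, g2⟩ | ⟨-, g1, g2⟩ | ⟨e3, -⟩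
      · exfalso; subst g1; subst f1; exact hz _ f2
      · exfalso; subst g1; subst g2; exact hz _ f2
      · have b1 := min_le_left (tropVal (Q (tri l a b)) (w - ε • u) + tropVal (Q (tri l c d)) (w - ε • u))
          (tropVal (Q (tri l a c)) (w - ε • u) + tropVal (Q (tri l b d)) (w - ε • u))
        rw [← e2] at b1
        have b2 := min_le_right (tropVal (Q (tri l a b)) u + tropVal (Q (tri l c d)) u)
          (tropVal (Q (tri l a c)) u + tropVal (Q (tri l b d)) u)
        rw [← e3] at b2
        have : ε * (tropVal (Q (tri l a b)) u + tropVal (Q (tri l c d)) u) ≤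
            ε * (tropVal (Q (tri l a d)) u + tropVal (Q (tri l b c)) u) := by
          linarith [ha.2]
        have := le_of_mul_le_mul_left this hε
        exact ⟨this.trans b2, this⟩

lemma faceIncl_of_refines (h : PosChart χ A e Q) {w u : Fin 4 → ℝ}
    (hr : Refines (tparam Q w) (tparam Q u)) (I : Triple) : FaceIncl (Q I) w u := by
  have hall := h.isRealizable.not_all_same
  have hev : ∀ᶠ ε : ℝ in nhdsWithin 0 (Set.Ioi 0), ∀ l a b c d : Fin 6, [l, a, b, c, d].Nodup →
      ochi χ l a b * ochi χ l c d = ochi χ l a c * ochi χ l b d →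
      ochi χ l a b * ochi χ l c d = -(ochi χ l a d * ochi χ l b c) →
      (tparam Q w + (-ε) • tparam Q u) (tri l a b) + (tparam Q w + (-ε) • tparam Q u) (tri l c d) =
      min ((tparam Q w + (-ε) • tparam Q u) (tri l a c) + (tparam Q w + (-ε) • tparam Q u) (tri l b d))
        ((tparam Q w + (-ε) • tparam Q u) (tri l a d) +
          (tparam Q w + (-ε) • tparam Q u) (tri l b c)) := by
    simp only [Filter.eventually_all]
    intro l a b c d hn e1 e2
    have hw := (threeTerm_trop_iff χ _).mp (h.threeTerm_tparam w) l a b c d hn e1 e2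
    have hu := (threeTerm_trop_iff χ _).mp (h.threeTerm_tparam u) l a b c d hn e1 e2
    have r1 := hr l a c b d (by simp_all [eq_comm])
    have r2 := hr l a d b c (by simp_all [eq_comm])
    rw [AttainsMin.swap_bc hn, AttainsMin.swap_bc hn] at r1
    rw [AttainsMin.swap_bd hn, AttainsMin.swap_bd hn] at r2
    simp only [Pi.add_apply, Pi.smul_apply, smul_eq_mul]
    generalize tparam Q w (tri l a b) = x1 at *
    generalize tparam Q w (tri l c d) = x2 at *
    generalize tparam Q w (tri l a c) = y1 at *
    generalize tparam Q w (tri l b d) = y2 at *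
    generalize tparam Q w (tri l a d) = z1 at *
    generalize tparam Q w (tri l b c) = z2 at *
    generalize tparam Q u (tri l a b) = x1' at *
    generalize tparam Q u (tri l c d) = x2' at *
    generalize tparam Q u (tri l a c) = y1' at *
    generalize tparam Q u (tri l b d) = y2' at *
    generalize tparam Q u (tri l a d) = z1' at *
    generalize tparam Q u (tri l b c) = z2' at *
    have small : ∀ p q : ℝ, 0 < p → 0 ≤ q → ∀ᶠ ε : ℝ in nhdsWithin 0 (Set.Ioi 0), ε * q ≤ p := by
      intro p q hp hq
      have : ∀ᶠ ε : ℝ in nhds 0, ε * q < p := by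
        have hc : Continuous fun ε : ℝ => ε * q := by fun_prop
        have := hc.tendsto 0
        rw [zero_mul] at this
        exact this.eventually_lt_const hp
      filter_upwards [nhdsWithin_le_nhds this] with ε h using h.le
    rcases lt_trichotomy (y1 + y2) (z1 + z2) with hlt | heq | hgt
    · rw [min_eq_left hlt.le] at hw
      obtain ⟨r, r'⟩ := r1 ⟨hw.ge, hlt.le⟩
      rw [min_eq_left r'] at hu
      filter_upwards [small (z1 + z2 - (y1 + y2)) (z1' + z2' - (y1' + y2')) (by linarith)
        (by linarith)] with ε hε
      rw [min_eq_left (by linarith)]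
      linear_combination hw - ε * hu
    · rw [heq, min_self] at hw
      obtain ⟨r, r'⟩ := r1 ⟨by linarith, heq.le⟩
      obtain ⟨s, s'⟩ := r2 ⟨by linarith, heq.ge⟩
      have heq' : y1' + y2' = z1' + z2' := le_antisymm r' s'
      rw [heq', min_self] at hu
      refine Filter.Eventually.of_forall fun ε => ?_
      rw [min_eq_left (le_of_eq (by linear_combination heq - ε * heq'))]
      linear_combination hw - ε * hu - heq + ε * heq'
    · rw [min_eq_right hgt.le] at hw
      obtain ⟨r, r'⟩ := r2 ⟨hw.ge, hgt.le⟩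
      rw [min_eq_right r'] at hu
      filter_upwards [small (y1 + y2 - (z1 + z2)) (y1' + y2' - (z1' + z2')) (by linarith)
        (by linarith)] with ε hε
      rw [min_eq_right (by linarith)]
      linear_combination hw - ε * hu
  obtain ⟨ε, hε3, hε⟩ := (hev.and self_mem_nhdsWithin).exists
  have hε : 0 < ε := hε
  have htt := (threeTerm_trop_iff χ (tparam Q w + (-ε) • tparam Q u)).mpr hε3
  obtain ⟨k, t, hkt⟩ := h.tropRecon htt
  rw [tcoord_add, tcoord_smul, h.tcoord_tparam, h.tcoord_tparam] at hkt
  have hwu : w + (-ε) • u = w - ε • u := by rw [neg_smul, sub_eq_add_neg]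
  rw [hwu] at hkt
  have hz := h.rigid (w - ε • u) (ε • u) (-k) (fun j => -t j) (fun J => by
    have h1 := hkt J
    simp only [tparam, Pi.add_apply, Pi.smul_apply, smul_eq_mul] at h1
    rw [sub_add_cancel, tropVal_smul (h.ne_zero J) hε.le, h1, Finset.sum_neg_distrib]
    ring) I
  refine FaceIncl.of_eq hε ?_
  have h1 := hkt I
  simp only [tparam, Pi.add_apply, Pi.smul_apply, smul_eq_mul] at h1
  rw [Finset.sum_neg_distrib] at hz
  linarith

end PosChart

namespace PosChart

variable {χ : SignVector} {A : Matrix (Fin 3) (Fin 6) Poly4} {e : Fin 4 → Triple → ℤ}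
  {Q : Triple → MvPolynomial (Fin 4) ℕ}

lemma refines_tparam_tcoord (h : PosChart χ A e Q) {ρ : Triple → ℝ}
    (hρ : ρ ∈ chiroGrassmannian χ) :
    Refines ρ (tparam Q (tcoord e ρ)) ∧ Refines (tparam Q (tcoord e ρ)) ρ := by
  obtain ⟨k, t, hkt⟩ := h.tropRecon (threeTerm_of_mem hρ)
  refine ⟨refines_of_eq hkt, refines_of_eq (k := -k) (t := fun j => -t j) fun I => ?_⟩
  rw [hkt I, Finset.sum_neg_distrib]; ring

theorem fan_orderIso (h : PosChart χ A e Q) {f : Poly4} (hf : f ≠ 0)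
    (hface : ∀ w u : Fin 4 → ℝ, FaceIncl f w u ↔ ∀ I, FaceIncl (Q I) w u) :
    Nonempty (normalFan (newtonPolytope f) ≃o chiroFan χ) := by
  have hcone : ∀ w : E4, {u | face (newtonPolytope f) w ⊆ face (newtonPolytope f) u} =
      {u : E4 | Refines (tparam Q fun i => w i) (tparam Q fun i => u i)} := by
    intro w
    ext u
    rw [Set.mem_ofPred_eq, Set.mem_ofPred_eq, face_subset_iff hf, hface]
    exact ⟨h.refines_tparam, h.faceIncl_of_refines⟩
  let T : (Triple → ℝ) → E4 := fun ρ => WithLp.toLp 2 (tcoord e ρ)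
  let F : Set E4 → Set (Triple → ℝ) := fun C => {ρ ∈ chiroGrassmannian χ | T ρ ∈ C}
  have hchiro : ∀ π ∈ chiroGrassmannian χ, chiroCone χ π =
      F {u : E4 | Refines (tparam Q (tcoord e π)) (tparam Q fun i => u i)} := by
    intro π hπ
    ext ρ
    refine and_congr_right fun hρ => ?_
    obtain ⟨h1, h2⟩ := h.refines_tparam_tcoord hπ
    obtain ⟨h3, h4⟩ := h.refines_tparam_tcoord hρ
    exact ⟨fun hr => (h2.trans hr).trans h3, fun hr => (h1.trans hr).trans h4⟩
  have hback : ∀ C C' : Set E4, F C ⊆ F C' → C ⊆ C' := by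
    intro C C' hCC u hu
    have hT : T (tparam Q fun i => u i) = u := by
      simp only [T, h.tcoord_tparam]
    have : (tparam Q fun i => u i) ∈ F C := ⟨h.mem_chiroGrassmannian _, by rw [hT]; exact hu⟩
    have := (hCC this).2
    rwa [hT] at this
  have hmem : ∀ C ∈ normalFan (newtonPolytope f), F C ∈ chiroFan χ := by
    rintro _ ⟨w, rfl⟩
    refine ⟨tparam Q fun i => w i, h.mem_chiroGrassmannian _, ?_⟩
    rw [hchiro _ (h.mem_chiroGrassmannian _), hcone, h.tcoord_tparam]
  let emb : normalFan (newtonPolytope f) ↪o chiroFan χ :=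
    OrderEmbedding.ofMapLEIff (fun C => ⟨F C.1, hmem _ C.2⟩) fun C C' =>
      ⟨hback _ _, fun hCC ρ hρ => ⟨hρ.1, hCC hρ.2⟩⟩
  refine ⟨RelIso.ofSurjective emb ?_⟩
  rintro ⟨_, π, hπ, rfl⟩
  refine ⟨⟨_, T π, rfl⟩, Subtype.ext ?_⟩
  exact (congrArg F (hcone (T π))).trans (hchiro π hπ).symm

theorem interior_newtonPolytope_nonempty (h : PosChart χ A e Q) {f : Poly4} (hf : f ≠ 0)
    (hface : ∀ w u : Fin 4 → ℝ, FaceIncl f w u ↔ ∀ I, FaceIncl (Q I) w u) :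
    (interior (newtonPolytope f)).Nonempty := by
  rw [newtonPolytope, interior_convexHull_nonempty_iff_affineSpan_eq_top]
  set V : Set E4 := {x | ∃ m ∈ f.support, x = WithLp.toLp 2 fun i => ((m i : ℕ) : ℝ)}
  obtain ⟨m₀, hm₀⟩ : f.support.Nonempty := by simpa [Finset.nonempty_iff_ne_empty] using hf
  have hV : V.Nonempty := ⟨_, m₀, hm₀, rfl⟩
  rw [AffineSubspace.affineSpan_eq_top_iff_vectorSpan_eq_top_of_nonempty ℝ E4 E4 hV]
  by_contra hne
  have hne' : (vectorSpan ℝ V)ᗮ ≠ ⊥ := fun h0 => hne ((Submodule.orthogonal_eq_bot_iff).mp h0)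
  obtain ⟨w, hw, hw0⟩ := (Submodule.ne_bot_iff _).mp hne'
  have hconst : ∀ m ∈ f.support, Finsupp.weight (fun i => w i) m =
      Finsupp.weight (fun i => w i) m₀ := by
    intro m hm
    have h1 : (WithLp.toLp 2 fun i => ((m i : ℕ) : ℝ)) - (WithLp.toLp 2 fun i => ((m₀ i : ℕ) : ℝ)) ∈
        vectorSpan ℝ V := vsub_mem_vectorSpan ℝ ⟨m, hm, rfl⟩ ⟨m₀, hm₀, rfl⟩
    have h2 := (Submodule.mem_orthogonal' _ _).mp hw _ h1
    rw [inner_sub_right, inner_toLp_weight, inner_toLp_weight] at h2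
    linarith
  have hincl : FaceIncl f 0 fun i => w i := fun m hm _ =>
    (tropVal_eq_of ⟨m, hm, rfl⟩ fun n hn => by rw [hconst m hm, hconst n hn]).symm
  have href := h.refines_tparam ((hface _ _).mp hincl)
  have hzero : ∀ I, tparam Q 0 I = 0 := by
    intro I
    obtain ⟨m, -, hm⟩ := exists_tropVal (h.ne_zero I) 0
    rw [tparam, ← hm, weight_eq]; simp
  have htie : ∀ i, ∑ I, (e i I : ℝ) * tparam Q (fun i => w i) I = 0 := by
    intro i
    refine h.tie i _ fun l a b c d hn => ?_
    have a1 := href l a b c d hn (by rw [attainsMin_iff _ hn]; simp [hzero])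
    have a2 := href l a c b d (by simp_all [eq_comm])
      (by rw [attainsMin_iff _ (by simp_all [eq_comm])]; simp [hzero])
    rw [attainsMin_iff _ hn] at a1
    rw [AttainsMin.swap_bc hn] at a2
    exact le_antisymm a1.1 a2.1
  apply hw0
  have h1 := h.tcoord_tparam fun i => w i
  ext i
  have h2 := congrFun h1 i
  rw [tcoord, htie] at h2
  exact h2.symm

/-! ### The factors of the minors -/

lemma minor_ne_zero (h : PosChart χ A e Q) (I : Triple) : minor A I ≠ 0 := by
  rw [h.minor_eq]
  refine mul_ne_zero ?_ ?_
  · exact_mod_cast (χ I).ne_zero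
  · exact (map_ne_zero_iff _ (MvPolynomial.map_injective _ Nat.cast_injective)).mpr (h.ne_zero I)

lemma faceIncl_minor (h : PosChart χ A e Q) (I : Triple) (w u : Fin 4 → ℝ) :
    FaceIncl (minor A I) w u ↔ FaceIncl (Q I) w u := by
  have hs : (minor A I).support = (Q I).support := by
    rw [h.minor_eq]
    rcases Int.units_eq_one_or (χ I) with h1 | h1
    · simp [h1, support_map_nat]
    · simp [h1, support_map_nat, MvPolynomial.support_neg]
  simp only [FaceIncl, tropVal, hs]

end PosChart

lemma numer_dvd_iff (p : Poly4) (f : Poly4) :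
    f ∣ numer (algebraMap Poly4 Rat4 p) ↔ f ∣ p := by
  have hd : IsUnit (denom (algebraMap Poly4 Rat4 p)) :=
    (IsFractionRing.isUnit_den_iff _).mpr ⟨p, rfl⟩
  have h1 : p * denom (algebraMap Poly4 Rat4 p) = numer (algebraMap Poly4 Rat4 p) := by
    have := (IsFractionRing.num_mul_den_eq_num_iff_eq (A := Poly4)
      (x := algebraMap Poly4 Rat4 p) (y := algebraMap Poly4 Rat4 p)).mpr rfl
    rw [← map_mul] at this
    exact FaithfulSMul.algebraMap_injective Poly4 Rat4 this
  rw [← h1, hd.dvd_mul_right]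

lemma isUnit_denom_algebraMap (p : Poly4) : IsUnit (denom (algebraMap Poly4 Rat4 p)) :=
  (IsFractionRing.isUnit_den_iff _).mpr ⟨p, rfl⟩

lemma evalRat_algebraMap (p : Poly4) (y : E4) :
    evalRat (algebraMap Poly4 Rat4 p) y = MvPolynomial.eval (fun i => y i) p := by
  have h1 : p * denom (algebraMap Poly4 Rat4 p) = numer (algebraMap Poly4 Rat4 p) := by
    have := (IsFractionRing.num_mul_den_eq_num_iff_eq (A := Poly4)
      (x := algebraMap Poly4 Rat4 p) (y := algebraMap Poly4 Rat4 p)).mpr rfl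
    rw [← map_mul] at this
    exact FaithfulSMul.algebraMap_injective Poly4 Rat4 this
  have h2 : MvPolynomial.eval (fun i => y i) (denom (algebraMap Poly4 Rat4 p)) ≠ 0 :=
    ((isUnit_denom_algebraMap p).map (MvPolynomial.eval fun i => y i)).ne_zero
  rw [evalRat, ← h1, map_mul, mul_div_cancel_right₀ _ h2]

lemma minor_algebraMap (A : Matrix (Fin 3) (Fin 6) Poly4) (I : Triple) :
    minor (A.map (algebraMap Poly4 Rat4)) I = algebraMap Poly4 Rat4 (minor A I) := by
  rw [minor, minor, RingHom.map_det]
  rfl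

lemma occursInMinors_iff (A : Matrix (Fin 3) (Fin 6) Poly4) (f : Poly4) :
    OccursInMinors (A.map (algebraMap Poly4 Rat4)) f ↔ Irreducible f ∧ ∃ I, f ∣ minor A I := by
  refine and_congr_right fun hf => exists_congr fun I => ?_
  rw [minor_algebraMap, numer_dvd_iff]
  exact or_iff_left fun h => hf.not_isUnit (isUnit_of_dvd_unit h (isUnit_denom_algebraMap _))

lemma FaceIncl.of_irreducible_dvd {w u : Fin 4 → ℝ} {p : Poly4} (hp : p ≠ 0)
    (h : ∀ f, Irreducible f → f ∣ p → FaceIncl f w u) : FaceIncl p w u := by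
  induction p using WfDvdMonoid.induction_on_irreducible with
  | zero => exact absurd rfl hp
  | unit p hu =>
    obtain ⟨c, hc, rfl⟩ := MvPolynomial.isUnit_iff_eq_C_of_isReduced.mp hu
    have hs : (MvPolynomial.C c : Poly4).support = {0} := by
      rw [MvPolynomial.C_apply, MvPolynomial.support_monomial, if_neg hc.ne_zero]
    intro m hm _
    rw [hs, Finset.mem_singleton] at hm
    subst hm
    exact (tropVal_eq_of ⟨0, by simp [hs], rfl⟩ fun n hn => by
      rw [hs, Finset.mem_singleton] at hn; rw [hn]).symm
  | mul a i ha hi ih =>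
    rw [faceIncl_mul hi.ne_zero ha]
    exact ⟨h i hi (dvd_mul_right _ _), ih ha fun f hf hfa => h f hf (hfa.mul_left _)⟩

theorem exists_listsFactors {A : Matrix (Fin 3) (Fin 6) Poly4} (hA : ∀ I, minor A I ≠ 0) :
    ∃ F : Finset Poly4, ListsFactors (A.map (algebraMap Poly4 Rat4)) F ∧ ∏ f ∈ F, f ≠ 0 ∧
      ∀ w u, FaceIncl (∏ f ∈ F, f) w u ↔ ∀ I, FaceIncl (minor A I) w u := by
  classical
  set p : Poly4 := ∏ I, minor A I with hp
  have hp0 : p ≠ 0 := Finset.prod_ne_zero_iff.mpr fun I _ => hA I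
  let F : Finset Poly4 := ((UniqueFactorizationMonoid.factors p).toFinset.image
    (Associates.mk : Poly4 → Associates Poly4)).image Quotient.out
  have hF : ∀ f ∈ F, OccursInMinors (A.map (algebraMap Poly4 Rat4)) f := by
    intro f hf
    simp only [F, Finset.mem_image, Multiset.mem_toFinset] at hf
    obtain ⟨_, ⟨g, hg, rfl⟩, rfl⟩ := hf
    have hassoc : Associated (Quotient.out (Associates.mk g)) g :=
      Associates.mk_eq_mk_iff_associated.mp (Quotient.out_eq _)
    have hirr : Irreducible g := UniqueFactorizationMonoid.irreducible_of_factor g hg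
    have hdvd : g ∣ p := UniqueFactorizationMonoid.dvd_of_mem_factors hg
    obtain ⟨I, -, hI⟩ := (hirr.prime.dvd_finsetProd_iff _).mp hdvd
    exact (occursInMinors_iff A _).mpr ⟨hassoc.irreducible_iff.mpr hirr, I, hassoc.dvd_iff_dvd_left.mpr hI⟩
  have hF' : ∀ f, OccursInMinors (A.map (algebraMap Poly4 Rat4)) f →
      ∃! g, g ∈ F ∧ Associated f g := by
    intro f hf
    obtain ⟨hirr, I, hI⟩ := (occursInMinors_iff A f).mp hf
    have hdvd : f ∣ p := hI.trans (Finset.dvd_prod_of_mem _ (Finset.mem_univ I))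
    obtain ⟨q, hq, hfq⟩ := UniqueFactorizationMonoid.exists_mem_factors_of_dvd hp0 hirr hdvd
    have hassoc : Associated (Quotient.out (Associates.mk q)) q :=
      Associates.mk_eq_mk_iff_associated.mp (Quotient.out_eq _)
    refine ⟨Quotient.out (Associates.mk q), ⟨?_, hfq.trans hassoc.symm⟩, ?_⟩
    · exact Finset.mem_image_of_mem _ (Finset.mem_image_of_mem _ (Multiset.mem_toFinset.mpr hq))
    · rintro g ⟨hg, hfg⟩
      simp only [F, Finset.mem_image, Multiset.mem_toFinset] at hg
      obtain ⟨_, ⟨g, -, rfl⟩, rfl⟩ := hg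
      have hassoc' : Associated (Quotient.out (Associates.mk g)) g :=
        Associates.mk_eq_mk_iff_associated.mp (Quotient.out_eq _)
      congr 1
      exact Associates.mk_eq_mk_iff_associated.mpr
        ((hassoc'.symm.trans hfg.symm).trans hfq)
  have hprod : ∏ f ∈ F, f ≠ 0 := Finset.prod_ne_zero_iff.mpr fun f hf => (hF f hf).1.ne_zero
  refine ⟨F, ⟨hF, hF'⟩, hprod, fun w u => ⟨fun h I => ?_, fun h => ?_⟩⟩
  · refine FaceIncl.of_irreducible_dvd (hA I) fun f hf hfI => ?_
    obtain ⟨g, ⟨hg, hfg⟩, -⟩ := hF' f ((occursInMinors_iff A f).mpr ⟨hf, I, hfI⟩)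
    exact h.of_dvd hprod (hfg.dvd.trans (Finset.dvd_prod_of_mem _ hg))
  · refine FaceIncl.of_irreducible_dvd hprod fun f hf hfF => ?_
    obtain ⟨g, hg, hfg⟩ := (hf.prime.dvd_finsetProd_iff _).mp hfF
    obtain ⟨-, I, hI⟩ := (occursInMinors_iff A g).mp (hF g hg)
    exact (h I).of_dvd (hA I) (hfg.trans hI)

/-! ### The moment map -/

section MomentMap

variable {E : Type*} [NormedAddCommGroup E] [InnerProductSpace ℝ E]

/-- The partition function of a finite point configuration. -/
def partitionFun (V : Finset E) (u : E) : ℝ := ∑ m ∈ V, Real.exp (inner ℝ m u)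

/-- The moment map of a finite point configuration. -/
def momentMap (V : Finset E) (u : E) : E :=
  (partitionFun V u)⁻¹ • ∑ m ∈ V, Real.exp (inner ℝ m u) • m

lemma partitionFun_pos {V : Finset E} (hV : V.Nonempty) (u : E) : 0 < partitionFun V u :=
  Finset.sum_pos (fun _ _ => Real.exp_pos _) hV

lemma contDiff_partitionFun (V : Finset E) : ContDiff ℝ ∞ (partitionFun V) :=
  ContDiff.sum fun _ _ => Real.contDiff_exp.comp (contDiff_const.inner ℝ contDiff_id)

lemma contDiff_momentMap {V : Finset E} (hV : V.Nonempty) : ContDiff ℝ ∞ (momentMap V) :=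
  ((contDiff_partitionFun V).inv fun u => (partitionFun_pos hV u).ne').smul
    (ContDiff.sum fun _ _ => (Real.contDiff_exp.comp
      (contDiff_const.inner ℝ contDiff_id)).smul contDiff_const)

lemma momentMap_mem (V : Finset E) (hV : V.Nonempty) (u : E) :
    momentMap V u ∈ convexHull ℝ (V : Set E) := by
  have h := partitionFun_pos hV u
  have : momentMap V u = ∑ m ∈ V, ((partitionFun V u)⁻¹ * Real.exp (inner ℝ m u)) • m := by
    simp only [momentMap, Finset.smul_sum, mul_smul]
  rw [this]
  refine (convex_convexHull ℝ _).sum_mem (fun m _ => by positivity) ?_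
    fun m hm => subset_convexHull ℝ _ hm
  rw [← Finset.mul_sum]
  exact inv_mul_cancel₀ h.ne'

lemma hasFDerivAt_exp_inner (m u : E) :
    HasFDerivAt (fun u : E => Real.exp (inner ℝ m u)) (Real.exp (inner ℝ m u) • innerSL ℝ m) u :=
  ((innerSL ℝ m).hasFDerivAt (x := u)).exp

/-- The derivative of the moment map is a covariance, hence positive definite. -/
lemma inner_fderiv_momentMap_pos {V : Finset E} (hV : V.Nonempty) (u h : E)
    (hh : ∃ m ∈ V, ∃ n ∈ V, inner ℝ m h ≠ inner ℝ n h) :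
    0 < inner ℝ (fderiv ℝ (momentMap V) u h) h := by
  set Z := partitionFun V u with hZ
  have hZ0 : 0 < Z := partitionFun_pos hV u
  have hdZ : HasFDerivAt (partitionFun V) (∑ m ∈ V, Real.exp (inner ℝ m u) • innerSL ℝ m) u :=
    HasFDerivAt.fun_sum fun m _ => hasFDerivAt_exp_inner m u
  have hdN : HasFDerivAt (fun u : E => ∑ m ∈ V, Real.exp (inner ℝ m u) • m)
      (∑ m ∈ V, (Real.exp (inner ℝ m u) • innerSL ℝ m).smulRight m) u :=
    HasFDerivAt.fun_sum fun m _ => (hasFDerivAt_exp_inner m u).smul_const m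
  have hdG : DifferentiableAt ℝ (momentMap V) u :=
    (contDiff_momentMap hV).differentiable (by simp) u
  have hprod : HasFDerivAt (fun u => partitionFun V u • momentMap V u)
      (∑ m ∈ V, (Real.exp (inner ℝ m u) • innerSL ℝ m).smulRight m) u := by
    refine hdN.congr_of_eventuallyEq (Filter.Eventually.of_forall fun v => ?_)
    simp only [momentMap]
    rw [smul_inv_smul₀ (partitionFun_pos hV v).ne']
  have heq := hprod.unique (hdZ.smul hdG.hasFDerivAt)
  have h1 := congrArg (fun T : E →L[ℝ] E => inner ℝ (T h) h) heq
  simp only [_root_.sum_apply, ContinuousLinearMap.smulRight_apply,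
    _root_.add_apply, _root_.smul_apply, innerSL_apply_apply, sum_inner,
    inner_add_left, inner_smul_left, smul_eq_mul, ← hZ] at h1
  set c := inner ℝ (momentMap V u) h with hc
  have hsum : Z * c = ∑ m ∈ V, Real.exp (inner ℝ m u) * inner ℝ m h := by
    rw [hc, momentMap, inner_smul_left, sum_inner, ← hZ]
    simp only [inner_smul_left, RCLike.conj_to_real]
    rw [mul_inv_cancel_left₀ hZ0.ne']
  have hvar : Z * inner ℝ (fderiv ℝ (momentMap V) u h) h =
      ∑ m ∈ V, Real.exp (inner ℝ m u) * (inner ℝ m h - c) ^ 2 := by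
    have e1 : ∑ m ∈ V, Real.exp (inner ℝ m u) * (inner ℝ m h - c) ^ 2 =
        ∑ m ∈ V, Real.exp (inner ℝ m u) * inner ℝ m h * inner ℝ m h
          - 2 * c * ∑ m ∈ V, Real.exp (inner ℝ m u) * inner ℝ m h + Z * c ^ 2 := by
      rw [hZ, partitionFun, Finset.mul_sum, Finset.sum_mul, ← Finset.sum_sub_distrib,
        ← Finset.sum_add_distrib]
      exact Finset.sum_congr rfl fun m _ => by ring
    rw [e1, ← hsum]
    simp only [RCLike.conj_to_real] at h1
    rw [h1, ← hsum]
    ring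
  have hpos : 0 < ∑ m ∈ V, Real.exp (inner ℝ m u) * (inner ℝ m h - c) ^ 2 := by
    obtain ⟨m, hm, n, hn, hmn⟩ := hh
    refine Finset.sum_pos' (fun _ _ => by positivity) ?_
    by_cases hmc : inner ℝ m h = c
    · exact ⟨n, hn, mul_pos (Real.exp_pos _) (sq_pos_of_ne_zero fun h0 => hmn (by linarith))⟩
    · exact ⟨m, hm, mul_pos (Real.exp_pos _) (sq_pos_of_ne_zero fun h0 => hmc (by linarith))⟩
  rw [← hvar] at hpos
  exact pos_of_mul_pos_right hpos hZ0.le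

lemma exists_inner_ge {V : Finset E} {x : E} {r : ℝ} (hr : 0 < r)
    (hx : Metric.closedBall x r ⊆ convexHull ℝ (V : Set E)) (u : E) :
    ∃ m ∈ V, r * ‖u‖ ≤ inner ℝ (m - x) u := by
  by_contra! hcon
  have hconv : Convex ℝ {z : E | inner ℝ (z - x) u < r * ‖u‖} := by
    have : {z : E | inner ℝ (z - x) u < r * ‖u‖} = {z | inner ℝ z u < r * ‖u‖ + inner ℝ x u} := by
      ext z; simp [inner_sub_left, sub_lt_iff_lt_add]
    rw [this]
    exact convex_halfSpace_lt (IsLinearMap.mk (fun a b => inner_add_left a b u)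
      fun c y => real_inner_smul_left y u c) _
  have hsub := convexHull_min (s := (V : Set E)) (fun m hm => hcon m hm) hconv
  have hmem : x + (r * ‖u‖⁻¹) • u ∈ Metric.closedBall x r := by
    rw [Metric.mem_closedBall, dist_eq_norm, add_sub_cancel_left, norm_smul, norm_mul, norm_inv,
      norm_norm, Real.norm_of_nonneg hr.le, mul_assoc]
    exact mul_le_of_le_one_right hr.le (inv_mul_le_one)
  have h : inner ℝ (x + (r * ‖u‖⁻¹) • u - x) u < r * ‖u‖ := hsub (hx hmem)
  simp only [add_sub_cancel_left, real_inner_smul_left,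
    real_inner_self_eq_norm_sq] at h
  by_cases hu : ‖u‖ = 0
  · simp [hu] at h
  · have : r * ‖u‖⁻¹ * ‖u‖ ^ 2 = r * ‖u‖ := by field_simp
    linarith

lemma exists_inner_ne {V : Finset E} (hint : (interior (convexHull ℝ (V : Set E))).Nonempty) {h : E}
    (hh : h ≠ 0) : ∃ m ∈ V, ∃ n ∈ V, inner ℝ m h ≠ inner ℝ n h := by
  obtain ⟨x, hx⟩ := hint
  obtain ⟨r, hr, hball⟩ := Metric.nhds_basis_closedBall.mem_iff.mp (mem_interior_iff_mem_nhds.mp hx)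
  obtain ⟨m, hm, h1⟩ := exists_inner_ge hr hball h
  obtain ⟨n, hn, h2⟩ := exists_inner_ge hr hball (-h)
  refine ⟨m, hm, n, hn, fun h3 => ?_⟩
  rw [norm_neg, inner_neg_right, inner_sub_left] at h2
  rw [inner_sub_left] at h1
  have : 0 < r * ‖h‖ := mul_pos hr (norm_pos_iff.mpr hh)
  linarith

variable [FiniteDimensional ℝ E]

lemma exists_momentMap_eq {V : Finset E} (hV : V.Nonempty) {x : E}
    (hx : x ∈ interior (convexHull ℝ (V : Set E))) : ∃ u, momentMap V u = x := by
  obtain ⟨r, hr, hball⟩ := Metric.nhds_basis_closedBall.mem_iff.mp (mem_interior_iff_mem_nhds.mp hx)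
  let S : E → ℝ := fun u => ∑ m ∈ V, Real.exp (inner ℝ (m - x) u)
  have hderiv : ∀ u, HasFDerivAt S
      (∑ m ∈ V, Real.exp (inner ℝ (m - x) u) • innerSL ℝ (m - x)) u := fun u =>
    HasFDerivAt.fun_sum fun m _ => hasFDerivAt_exp_inner (m - x) u
  have hS : Continuous S := continuous_iff_continuousAt.mpr fun u => (hderiv u).continuousAt
  have hge : ∀ u, r * ‖u‖ ≤ S u := fun u => by
    obtain ⟨m, hm, h⟩ := exists_inner_ge hr hball u
    calc r * ‖u‖ ≤ Real.exp (inner ℝ (m - x) u) := by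
          linarith [Real.add_one_le_exp (inner ℝ (m - x) u)]
      _ ≤ S u := Finset.single_le_sum
          (f := fun m => Real.exp (inner ℝ (m - x) u)) (fun _ _ => (Real.exp_pos _).le) hm
  have hlim : Filter.Tendsto S (Filter.cocompact E) Filter.atTop :=
    Filter.tendsto_atTop_mono hge (tendsto_norm_cocompact_atTop.const_mul_atTop hr)
  obtain ⟨u, hu⟩ := hS.exists_forall_le hlim
  have h0 := IsLocalMin.hasFDerivAt_eq_zero (Filter.Eventually.of_forall hu) (hderiv u)
  refine ⟨u, ?_⟩
  have h1 : ∑ m ∈ V, Real.exp (inner ℝ (m - x) u) • (m - x) = 0 := by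
    refine ext_inner_right ℝ fun v => ?_
    have := congrArg (fun T : E →L[ℝ] ℝ => T v) h0
    simpa [sum_inner, inner_smul_left, inner_sub_left, _root_.sum_apply] using this
  have h2 : ∑ m ∈ V, Real.exp (inner ℝ m u) • (m - x) = 0 := by
    have : ∑ m ∈ V, Real.exp (inner ℝ m u) • (m - x) = Real.exp (inner ℝ x u) •
        ∑ m ∈ V, Real.exp (inner ℝ (m - x) u) • (m - x) := by
      rw [Finset.smul_sum]
      refine Finset.sum_congr rfl fun m _ => ?_
      rw [smul_smul, ← Real.exp_add, inner_sub_left]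
      congr 2
      ring
    rw [this, h1, smul_zero]
  simp only [smul_sub, Finset.sum_sub_distrib, sub_eq_zero, ← Finset.sum_smul] at h2
  rw [momentMap, h2]
  exact inv_smul_smul₀ (partitionFun_pos hV u).ne' x

/-- The moment map is a diffeomorphism onto the interior of the convex hull. -/
theorem exists_diffeo_momentMap {V : Finset E}
    (hint : (interior (convexHull ℝ (V : Set E))).Nonempty) :
    ∃ H : E → E, (∀ u, H (momentMap V u) = u) ∧
      (∀ u, momentMap V u ∈ interior (convexHull ℝ (V : Set E))) ∧
      ∀ x ∈ interior (convexHull ℝ (V : Set E)), momentMap V (H x) = x ∧ ContDiffAt ℝ ∞ H x := by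
  have hV : V.Nonempty := by
    rw [Finset.nonempty_iff_ne_empty]
    rintro rfl
    simp at hint
  have hsm := contDiff_momentMap hV
  have hpos : ∀ u h : E, h ≠ 0 → 0 < inner ℝ (fderiv ℝ (momentMap V) u h) h := fun u h hh =>
    inner_fderiv_momentMap_pos hV u h (exists_inner_ne hint hh)
  have hinj : Function.Injective (momentMap V) := by
    intro u v huv
    by_contra hne
    have hne' : v - u ≠ 0 := sub_ne_zero.mpr (Ne.symm hne)
    have hφ : ∀ t : ℝ, HasDerivAt (fun t : ℝ => inner ℝ (momentMap V (u + t • (v - u))) (v - u))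
        (inner ℝ (fderiv ℝ (momentMap V) (u + t • (v - u)) (v - u)) (v - u)) t := by
      intro t
      have hline : HasDerivAt (fun t : ℝ => u + t • (v - u)) (v - u) t := by
        simpa using ((hasDerivAt_id t).smul_const (v - u)).const_add u
      have hG := (hsm.differentiable (by simp) (u + t • (v - u))).hasFDerivAt.comp_hasDerivAt t hline
      simpa using hG.inner ℝ (hasDerivAt_const t (v - u))
    have hmono : StrictMono fun t : ℝ => inner ℝ (momentMap V (u + t • (v - u))) (v - u) :=
      strictMono_of_deriv_pos fun t => by rw [(hφ t).deriv]; exact hpos _ _ hne'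
    have := hmono zero_lt_one
    simp [huv] at this
  have hequiv : ∀ u, ∃ T : E ≃L[ℝ] E, (T : E →L[ℝ] E) = fderiv ℝ (momentMap V) u := by
    intro u
    have hker : Function.Injective (fderiv ℝ (momentMap V) u : E →ₗ[ℝ] E) := by
      rw [injective_iff_map_eq_zero]
      intro h hh
      by_contra hne
      have := hpos u h hne
      rw [show fderiv ℝ (momentMap V) u h = 0 from hh, inner_zero_left] at this
      exact lt_irrefl _ this
    exact ⟨(LinearEquiv.ofInjectiveEndo _ hker).toContinuousLinearEquiv, by ext; rfl⟩
  refine ⟨Function.invFun (momentMap V), Function.leftInverse_invFun hinj, fun u => ?_, ?_⟩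
  · obtain ⟨T, hT⟩ := hequiv u
    have hs : HasStrictFDerivAt (momentMap V) (T : E →L[ℝ] E) u := by
      rw [hT]; exact hsm.contDiffAt.hasStrictFDerivAt (by simp)
    rw [mem_interior_iff_mem_nhds, ← hs.map_nhds_eq_of_equiv]
    exact Filter.mem_map.mpr (Filter.univ_mem' (momentMap_mem V hV))
  · intro x hx
    obtain ⟨u, rfl⟩ := exists_momentMap_eq hV hx
    refine ⟨by rw [Function.leftInverse_invFun hinj], ?_⟩
    obtain ⟨T, hT⟩ := hequiv u
    have hd : HasFDerivAt (momentMap V) (T : E →L[ℝ] E) u := by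
      rw [hT]; exact (hsm.differentiable (by simp) u).hasFDerivAt
    have hs := hsm.contDiffAt.hasStrictFDerivAt' (x := u) hd (by simp)
    refine (hsm.contDiffAt.to_localInverse hd (by simp)).congr_of_eventuallyEq ?_
    filter_upwards [hs.eventually_right_inverse] with z hz
    conv_lhs => rw [← hz]
    exact Function.leftInverse_invFun hinj _

end MomentMap

/-- The interior of a full-dimensional Newton polytope is diffeomorphic to Euclidean space. -/
theorem nonempty_diffeo_interior {f : Poly4} (hf : (interior (newtonPolytope f)).Nonempty) :
    Nonempty (E4 ≃ₘ^∞⟮𝓘(ℝ, E4), 𝓘(ℝ, E4)⟯ interiorOpens (newtonPolytope f)) := by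
  classical
  let V : Finset E4 := f.support.image fun m => WithLp.toLp 2 fun i => ((m i : ℕ) : ℝ)
  have hV : newtonPolytope f = convexHull ℝ (V : Set E4) := by
    rw [newtonPolytope]
    congr 1
    ext x
    simp [V, eq_comm]
  have hne : V.Nonempty := by
    rw [Finset.nonempty_iff_ne_empty]
    intro h
    rw [hV, h] at hf
    simp at hf
  rw [hV] at hf ⊢
  obtain ⟨H, h1, h2, h3⟩ := exists_diffeo_momentMap hf
  exact ⟨{
    toFun := fun u => ⟨momentMap V u, h2 u⟩
    invFun := fun x => H x
    left_inv := h1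
    right_inv := fun x => Subtype.ext (h3 x x.2).1
    contMDiff_toFun := by
      rw [← ContMDiff.subtypeVal_comp_iff]
      exact (contDiff_momentMap hne).contMDiff
    contMDiff_invFun := fun x =>
      (h3 x x.2).2.contMDiffAt.comp x contMDiff_subtype_val.contMDiffAt }⟩

/-- The positive orthant is diffeomorphic to Euclidean space. -/
def orthantDiffeo : posOrthant ≃ₘ^∞⟮𝓘(ℝ, E4), 𝓘(ℝ, E4)⟯ E4 where
  toFun y := WithLp.toLp 2 fun i => Real.log ((y : E4) i)
  invFun u := ⟨WithLp.toLp 2 fun i => Real.exp (u i), fun _ => Real.exp_pos _⟩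
  left_inv y := Subtype.ext (by ext i; exact Real.exp_log (y.2 i))
  right_inv u := by ext i; exact Real.log_exp _
  contMDiff_toFun y := by
    have h : ContDiffAt ℝ ∞ (fun y : E4 => (WithLp.toLp 2 fun i => Real.log (y i) : E4)) y := by
      rw [contDiffAt_euclidean]
      intro i
      exact (contDiffAt_euclidean.mp contDiffAt_id i).log (y.2 i).ne'
    exact h.contMDiffAt.comp y contMDiff_subtype_val.contMDiffAt
  contMDiff_invFun := by
    rw [← ContMDiff.subtypeVal_comp_iff]
    refine ContDiff.contMDiff ?_
    rw [contDiff_euclidean]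
    intro i
    exact Real.contDiff_exp.comp (contDiff_euclidean.mp contDiff_id i)

/-! ### Smoothness of the basic maps -/

section Smooth

variable {E : Type*} [NormedAddCommGroup E] [NormedSpace ℝ E]

lemma contDiffAt_det3 {M : E → Matrix (Fin 3) (Fin 6) ℝ} {x : E}
    (hM : ∀ i j, ContDiffAt ℝ ∞ (fun z => M z i j) x) (f : Fin 3 → Fin 6) :
    ContDiffAt ℝ ∞ (fun z => det3 (M z) f) x := by
  simp only [det3, Matrix.det_fin_three, Matrix.submatrix_apply, id_eq]
  fun_prop

lemma contDiffAt_minor {M : E → Matrix (Fin 3) (Fin 6) ℝ} {x : E}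
    (hM : ∀ i j, ContDiffAt ℝ ∞ (fun z => M z i j) x) (I : Triple) :
    ContDiffAt ℝ ∞ (fun z => minor (M z) I) x :=
  contDiffAt_det3 hM _

lemma contDiffAt_coordMat {M : E → Matrix (Fin 3) (Fin 6) ℝ} {x : E}
    (hM : ∀ i j, ContDiffAt ℝ ∞ (fun z => M z i j) x) (hx : Generic (M x)) :
    ContDiffAt ℝ ∞ (fun z => coordMat (M z)) x := by
  have hd := contDiffAt_det3 hM
  have key : ∀ f g f' g' : Fin 3 → Fin 6, Function.Injective f' → Function.Injective g' →
      ContDiffAt ℝ ∞ (fun z => det3 (M z) f * det3 (M z) g / (det3 (M z) f' * det3 (M z) g')) x :=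
    fun f g f' g' hf' hg' => ((hd f).mul (hd g)).div ((hd f').mul (hd g'))
      (mul_ne_zero (hx.det3_ne hf') (hx.det3_ne hg'))
  rw [contDiffAt_euclidean]
  intro i
  fin_cases i
  · exact key _ _ _ _ (by decide) (by decide)
  · exact key _ _ _ _ (by decide) (by decide)
  · exact key _ _ _ _ (by decide) (by decide)
  · exact key _ _ _ _ (by decide) (by decide)

lemma contDiffAt_zpow {f : E → ℝ} {x : E} (hf : ContDiffAt ℝ ∞ f x) (hx : f x ≠ 0) (n : ℤ) :
    ContDiffAt ℝ ∞ (fun z => f z ^ n) x := by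
  cases n with
  | ofNat n => simpa using hf.pow n
  | negSucc n =>
    simp only [zpow_negSucc]
    exact (hf.pow _).inv (pow_ne_zero _ hx)

lemma contDiffAt_evalMat {M : E → Matrix (Fin 3) (Fin 6) ℝ} {x : E}
    (hM : ∀ i j, ContDiffAt ℝ ∞ (fun z => M z i j) x) (hx : Generic (M x)) (c : CrossRatio) :
    ContDiffAt ℝ ∞ (fun z => c.evalMat (M z)) x :=
  contDiffAt_const.mul
    (contDiffAt_prod fun I _ => contDiffAt_zpow (contDiffAt_minor hM I) (hx I) _)

end Smooth

lemma contDiff_normalForm (i : Fin 3) (j : Fin 6) : ContDiff ℝ ∞ fun v => normalForm v i j := by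
  have h : ∀ k : Fin 4, ContDiff ℝ ∞ fun v : E4 => v k := contDiff_euclidean.mp contDiff_id
  fin_cases i <;> fin_cases j <;> simp [normalForm] <;> first | exact contDiff_const | exact h _

lemma generic_normalForm_coord (x : X36) : Generic (normalForm (coord x)) := by
  induction x using Quotient.inductionOn with | _ M
  exact generic_of_sameConfig (sameConfig_normalForm M.2) M.2

lemma mk_normalForm_coord (x : X36) : mk _ (generic_normalForm_coord x) = x :=
  injective_coord (coordMat_normalForm (coord x))

lemma contMDiff_coord : ContMDiff 𝓘(ℝ, E4) 𝓘(ℝ, E4) ∞ coord :=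
  contMDiff_isOpenEmbedding isOpenEmbedding_coord

lemma contMDiff_crossRatio (c : CrossRatio) : ContMDiff 𝓘(ℝ, E4) 𝓘(ℝ, ℝ) ∞ c.eval := by
  intro x
  have h : c.eval = (fun v => c.evalMat (normalForm v)) ∘ coord := by
    funext z
    conv_lhs => rw [← mk_normalForm_coord z]
    rfl
  rw [h]
  exact (contDiffAt_evalMat (fun i j => (contDiff_normalForm i j).contDiffAt)
    (generic_normalForm_coord x) c).contMDiffAt.comp x contMDiff_coord.contMDiffAt

lemma crossRatio_ne_zero (c : CrossRatio) (x : X36) : c.eval x ≠ 0 := by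
  induction x using Quotient.inductionOn with | _ M
  refine mul_ne_zero ?_ (Finset.prod_ne_zero_iff.mpr fun I _ => zpow_ne_zero _ (M.2 I))
  exact_mod_cast c.sign.ne_zero

lemma contMDiff_crossRatioMap (c : Fin 4 → CrossRatio) :
    ContMDiff 𝓘(ℝ, E4) 𝓘(ℝ, E4) ∞ (crossRatioMap c) := by
  have h : ContMDiff 𝓘(ℝ, E4) 𝓘(ℝ, Fin 4 → ℝ) ∞ fun x => fun i => (c i).eval x :=
    contMDiff_pi_space.mpr fun i => contMDiff_crossRatio (c i)
  exact (EuclideanSpace.equiv (Fin 4) ℝ).symm.contDiff.contMDiff.comp h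

lemma contMDiff_relabel (σ : Equiv.Perm (Fin 6)) :
    ContMDiff 𝓘(ℝ, E4) 𝓘(ℝ, E4) ∞ (relabel σ) := by
  refine ContMDiff.of_comp_isOpenEmbedding isOpenEmbedding_coord fun x => ?_
  have h : coord ∘ relabel σ = (fun v => coordMat ((normalForm v).submatrix id σ)) ∘ coord := by
    funext z
    simp only [Function.comp_apply]
    conv_lhs => rw [← mk_normalForm_coord z]
    rfl
  rw [h]
  exact (contDiffAt_coordMat (fun i j => (contDiff_normalForm i (σ j)).contDiffAt)
    fun I => (generic_normalForm_coord x).det3_ne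
      (f := σ ∘ I.1.orderEmbOfFin I.2) (σ.injective.comp (I.1.orderEmbOfFin I.2).injective)
    ).contMDiffAt.comp x contMDiff_coord.contMDiffAt

lemma mdifferentiableAt_log_crossRatio (c : CrossRatio) (x : X36) :
    MDifferentiableAt 𝓘(ℝ, E4) 𝓘(ℝ, ℝ) (fun z => Real.log (c.eval z)) x :=
  ((Real.differentiableAt_log (crossRatio_ne_zero c x)).mdifferentiableAt).comp x
    ((contMDiff_crossRatio c).mdifferentiableAt (by simp))

/-- The pull-back of a logarithmic form is the determinant of the differentials of the pulled-back
logarithms. -/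
lemma logForm_comp {H : Type*} [TopologicalSpace H] {N : Type*} [TopologicalSpace N]
    {F : Type*} [NormedAddCommGroup F] [NormedSpace ℝ F] {I : ModelWithCorners ℝ F H}
    [ChartedSpace H N] (c : Fin 4 → CrossRatio) (f : N → X36) (y : N)
    (hf : MDifferentiableAt I 𝓘(ℝ, E4) f y) (g : Fin 4 → N → ℝ)
    (hg : ∀ i, (fun z => Real.log ((c i).eval (f z))) =ᶠ[nhds y] g i) :
    (logForm c (f y)).compLinearMap (mfderiv I 𝓘(ℝ, E4) f y).toLinearMap =
      (Matrix.detRowAlternating : (Fin 4 → ℝ) [⋀^Fin 4]→ₗ[ℝ] ℝ).compLinearMap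
        (LinearMap.pi fun i => (mfderiv I 𝓘(ℝ, ℝ) (g i) y : TangentSpace I y →L[ℝ] ℝ).toLinearMap) := by
  ext v
  simp only [logForm, AlternatingMap.compLinearMap_apply]
  congr 1
  funext k i
  have h := mfderiv_comp y (mdifferentiableAt_log_crossRatio (c i) (f y)) hf
  have h2 := (hg i).mfderiv_eq (I := I) (I' := 𝓘(ℝ, ℝ))
  exact (congrArg (fun T : TangentSpace I y →L[ℝ] ℝ => T (v k)) h).symm.trans
    (congrArg (fun T : TangentSpace I y →L[ℝ] ℝ => T (v k)) h2)

/-! ### Configurations are determined by their minors -/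

lemma coordMat_congr {M N : Matrix (Fin 3) (Fin 6) ℝ} (h : ∀ I, minor M I = minor N I) :
    coordMat M = coordMat N := by
  have hd : ∀ a b c : Fin 6, a ≠ b → a ≠ c → b ≠ c → det3 M ![a, b, c] = det3 N ![a, b, c] :=
    fun a b c h1 h2 h3 => by rw [det3_eq M h1 h2 h3, det3_eq N h1 h2 h3, h]
  simp only [coordMat]
  rw [hd 4 1 2 (by decide) (by decide) (by decide), hd 0 1 3 (by decide) (by decide) (by decide),
    hd 3 1 2 (by decide) (by decide) (by decide), hd 0 1 4 (by decide) (by decide) (by decide),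
    hd 0 4 2 (by decide) (by decide) (by decide), hd 0 3 2 (by decide) (by decide) (by decide),
    hd 5 1 2 (by decide) (by decide) (by decide), hd 0 1 5 (by decide) (by decide) (by decide),
    hd 0 5 2 (by decide) (by decide) (by decide)]

lemma mk_eq_of_minor {M N : Matrix (Fin 3) (Fin 6) ℝ} (hM : Generic M) (hN : Generic N) {k : ℝ}
    {t : Fin 6 → ℝ} (h : ∀ I, minor N I = k * minor M I * ∏ j ∈ I.1, t j) : mk N hN = mk M hM := by
  have hk : k ≠ 0 := by
    rintro rfl
    exact hN (triple 0) (by rw [h]; simp)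
  have ht : ∀ j, t j ≠ 0 := by
    intro j hj
    obtain ⟨I, hI⟩ : ∃ I : Triple, j ∈ I.1 := by
      clear hj
      revert j
      decide
    exact hN I (by rw [h, Finset.prod_eq_zero hI hj, mul_zero])
  have hdet : (Matrix.diagonal ![k, 1, 1] : Matrix (Fin 3) (Fin 3) ℝ).det = k := by
    simp [Matrix.det_diagonal, Fin.prod_univ_three]
  have hs : SameConfig M (Matrix.diagonal ![k, 1, 1] * M * Matrix.diagonal t) :=
    ⟨Matrix.GeneralLinearGroup.mkOfDetNeZero _ (hdet.trans_ne hk),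
      fun j => Units.mk0 (t j) (ht j), rfl⟩
  refine injective_coord ?_
  change coordMat N = coordMat M
  rw [coordMat_eq_of_sameConfig hs]
  exact coordMat_congr fun I => by rw [h, minor_act, hdet]

/-! ### The parametrization given by a positive chart -/

namespace PosChart

variable {χ : SignVector} {A : Matrix (Fin 3) (Fin 6) Poly4} {e : Fin 4 → Triple → ℤ}
  {Q : Triple → MvPolynomial (Fin 4) ℕ}

/-- The cross-ratios of a positive chart, signed so that they are positive on `χ`. -/
def crossRatio (h : PosChart χ A e Q) (i : Fin 4) : CrossRatio where
  sign := ∏ I, χ I ^ e i I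
  expo := e i
  balanced := h.balanced i

/-- The matrix of rational functions of a positive chart. -/
def ratMatrix (A : Matrix (Fin 3) (Fin 6) Poly4) : Matrix (Fin 3) (Fin 6) Rat4 :=
  A.map (algebraMap Poly4 Rat4)

lemma evalMatrix_ratMatrix (A : Matrix (Fin 3) (Fin 6) Poly4) (y : E4) :
    evalMatrix (ratMatrix A) y = A.map (MvPolynomial.eval fun i => y i) := by
  ext i j
  exact evalRat_algebraMap _ _

lemma mem_paramDomain {y : E4} :
    y ∈ paramDomain (ratMatrix A) ↔ Generic (A.map (MvPolynomial.eval fun i => y i)) := by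
  rw [paramDomain, Set.mem_ofPred_eq, evalMatrix_ratMatrix]
  refine and_iff_right fun i j => ?_
  exact ((isUnit_denom_algebraMap (A i j)).map (MvPolynomial.eval fun k => y k)).ne_zero

lemma crossRatio_evalMat (h : PosChart χ A e Q) (i : Fin 4) (M : Matrix (Fin 3) (Fin 6) ℝ) :
    (h.crossRatio i).evalMat M = ∏ I, (((χ I : ℤ) : ℝ) * minor M I) ^ e i I := by
  have hc : (((∏ I, χ I ^ e i I : ℤˣ) : ℤ) : ℝ) = ∏ I, (((χ I : ℤ) : ℝ)) ^ e i I := by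
    have hz : ∀ (u : ℤˣ) (n : ℤ), (((u ^ n : ℤˣ) : ℤ) : ℝ) = ((u : ℤ) : ℝ) ^ n := by
      intro u n
      have := map_zpow (Units.map (Int.castRingHom ℝ).toMonoidHom) u n
      exact (congrArg Units.val this).trans (Units.val_zpow_eq_zpow_val _ _)
    rw [Units.coe_prod, Int.cast_prod]
    exact Finset.prod_congr rfl fun I _ => hz _ _
  simp only [CrossRatio.evalMat, crossRatio]
  rw [hc, ← Finset.prod_mul_distrib]
  simp only [mul_zpow]

lemma zpow_toNat {a : ℝ} (ha : a ≠ 0) (n : ℤ) : a ^ n * a ^ (-n).toNat = a ^ n.toNat := by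
  rw [← zpow_natCast, ← zpow_natCast, ← zpow_add₀ ha]
  congr 1
  omega

lemma prod_aeval_zpow (h : PosChart χ A e Q) {y : Fin 4 → ℝ}
    (hy : ∀ I, MvPolynomial.aeval y (Q I) ≠ 0) (i : Fin 4) :
    ∏ I, (MvPolynomial.aeval y (Q I) : ℝ) ^ e i I = y i := by
  have h1 := congrArg (MvPolynomial.aeval y) (h.section_eq i)
  simp only [map_prod, map_pow, map_mul, MvPolynomial.aeval_X] at h1
  have h2 : ∏ I, (MvPolynomial.aeval y (Q I) : ℝ) ^ (-e i I).toNat ≠ 0 :=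
    Finset.prod_ne_zero_iff.mpr fun I _ => pow_ne_zero _ (hy I)
  refine mul_right_cancel₀ h2 ?_
  rw [← h1, ← Finset.prod_mul_distrib]
  exact Finset.prod_congr rfl fun I _ => zpow_toNat (hy I) _

lemma generic_iff (h : PosChart χ A e Q) {y : Fin 4 → ℝ} :
    Generic (A.map (MvPolynomial.eval y)) ↔ ∀ I, (MvPolynomial.aeval y (Q I) : ℝ) ≠ 0 := by
  refine forall_congr' fun I => ?_
  rw [h.minor_eval, mul_ne_zero_iff]
  exact and_iff_right (by exact_mod_cast (χ I).ne_zero)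

lemma sign_mul_minor (h : PosChart χ A e Q) (y : Fin 4 → ℝ) (I : Triple) :
    ((χ I : ℤ) : ℝ) * minor (A.map (MvPolynomial.eval y)) I = MvPolynomial.aeval y (Q I) := by
  rw [h.minor_eval]
  rcases Int.units_eq_one_or (χ I) with h1 | h1 <;> simp [h1]

lemma crossRatio_section (h : PosChart χ A e Q) {y : Fin 4 → ℝ}
    (hy : Generic (A.map (MvPolynomial.eval y))) (i : Fin 4) :
    (h.crossRatio i).evalMat (A.map (MvPolynomial.eval y)) = y i := by
  rw [crossRatio_evalMat]
  simp only [h.sign_mul_minor]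
  exact h.prod_aeval_zpow (h.generic_iff.mp hy) i

theorem mk_crossRatio (h : PosChart χ A e Q) {M : Matrix (Fin 3) (Fin 6) ℝ} (hM : Generic M)
    (hy : Generic (A.map (MvPolynomial.eval fun i => (h.crossRatio i).evalMat M))) :
    Chirotopal.mk _ hy = Chirotopal.mk M hM := by
  have hne : ∀ I, ((χ I : ℤ) : ℝ) * minor M I ≠ 0 := fun I =>
    mul_ne_zero (by exact_mod_cast (χ I).ne_zero) (hM I)
  obtain ⟨k, t, hkt⟩ := h.recon ℝ (fun I => Units.mk0 _ (hne I)) (threeTerm_minor χ M)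
  refine mk_eq_of_minor hM hy (k := k) (t := t) fun I => ?_
  have h1 : (fun i => ((∏ J, Units.mk0 _ (hne J) ^ e i J : ℝˣ) : ℝ)) =
      fun i => (h.crossRatio i).evalMat M := by
    funext i
    rw [crossRatio_evalMat, Units.coe_prod]
    exact Finset.prod_congr rfl fun J _ => by rw [Units.val_zpow_eq_zpow_val]; rfl
  have h2 := hkt I
  rw [h1] at h2
  rw [h.minor_eval, h2, Units.val_mk0]
  rcases Int.units_eq_one_or (χ I) with h3 | h3 <;> simp only [h3] <;> push_cast <;> ring

theorem isBirationalPair (h : PosChart χ A e Q) :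
    IsBirationalPair (ratMatrix A) h.crossRatio := by
  refine ⟨⟨WithLp.toLp 2 fun _ => 1, ?_⟩, fun y => ?_, fun x hx => ?_⟩
  · exact mem_paramDomain.mpr (h.hasSigns (y := fun _ => 1) fun _ => one_pos).generic
  · have hy := mem_paramDomain.mp y.2
    ext i
    change (h.crossRatio i).evalMat (evalMatrix (ratMatrix A) y) = _
    rw [evalMatrix_ratMatrix]
    exact h.crossRatio_section hy i
  · induction x using Quotient.inductionOn with | _ M
    have hc : (fun i => (h.crossRatio i).evalMat M.1) =
      fun i => crossRatioMap h.crossRatio (Quotient.mk configSetoid M) i := rfl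
    have hy : Generic (A.map (MvPolynomial.eval fun i => (h.crossRatio i).evalMat M.1)) := by
      rw [hc]
      exact mem_paramDomain.mp hx
    refine Eq.trans ?_ (h.mk_crossRatio M.2 hy)
    simp only [paramMap, evalMatrix_ratMatrix]
    rfl

lemma mem_paramDomain_of_pos (h : PosChart χ A e Q) {y : E4} (hy : y ∈ posOrthant) :
    y ∈ paramDomain (ratMatrix A) :=
  mem_paramDomain.mpr (h.hasSigns hy).generic

lemma crossRatio_pos (h : PosChart χ A e Q) {x : X36} (hx : x ∈ realizationSpace χ) :
    crossRatioMap h.crossRatio x ∈ posOrthant := by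
  obtain ⟨M, hM, rfl⟩ := hx
  intro i
  refine lt_of_lt_of_eq ?_ (h.crossRatio_evalMat i M).symm
  exact Finset.prod_pos fun I _ => zpow_pos (hasSigns_iff_pos.mp hM I) _

lemma contMDiff_param (h : PosChart χ A e Q) : ContMDiff 𝓘(ℝ, E4) 𝓘(ℝ, E4) ∞
    fun y : posOrthant => Chirotopal.mk (A.map (MvPolynomial.eval fun i => (y : E4) i))
      (h.hasSigns y.2).generic := by
  refine ContMDiff.of_comp_isOpenEmbedding isOpenEmbedding_coord fun y => ?_
  have h1 : ∀ p : Poly4, ContDiff ℝ ∞ fun y : E4 => MvPolynomial.eval (fun i => y i) p := by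
    intro p
    rw [contDiff_iff_contDiffAt]
    intro x
    have : AnalyticAt ℝ (fun y : E4 => MvPolynomial.aeval (fun i => y i) p) x :=
      AnalyticAt.aeval_mvPolynomial
        (fun i => ((EuclideanSpace.proj i : E4 →L[ℝ] ℝ)).analyticAt x) p
    exact this.contDiffAt
  have h2 : ContDiffAt ℝ ∞
      (fun y : E4 => coordMat (A.map (MvPolynomial.eval fun i => y i))) (y : E4) :=
    contDiffAt_coordMat (fun i j => (h1 (A i j)).contDiffAt) (h.hasSigns y.2).generic
  exact h2.contMDiffAt.comp y contMDiff_subtype_val.contMDiffAt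

/-- The diffeomorphism from the positive orthant to the configuration space. -/
def diffeo (h : PosChart χ A e Q) :
    posOrthant ≃ₘ^∞⟮𝓘(ℝ, E4), 𝓘(ℝ, E4)⟯ realizationSpace χ where
  toFun y := ⟨Chirotopal.mk (A.map (MvPolynomial.eval fun i => (y : E4) i)) (h.hasSigns y.2).generic,
    _, h.hasSigns y.2, rfl⟩
  invFun x := ⟨crossRatioMap h.crossRatio x, h.crossRatio_pos x.2⟩
  left_inv y := Subtype.ext (by
    ext i
    exact h.crossRatio_section (h.hasSigns y.2).generic i)
  right_inv := by
    rintro ⟨x, M, hM, rfl⟩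
    exact Subtype.ext (h.mk_crossRatio hM.generic _)
  contMDiff_toFun := by
    rw [← ContMDiff.subtypeVal_comp_iff]
    exact h.contMDiff_param
  contMDiff_invFun := by
    rw [← ContMDiff.subtypeVal_comp_iff]
    exact (contMDiff_crossRatioMap _).comp contMDiff_subtype_val

lemma diffeo_apply (h : PosChart χ A e Q) (y : posOrthant) : (h.diffeo y : X36) =
    Chirotopal.mk (A.map (MvPolynomial.eval fun i => (y : E4) i)) (h.hasSigns y.2).generic := rfl

lemma crossRatio_diffeo (h : PosChart χ A e Q) (y : posOrthant) (i : Fin 4) :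
    (h.crossRatio i).eval (h.diffeo y) = (y : E4) i :=
  h.crossRatio_section (h.hasSigns y.2).generic i

lemma diffeo_eq_paramMap (h : PosChart χ A e Q) (y : posOrthant) :
    (h.diffeo y : X36) = paramMap (ratMatrix A) ⟨y, h.mem_paramDomain_of_pos y.2⟩ := by
  simp only [diffeo_apply, paramMap, evalMatrix_ratMatrix]

lemma logForm_diffeo (h : PosChart χ A e Q) (y : posOrthant) :
    (logForm h.crossRatio (h.diffeo y)).compLinearMap
      (mfderiv 𝓘(ℝ, E4) 𝓘(ℝ, E4) (fun z : posOrthant => (h.diffeo z : X36)) y).toLinearMap =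
      orthantForm y :=
  logForm_comp h.crossRatio (fun z : posOrthant => (h.diffeo z : X36)) y
    (h.contMDiff_param.mdifferentiableAt (by simp)) _
    fun i => Filter.Eventually.of_forall fun z => congrArg Real.log (h.crossRatio_diffeo z i)

theorem exists_factors (h : PosChart χ A e Q) :
    ∃ F : Finset Poly4, ListsFactors (ratMatrix A) F ∧
      Nonempty (realizationSpace χ ≃ₘ^∞⟮𝓘(ℝ, E4), 𝓘(ℝ, E4)⟯
        interiorOpens (newtonPolytope (∏ f ∈ F, f))) ∧
      Nonempty (normalFan (newtonPolytope (∏ f ∈ F, f)) ≃o chiroFan χ) := by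
  obtain ⟨F, hF, h0, hface⟩ := exists_listsFactors h.minor_ne_zero
  simp only [h.faceIncl_minor] at hface
  obtain ⟨Ψ⟩ := nonempty_diffeo_interior (h.interior_newtonPolytope_nonempty h0 hface)
  exact ⟨F, hF, ⟨(h.diffeo.symm.trans orthantDiffeo).trans Ψ⟩, h.fan_orderIso h0 hface⟩

end PosChart

/-! ### Relabelling and reorientation -/

/-- The action of a permutation of the labels on triples. -/
def tripleMap (σ : Equiv.Perm (Fin 6)) : Triple ≃ Triple where
  toFun I := ⟨I.1.map σ.toEmbedding, by rw [Finset.card_map, I.2]⟩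
  invFun I := ⟨I.1.map σ.symm.toEmbedding, by rw [Finset.card_map, I.2]⟩
  left_inv I := Subtype.ext (by ext; simp)
  right_inv I := Subtype.ext (by ext; simp)

lemma tripleMap_tri (σ : Equiv.Perm (Fin 6)) {a b c : Fin 6} (hab : a ≠ b) (hac : a ≠ c)
    (hbc : b ≠ c) : tripleMap σ (tri a b c) = tri (σ a) (σ b) (σ c) := by
  refine Subtype.ext ?_
  rw [tri_val (σ.injective.ne hab) (σ.injective.ne hac) (σ.injective.ne hbc)]
  simp only [tripleMap, Equiv.coe_fn_mk, tri_val hab hac hbc]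
  ext
  simp

lemma mem_tripleMap {σ : Equiv.Perm (Fin 6)} {I : Triple} {j : Fin 6} :
    σ j ∈ (tripleMap σ I).1 ↔ j ∈ I.1 := by
  simp [tripleMap]

lemma prod_tripleMap {S : Type*} [CommMonoid S] (σ : Equiv.Perm (Fin 6)) (I : Triple)
    (t : Fin 6 → S) : ∏ j ∈ (tripleMap σ I).1, t j = ∏ j ∈ I.1, t (σ j) := by
  simp [tripleMap]

lemma sum_tripleMap {S : Type*} [AddCommMonoid S] (σ : Equiv.Perm (Fin 6)) (I : Triple)
    (t : Fin 6 → S) : ∑ j ∈ (tripleMap σ I).1, t j = ∑ j ∈ I.1, t (σ j) := by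
  simp [tripleMap]

/-- `χ'` arises from `χ` by relabelling with `σ` and reorienting the elements with `s j = -1`. -/
def Reoriented (σ : Equiv.Perm (Fin 6)) (s : Fin 6 → ℤˣ) (χ χ' : SignVector) : Prop :=
  ∀ a b c, a ≠ b → a ≠ c → b ≠ c → ochi χ' a b c = s a * s b * s c * ochi χ (σ a) (σ b) (σ c)

lemma minor_submatrix {R : Type*} [CommRing R] (χ : SignVector) (M : Matrix (Fin 3) (Fin 6) R)
    (σ : Equiv.Perm (Fin 6)) {a b c : Fin 6} (hab : a < b) (hbc : b < c) :
    minor (M.submatrix id σ) (tri a b c) = ((ochi χ (σ a) (σ b) (σ c) : ℤ) : R) *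
      (((χ (tri (σ a) (σ b) (σ c)) : ℤ) : R) * minor M (tri (σ a) (σ b) (σ c))) := by
  rw [← det3_eq_ochi χ M (σ.injective.ne hab.ne) (σ.injective.ne (hab.trans hbc).ne)
    (σ.injective.ne hbc.ne), minor_tri _ hab hbc]
  simp only [det3, Matrix.submatrix_submatrix]
  congr 1
  ext i j
  fin_cases j <;> rfl

lemma minor_smul_col {R : Type*} [CommRing R] (M : Matrix (Fin 3) (Fin 6) R) (s : Fin 6 → R)
    (I : Triple) : minor (Matrix.of fun i j => s j * M i j) I = (∏ j ∈ I.1, s j) * minor M I := by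
  have h2 : ∏ k, s (I.1.orderEmbOfFin I.2 k) = ∏ j ∈ I.1, s j := by
    conv_rhs => rw [← Finset.map_orderEmbOfFin_univ I.1 I.2, Finset.prod_map]
    rfl
  rw [← h2, minor, minor, ← Matrix.det_mul_row]
  rfl

lemma sgn3_of_lt {a b c : Fin 6} (hab : a < b) (hbc : b < c) : sgn3 a b c = 1 := by
  simp [sgn3, hab, hbc, hab.trans hbc]

lemma Reoriented.minor {R : Type*} [CommRing R] {σ : Equiv.Perm (Fin 6)} {s : Fin 6 → ℤˣ}
    {χ χ' : SignVector} (h : Reoriented σ s χ χ') (M : Matrix (Fin 3) (Fin 6) R) (I : Triple) :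
    minor (Matrix.of fun i j => ((s j : ℤ) : R) * M i (σ j)) I =
      ((χ' I : ℤ) : R) * (((χ (tripleMap σ I) : ℤ) : R) * Chirotopal.minor M (tripleMap σ I)) := by
  obtain ⟨a, b, c, hab, hbc, rfl⟩ := exists_tri I
  have h1 := minor_smul_col (M.submatrix id σ) (fun j => ((s j : ℤ) : R)) (tri a b c)
  have hac := hab.trans hbc
  rw [minor_submatrix χ M σ hab hbc] at h1
  refine h1.trans ?_
  have h2 := h a b c hab.ne hac.ne hbc.ne
  rw [ochi, sgn3_of_lt hab hbc, one_mul] at h2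
  rw [h2, tripleMap_tri σ hab.ne hac.ne hbc.ne, tri_val hab.ne hac.ne hbc.ne,
    Finset.prod_insert (by simp [hab.ne, hac.ne]), Finset.prod_pair hbc.ne]
  push_cast
  ring

/-- The labels of the triples in lexicographic order. -/
def labels : Fin 20 → Fin 3 → Fin 6 :=
  ![![0, 1, 2], ![0, 1, 3], ![0, 1, 4], ![0, 1, 5], ![0, 2, 3], ![0, 2, 4], ![0, 2, 5],
    ![0, 3, 4], ![0, 3, 5], ![0, 4, 5], ![1, 2, 3], ![1, 2, 4], ![1, 2, 5], ![1, 3, 4],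
    ![1, 3, 5], ![1, 4, 5], ![2, 3, 4], ![2, 3, 5], ![2, 4, 5], ![3, 4, 5]]

lemma triple_val (n : Fin 20) : (triple n).1 = {labels n 0, labels n 1, labels n 2} := by
  revert n; decide

lemma labels_lt (n : Fin 20) : labels n 0 < labels n 1 ∧ labels n 1 < labels n 2 := by
  revert n; decide

@[to_additive]
lemma prod_triple {S : Type*} [CommMonoid S] (n : Fin 20) (t : Fin 6 → S) :
    ∏ j ∈ (triple n).1, t j = t (labels n 0) * t (labels n 1) * t (labels n 2) := by
  obtain ⟨h1, h2⟩ := labels_lt n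
  rw [triple_val, Finset.prod_insert (by simp [h1.ne, (h1.trans h2).ne]), Finset.prod_pair h2.ne,
    mul_assoc]

/-- Coordinates satisfying all three-term ties lie in the lineality space. -/
lemma exists_lineality {ρ : Triple → ℝ} (hρ : ∀ l a b c d : Fin 6, [l, a, b, c, d].Nodup →
      ρ (tri l a b) + ρ (tri l c d) = ρ (tri l a c) + ρ (tri l b d)) :
    ∃ t : Fin 6 → ℝ, ∀ I, ρ I = ∑ j ∈ I.1, t j := by
  have hr : ∀ (l a b c d : Fin 6) (n₁ n₂ n₃ n₄ : Fin 20),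
      [l, a, b, c, d].Nodup ∧ tri l a b = triple n₁ ∧ tri l c d = triple n₂ ∧
        tri l a c = triple n₃ ∧ tri l b d = triple n₄ →
      ρ (triple n₁) + ρ (triple n₂) = ρ (triple n₃) + ρ (triple n₄) := by
    rintro l a b c d n₁ n₂ n₃ n₄ ⟨h, h1, h2, h3, h4⟩
    rw [← h1, ← h2, ← h3, ← h4]
    exact hρ l a b c d h
  have e0 := hr 0 1 3 4 2 1 5 2 4 (by decide)
  have e1 := hr 0 1 2 4 3 0 7 2 4 (by decide)
  have e2 := hr 0 1 3 5 2 1 6 3 4 (by decide)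
  have e3 := hr 0 1 2 5 3 0 8 3 4 (by decide)
  have e4 := hr 0 1 2 4 5 0 9 2 6 (by decide)
  have e5 := hr 1 0 3 4 2 1 11 2 10 (by decide)
  have e6 := hr 1 0 2 4 3 0 13 2 10 (by decide)
  have e7 := hr 1 0 3 5 2 1 12 3 10 (by decide)
  have e8 := hr 1 0 2 5 3 0 14 3 10 (by decide)
  have e9 := hr 1 0 2 4 5 0 15 2 12 (by decide)
  have e10 := hr 2 0 1 3 4 0 16 4 11 (by decide)
  have e11 := hr 2 0 1 3 5 0 17 4 12 (by decide)
  have e12 := hr 2 0 1 4 5 0 18 5 12 (by decide)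
  have e13 := hr 3 0 1 4 5 1 19 7 14 (by decide)
  let t : Fin 4 → ℝ := ![(ρ (triple 0) + ρ (triple 1) + ρ (triple 4) - 2 * ρ (triple 10)) / 3,
    (ρ (triple 0) + ρ (triple 1) + ρ (triple 10) - 2 * ρ (triple 4)) / 3,
    (ρ (triple 0) + ρ (triple 4) + ρ (triple 10) - 2 * ρ (triple 1)) / 3,
    (ρ (triple 1) + ρ (triple 4) + ρ (triple 10) - 2 * ρ (triple 0)) / 3]
  refine ⟨![t 0, t 1, t 2, t 3, ρ (triple 2) - t 0 - t 1, ρ (triple 3) - t 0 - t 1], ?_⟩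
  rw [forall_triple]
  intro n
  rw [sum_triple]
  fin_cases n <;>
    simp only [labels, t, Matrix.cons_val, Fin.isValue, Fin.zero_eta, Fin.mk_one,
      Fin.reduceFinMk] <;> linarith

lemma tie_of_balanced {e : Triple → ℤ} (he : ∀ j : Fin 6, ∑ I : Triple with j ∈ I.1, e I = 0)
    {ρ : Triple → ℝ} (hρ : ∀ l a b c d : Fin 6, [l, a, b, c, d].Nodup →
      ρ (tri l a b) + ρ (tri l c d) = ρ (tri l a c) + ρ (tri l b d)) :
    ∑ I, (e I : ℝ) * ρ I = 0 := by
  obtain ⟨t, hkt⟩ := exists_lineality hρ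
  have h5 : ∑ I : Triple, (e I : ℝ) * ∑ j ∈ I.1, t j = 0 := by
    have : ∑ j : Fin 6, t j * ∑ I : Triple with j ∈ I.1, (e I : ℝ) = 0 :=
      Finset.sum_eq_zero fun j _ => by
        have : ∑ I : Triple with j ∈ I.1, (e I : ℝ) = 0 := by exact_mod_cast he j
        rw [this, mul_zero]
    simp only [Finset.sum_filter, Finset.mul_sum] at this
    rw [Finset.sum_comm] at this
    rw [← this]
    refine Finset.sum_congr rfl fun I _ => ?_
    rw [Finset.mul_sum, ← Finset.sum_subset (Finset.subset_univ I.1)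
      (f := fun j => t j * if j ∈ I.1 then (e I : ℝ) else 0) fun j _ hj => by simp [hj]]
    exact Finset.sum_congr rfl fun j hj => by rw [if_pos hj, mul_comm]
  simpa only [hkt] using h5

lemma rearr {S : Type*} [CommMonoid S] (a b c o a' b' c' o' : S) :
    a * b * c * o * (a' * b' * c' * o') = (a * a') * (b * b') * (c * c') * (o * o') := by
  ac_rfl

namespace PosChart

variable {χ χ' : SignVector} {A : Matrix (Fin 3) (Fin 6) Poly4} {e : Fin 4 → Triple → ℤ}
  {Q : Triple → MvPolynomial (Fin 4) ℕ} {σ : Equiv.Perm (Fin 6)} {s : Fin 6 → ℤˣ}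

/-- Positive charts can be transported along relabellings and reorientations. -/
theorem reorient (h : PosChart χ A e Q) (hr : Reoriented σ s χ χ') :
    PosChart χ' (Matrix.of fun i j => ((s j : ℤ) : Poly4) * A i (σ j))
      (fun i I => e i (tripleMap σ I)) (fun I => Q (tripleMap σ I)) := by
  have hb : ∀ i (j : Fin 6), ∑ I : Triple with j ∈ I.1, e i (tripleMap σ I) = 0 := by
    intro i j
    rw [← h.balanced i (σ j), Finset.sum_filter, Finset.sum_filter,
      ← Equiv.sum_comp (tripleMap σ) fun J => if σ j ∈ J.1 then e i J else 0]
    simp only [mem_tripleMap]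
  refine ⟨fun I => ?_, fun I => h.ne_zero _, hb, fun i => ?_, fun i ρ => tie_of_balanced (hb i),
    fun S _ P hP => ?_, fun w u k t ht I => ?_⟩
  · rw [hr.minor, h.minor_eq, ← mul_assoc (((χ _ : ℤˣ) : ℤ) : Poly4)]
    rcases Int.units_eq_one_or (χ (tripleMap σ I)) with h1 | h1 <;> simp [h1]
  · rw [Equiv.prod_comp (tripleMap σ) fun I => Q I ^ (e i I).toNat,
      Equiv.prod_comp (tripleMap σ) fun I => Q I ^ (-e i I).toNat]
    exact h.section_eq i
  · have hP' : ThreeTerm χ fun I => ((P ((tripleMap σ).symm I) : Sˣ) : S) := by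
      intro l a b c d hn h1 h2
      obtain ⟨l, rfl⟩ := σ.surjective l
      obtain ⟨a, rfl⟩ := σ.surjective a
      obtain ⟨b, rfl⟩ := σ.surjective b
      obtain ⟨c, rfl⟩ := σ.surjective c
      obtain ⟨d, rfl⟩ := σ.surjective d
      have hn' : [l, a, b, c, d].Nodup := by
        simpa using (List.nodup_map_iff (l := [l, a, b, c, d]) σ.injective).mp hn
      obtain ⟨⟨n1, n2, n3, n4⟩, ⟨n5, n6, n7⟩, ⟨n8, n9⟩, n10⟩ := nodup_five hn'
      simp only [← tripleMap_tri σ n1 n2 n5, ← tripleMap_tri σ n3 n4 n10,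
        ← tripleMap_tri σ n1 n3 n6, ← tripleMap_tri σ n2 n4 n9, ← tripleMap_tri σ n1 n4 n7,
        ← tripleMap_tri σ n2 n3 n8, Equiv.symm_apply_apply]
      refine hP l a b c d hn' ?_ ?_
      · rw [hr l a b n1 n2 n5, hr l c d n3 n4 n10, hr l a c n1 n3 n6, hr l b d n2 n4 n9]
        rw [rearr, h1]
        ac_rfl
      · rw [hr l a b n1 n2 n5, hr l c d n3 n4 n10, hr l a d n1 n4 n7, hr l b c n2 n3 n8]
        rw [rearr, h2, mul_neg, neg_inj]
        ac_rfl
    obtain ⟨k, t, hkt⟩ := h.recon S _ hP'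
    refine ⟨k, fun j => t (σ j), fun I => ?_⟩
    have h1 := hkt (tripleMap σ I)
    rw [Equiv.symm_apply_apply, prod_tripleMap] at h1
    rw [← h1]
    congr 2
    funext i
    rw [← Equiv.prod_comp (tripleMap σ) fun J => P ((tripleMap σ).symm J) ^ e i J]
    simp only [Equiv.symm_apply_apply]
  · have h1 := h.rigid w u k (fun j => t (σ.symm j)) (fun J => ?_) (tripleMap σ I)
    · rw [sum_tripleMap] at h1
      simpa using h1
    · obtain ⟨J, rfl⟩ := (tripleMap σ).surjective J
      rw [sum_tripleMap]
      simpa using ht J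

end PosChart

/-! ### Relabelling configurations -/

lemma relabel_relabel (σ τ : Equiv.Perm (Fin 6)) (x : X36) :
    relabel τ (relabel σ x) = relabel (σ * τ) x := by
  induction x using Quotient.inductionOn with | _ M
  rfl

lemma relabel_one (x : X36) : relabel 1 x = x := by
  induction x using Quotient.inductionOn with | _ M
  rfl

lemma Reoriented.relabel_mem {σ : Equiv.Perm (Fin 6)} {s : Fin 6 → ℤˣ} {χ χ' : SignVector}
    (h : Reoriented σ s χ χ') {x : X36} (hx : x ∈ realizationSpace χ) :
    relabel σ x ∈ realizationSpace χ' := by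
  obtain ⟨M, hM, rfl⟩ := hx
  have hN : HasSigns χ' (Matrix.of fun i j => ((s j : ℤ) : ℝ) * M i (σ j)) := by
    rw [hasSigns_iff_pos] at hM ⊢
    intro I
    rw [h.minor]
    have := hM (tripleMap σ I)
    rcases Int.units_eq_one_or (χ' I) with h1 | h1 <;> simpa [h1] using this
  refine ⟨_, hN, (Quotient.sound ?_).symm⟩
  refine ⟨1, fun j => Units.map (Int.castRingHom ℝ).toMonoidHom (s j), ?_⟩
  ext i j
  simp [Matrix.mul_diagonal, mul_comm]

/-- The sign of a real number, as a unit. -/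
def signUnit (x : ℝ) : ℤˣ := if 0 < x then 1 else -1

lemma signUnit_mul_abs (x : ℝ) : x = ((signUnit x : ℤ) : ℝ) * |x| := by
  rw [signUnit]
  split_ifs with h
  · simp [abs_of_pos h]
  · simp [abs_of_nonpos (not_lt.mp h)]

lemma unit_eq_of_mul_eq {u v : ℤˣ} {p q : ℝ} (hp : 0 < p) (hq : 0 < q)
    (h : ((u : ℤ) : ℝ) * p = ((v : ℤ) : ℝ) * q) : u = v := by
  rcases Int.units_eq_one_or u with rfl | rfl <;> rcases Int.units_eq_one_or v with rfl | rfl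
  · rfl
  · simp at h; linarith
  · simp at h; linarith
  · rfl

/-- Configuration spaces that are matched by a relabelling come from reorientation-equivalent
sign vectors. -/
lemma exists_reoriented {σ : Equiv.Perm (Fin 6)} {χ χ' : SignVector} {x : X36}
    (hx : x ∈ realizationSpace χ) (hx' : relabel σ x ∈ realizationSpace χ') :
    ∃ s, Reoriented σ s χ χ' := by
  obtain ⟨M, hM, rfl⟩ := hx
  obtain ⟨N, hN, hNM⟩ := hx'
  obtain ⟨g, t, hgt⟩ := (Quotient.exact hNM).symm
  rw [hasSigns_iff_pos] at hM hN
  change N = g.1 * M.submatrix id σ * Matrix.diagonal _ at hgt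
  have hg : g.1.det ≠ 0 := ((Matrix.isUnit_iff_isUnit_det g.1).mp g.isUnit).ne_zero
  refine ⟨fun j => signUnit g.1.det * signUnit (t j), fun a b c hab hac hbc => ?_⟩
  have h1 := det3_act g.1 (M.submatrix id σ) (fun j => ((t j : ℝˣ) : ℝ)) ![a, b, c]
  have h2 : det3 (M.submatrix id σ) ![a, b, c] = det3 M ![σ a, σ b, σ c] := by
    simp only [det3, Matrix.submatrix_submatrix]
    congr 1
    ext i j
    fin_cases j <;> rfl
  rw [← hgt, h2, det3_eq_ochi χ' N hab hac hbc, det3_eq_ochi χ M (σ.injective.ne hab)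
    (σ.injective.ne hac) (σ.injective.ne hbc), Fin.prod_univ_three] at h1
  simp only [Matrix.cons_val] at h1
  refine unit_eq_of_mul_eq (hN (tri a b c)) (q := (χ (tri (σ a) (σ b) (σ c)) : ℤ) *
    minor M (tri (σ a) (σ b) (σ c)) * (|g.1.det| * |(t a : ℝ)| * |(t b : ℝ)| * |(t c : ℝ)|))
    (mul_pos (hM _) ?_) (h1.trans ?_)
  · have h3 := fun j => abs_pos.mpr (t j).ne_zero
    have h4 := abs_pos.mpr hg
    have := h3 a
    have := h3 b
    have := h3 c
    positivity
  · conv_lhs => rw [signUnit_mul_abs g.1.det, signUnit_mul_abs (t a), signUnit_mul_abs (t b),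
      signUnit_mul_abs (t c)]
    have hsq : ((signUnit g.1.det : ℤ) : ℝ) ^ 3 = ((signUnit g.1.det : ℤ) : ℝ) := by
      rcases Int.units_eq_one_or (signUnit g.1.det) with h | h <;> norm_num [h]
    push_cast
    generalize ((signUnit g.1.det : ℤ) : ℝ) = s0 at *
    linear_combination -(((signUnit (t a : ℝ) : ℤ) : ℝ) *
      ((signUnit (t b : ℝ) : ℤ) : ℝ) * ((signUnit (t c : ℝ) : ℤ) : ℝ) *
      ((ochi χ (σ a) (σ b) (σ c) : ℤ) : ℝ) * (((χ (tri (σ a) (σ b) (σ c)) : ℤ) : ℝ) *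
      minor M (tri (σ a) (σ b) (σ c)) * (|g.1.det| * |(t a : ℝ)| * |(t b : ℝ)| * |(t c : ℝ)|))) * hsq

lemma abs_evalMat (c : CrossRatio) (M : Matrix (Fin 3) (Fin 6) ℝ) :
    |c.evalMat M| = ∏ I, |minor M I| ^ c.expo I := by
  rw [CrossRatio.evalMat, abs_mul, Finset.abs_prod]
  simp only [abs_zpow]
  rcases Int.units_eq_one_or c.sign with h1 | h1 <;> simp [h1]

lemma abs_minor_submatrix (M : Matrix (Fin 3) (Fin 6) ℝ) (σ : Equiv.Perm (Fin 6)) (I : Triple) :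
    |minor (M.submatrix id σ) I| = |minor M (tripleMap σ I)| := by
  obtain ⟨a, b, c, hab, hbc, rfl⟩ := exists_tri I
  rw [minor_submatrix (fun _ => 1) M σ hab hbc, tripleMap_tri σ hab.ne (hab.trans hbc).ne hbc.ne,
    abs_mul]
  rcases Int.units_eq_one_or (ochi (fun _ => 1) (σ a) (σ b) (σ c)) with h1 | h1 <;> simp [h1]

lemma log_eval_relabel {c c' : CrossRatio} {σ : Equiv.Perm (Fin 6)}
    (h : ∀ I, c'.expo I = c.expo (tripleMap σ I)) (x : X36) :
    Real.log (c'.eval (relabel σ x)) = Real.log (c.eval x) := by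
  induction x using Quotient.inductionOn with | _ M
  rw [← Real.log_abs, ← Real.log_abs (c.eval _)]
  congr 1
  refine (abs_evalMat c' (M.1.submatrix id σ)).trans (Eq.trans ?_ (abs_evalMat c M.1).symm)
  simp only [abs_minor_submatrix, h]
  exact Equiv.prod_comp (tripleMap σ) fun I => |minor M.1 I| ^ c.expo I

/-! ### Invariance of logarithmic forms -/

/-- The wedge product of the differentials of four functions. -/
def wedgeForm (g : Fin 4 → X36 → ℝ) (x : X36) : TangentSpace 𝓘(ℝ, E4) x [⋀^Fin 4]→ₗ[ℝ] ℝ :=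
  (Matrix.detRowAlternating : (Fin 4 → ℝ) [⋀^Fin 4]→ₗ[ℝ] ℝ).compLinearMap
    (LinearMap.pi fun i => (mfderiv 𝓘(ℝ, E4) 𝓘(ℝ, ℝ) (g i) x :
        TangentSpace 𝓘(ℝ, E4) x →L[ℝ] ℝ).toLinearMap)

lemma logForm_eq (c : Fin 4 → CrossRatio) (x : X36) :
    logForm c x = wedgeForm (fun i z => Real.log ((c i).eval z)) x := rfl

lemma logForm_relabel (c : Fin 4 → CrossRatio) (σ : Equiv.Perm (Fin 6)) (x : X36) :
    (logForm c (relabel σ x)).compLinearMap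
      (mfderiv 𝓘(ℝ, E4) 𝓘(ℝ, E4) (relabel σ) x).toLinearMap =
    wedgeForm (fun i z => Real.log ((c i).eval (relabel σ z))) x :=
  logForm_comp c (relabel σ) x ((contMDiff_relabel σ).mdifferentiableAt (by simp)) _
    fun _ => Filter.EventuallyEq.rfl

/-- Relabelling by `σ` maps the configuration space of `χ` to itself and preserves the logarithmic
form of `c` up to sign. -/
def PreservesLogForm (χ : SignVector) (c : Fin 4 → CrossRatio) (σ : Equiv.Perm (Fin 6)) : Prop :=
  (∀ x ∈ realizationSpace χ, relabel σ x ∈ realizationSpace χ) ∧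
  ∃ ε : ℤˣ, ∀ x ∈ realizationSpace χ,
    (logForm c (relabel σ x)).compLinearMap
      (mfderiv 𝓘(ℝ, E4) 𝓘(ℝ, E4) (relabel σ) x).toLinearMap = ((ε : ℤ) : ℝ) • logForm c x

lemma compLinearMap_smul' {V W : Type*} [AddCommGroup V] [Module ℝ V] [AddCommGroup W] [Module ℝ W]
    (a : ℝ) (f : W [⋀^Fin 4]→ₗ[ℝ] ℝ) (T : V →ₗ[ℝ] W) :
    (a • f).compLinearMap T = a • f.compLinearMap T := by
  ext; rfl

lemma wedgeForm_relabel_relabel (c : Fin 4 → CrossRatio) (σ τ : Equiv.Perm (Fin 6)) (x : X36) :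
    ((logForm c (relabel τ (relabel σ x))).compLinearMap
      (mfderiv 𝓘(ℝ, E4) 𝓘(ℝ, E4) (relabel τ) (relabel σ x)).toLinearMap).compLinearMap
      (mfderiv 𝓘(ℝ, E4) 𝓘(ℝ, E4) (relabel σ) x).toLinearMap =
    wedgeForm (fun i z => Real.log ((c i).eval (relabel τ (relabel σ z)))) x := by
  have hd : ∀ (ρ : Equiv.Perm (Fin 6)) z,
      MDifferentiableAt 𝓘(ℝ, E4) 𝓘(ℝ, E4) (relabel ρ) z :=
    fun ρ z => (contMDiff_relabel ρ).mdifferentiableAt (by simp)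
  have h1 := mfderiv_comp x (hd τ (relabel σ x)) (hd σ x)
  have h2 := logForm_comp c (relabel τ ∘ relabel σ) x ((hd τ (relabel σ x)).comp x (hd σ x)) _
    fun _ => Filter.EventuallyEq.rfl
  refine Eq.trans ?_ h2
  rw [h1]
  rfl

lemma PreservesLogForm.mul {χ : SignVector} {c : Fin 4 → CrossRatio} {σ τ : Equiv.Perm (Fin 6)}
    (hσ : PreservesLogForm χ c σ) (hτ : PreservesLogForm χ c τ) :
    PreservesLogForm χ c (σ * τ) := by
  obtain ⟨m1, ε1, h1⟩ := hσ
  obtain ⟨m2, ε2, h2⟩ := hτ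
  refine ⟨fun x hx => by rw [← relabel_relabel]; exact m2 _ (m1 x hx), ε2 * ε1, fun x hx => ?_⟩
  rw [logForm_relabel]
  simp only [← relabel_relabel]
  rw [← wedgeForm_relabel_relabel, h2 _ (m1 x hx), compLinearMap_smul', h1 x hx, smul_smul]
  push_cast
  rfl

lemma preservesLogForm_one (χ : SignVector) (c : Fin 4 → CrossRatio) :
    PreservesLogForm χ c 1 := by
  refine ⟨fun x hx => by rwa [relabel_one], 1, fun x _ => ?_⟩
  rw [logForm_relabel]
  simp only [relabel_one]
  simp [logForm_eq]

/-- Transport of invariance along relabellings. -/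
theorem logForm_canonical {χ : SignVector} {c c₁ c₂ : Fin 4 → CrossRatio}
    {σ σ₁ σ₂ : Equiv.Perm (Fin 6)} (hτ : PreservesLogForm χ c (σ₁ * σ * σ₂⁻¹))
    (h₁ : ∀ i I, (c₁ i).expo I = (c i).expo (tripleMap σ₁ I))
    (h₂ : ∀ i I, (c₂ i).expo I = (c i).expo (tripleMap σ₂ I)) :
    ∃ ε : ℤˣ, ∀ z ∈ realizationSpace χ,
      (logForm c₂ (relabel σ (relabel σ₁ z))).compLinearMap
        (mfderiv 𝓘(ℝ, E4) 𝓘(ℝ, E4) (relabel σ) (relabel σ₁ z)).toLinearMap =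
      ((ε : ℤ) : ℝ) • logForm c₁ (relabel σ₁ z) := by
  obtain ⟨-, ε, hε⟩ := hτ
  refine ⟨ε, fun z hz => ?_⟩
  have hinv : ∀ (ρ : Equiv.Perm (Fin 6)) (x : X36), relabel ρ (relabel ρ⁻¹ x) = x := fun ρ x => by
    rw [relabel_relabel, inv_mul_cancel, relabel_one]
  have hinv' : ∀ (ρ : Equiv.Perm (Fin 6)) (x : X36), relabel ρ⁻¹ (relabel ρ x) = x := fun ρ x => by
    rw [relabel_relabel, mul_inv_cancel, relabel_one]
  have e1 : ∀ i x, Real.log ((c₁ i).eval x) = Real.log ((c i).eval (relabel σ₁⁻¹ x)) :=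
    fun i x => by rw [← log_eval_relabel (h₁ i), hinv]
  have e2 : ∀ i x, Real.log ((c₂ i).eval (relabel σ x)) =
      Real.log ((c i).eval (relabel (σ₁ * σ * σ₂⁻¹) (relabel σ₁⁻¹ x))) := fun i x => by
    rw [← log_eval_relabel (h₂ i), relabel_relabel, relabel_relabel]
    congr 3
    group
  rw [logForm_relabel, logForm_eq c₁]
  simp only [e1, e2]
  rw [← wedgeForm_relabel_relabel, hinv', hε z hz, compLinearMap_smul']
  congr 1
  have h3 := logForm_relabel c σ₁⁻¹ (relabel σ₁ z)
  rw [hinv'] at h3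
  exact h3

/-! ### Constructing positive charts from data listed in lexicographic order -/

/-- A function on triples given by its values in lexicographic order. -/
def ofVec {α : Type*} (v : Fin 20 → α) (I : Triple) : α := v (tripleEquiv.symm I)

@[simp] lemma ofVec_triple {α : Type*} (v : Fin 20 → α) (n : Fin 20) : ofVec v (triple n) = v n :=
  congrArg v (tripleEquiv.symm_apply_apply n)

@[to_additive]
lemma prod_eq_prod_triple {S : Type*} [CommMonoid S] (f : Triple → S) :
    ∏ I, f I = ∏ n, f (triple n) :=
  (Equiv.prod_comp tripleEquiv f).symm

lemma ThreeTerm.rel {v : Fin 20 → ℤˣ} {S : Type*} [Mul S] [Add S] {P : Triple → S}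
    (h : ThreeTerm (ofVec v) P) (l a b c d : Fin 6) (n₁ n₂ n₃ n₄ n₅ n₆ : Fin 20)
    (hn : [l, a, b, c, d].Nodup ∧ tri l a b = triple n₁ ∧ tri l c d = triple n₂ ∧
      tri l a c = triple n₃ ∧ tri l b d = triple n₄ ∧ tri l a d = triple n₅ ∧
      tri l b c = triple n₆ ∧
      sgn3 l a b * v n₁ * (sgn3 l c d * v n₂) = sgn3 l a c * v n₃ * (sgn3 l b d * v n₄) ∧
      sgn3 l a b * v n₁ * (sgn3 l c d * v n₂) = -(sgn3 l a d * v n₅ * (sgn3 l b c * v n₆))) :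
    P (triple n₁) * P (triple n₂) =
      P (triple n₃) * P (triple n₄) + P (triple n₅) * P (triple n₆) := by
  obtain ⟨h0, h1, h2, h3, h4, h5, h6, h7, h8⟩ := hn
  have := h l a b c d h0
  simp only [ochi, h1, h2, h3, h4, h5, h6, ofVec_triple] at this
  exact this h7 h8

lemma exists_gauge {G : Type*} [CommGroup G] (p : Triple → G) :
    ∃ (k : G) (t : Fin 6 → G), ∀ n ∈ ({0, 1, 2, 3, 4, 10} : Finset (Fin 20)),
      p (triple n) * k * ∏ j ∈ (triple n).1, t j = 1 := by
  have key : ∀ (A : Type _) [AddCommGroup A] (a b c d f : A),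
      a - (a + b + c + d) + (d + c + b) = 0 ∧ b - (a + b + c + d) + (d + c + a) = 0 ∧
      c - (a + b + c + d) + (d + b + a) = 0 ∧ d - (a + b + c + d) + (c + b + a) = 0 ∧
      f - (a + b + c + d) + (d + c + (a + b - f)) = 0 := by
    intro A _ a b c d f
    refine ⟨?_, ?_, ?_, ?_, ?_⟩ <;> abel
  have key' := key (Additive G)
  refine ⟨(p (triple 0) * p (triple 1) * p (triple 4) * p (triple 10))⁻¹,
    ![p (triple 10), p (triple 4), p (triple 1), p (triple 0),
      p (triple 0) * p (triple 1) / p (triple 2), p (triple 0) * p (triple 1) / p (triple 3)],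
    fun n hn => ?_⟩
  rw [prod_triple, ← div_eq_mul_inv]
  simp only [Finset.mem_insert, Finset.mem_singleton] at hn
  rcases hn with rfl | rfl | rfl | rfl | rfl | rfl
  · exact (key' _ _ _ _ 0).1
  · exact (key' _ _ _ _ 0).2.1
  · exact (key' _ _ _ _ _).2.2.2.2
  · exact (key' _ _ _ _ _).2.2.2.2
  · exact (key' _ _ _ _ 0).2.2.1
  · exact (key' _ _ _ _ 0).2.2.2.1

lemma prod_scale_zpow {G : Type*} [CommGroup G] {e : Triple → ℤ}
    (he : ∀ j : Fin 6, ∑ I : Triple with j ∈ I.1, e I = 0) (p : Triple → G) (k : G)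
    (t : Fin 6 → G) : ∏ I, (p I * k * ∏ j ∈ I.1, t j) ^ e I = ∏ I, p I ^ e I := by
  have hz : ∀ (u : G) (s : Finset Triple), ∏ I ∈ s, u ^ e I = u ^ ∑ I ∈ s, e I := by
    intro u s
    induction s using Finset.induction_on with
    | empty => simp
    | insert a s ha ih => rw [Finset.prod_insert ha, Finset.sum_insert ha, ih, zpow_add]
  have hsum : ∑ I, e I = 0 := by
    have h1 : ∑ j : Fin 6, ∑ I : Triple with j ∈ I.1, e I = 0 :=
      Finset.sum_eq_zero fun j _ => he j
    simp only [Finset.sum_filter] at h1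
    rw [Finset.sum_comm] at h1
    have h2 : ∀ I : Triple, ∑ j : Fin 6, (if j ∈ I.1 then e I else 0) = 3 * e I := by
      intro I
      rw [← Finset.sum_filter, Finset.filter_mem_eq_inter, Finset.univ_inter, Finset.sum_const,
        I.2]
      simp
    simp only [h2, ← Finset.mul_sum] at h1
    omega
  have htor : ∏ I : Triple, (∏ j ∈ I.1, t j) ^ e I = 1 := by
    have h4 : ∀ I : Triple, (∏ j ∈ I.1, t j) ^ e I =
        ∏ j : Fin 6, if j ∈ I.1 then t j ^ e I else 1 := by
      intro I
      rw [← Finset.prod_zpow, ← Finset.prod_filter, Finset.filter_mem_eq_inter,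
        Finset.univ_inter]
    simp only [h4]
    rw [Finset.prod_comm]
    refine Finset.prod_eq_one fun j _ => ?_
    rw [← Finset.prod_filter, hz, he j, zpow_zero]
  simp only [mul_zpow, Finset.prod_mul_distrib, hz, hsum, htor, zpow_zero, mul_one]

lemma ThreeTerm.scale {χ : SignVector} {S : Type*} [CommSemiring S] {P : Triple → S}
    (h : ThreeTerm χ P) (k : S) (t : Fin 6 → S) :
    ThreeTerm χ fun I => P I * k * ∏ j ∈ I.1, t j := by
  intro l a b c d hn h1 h2
  have h3 := h l a b c d hn h1 h2
  obtain ⟨⟨n1, n2, n3, n4⟩, ⟨n5, n6, n7⟩, ⟨n8, n9⟩, n10⟩ := nodup_five hn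
  have hp : ∀ {x y z : Fin 6}, x ≠ y → x ≠ z → y ≠ z →
      ∏ j ∈ (tri x y z).1, t j = t x * t y * t z := fun hxy hxz hyz => by
    rw [tri_val hxy hxz hyz, Finset.prod_insert (by simp [hxy, hxz]), Finset.prod_pair hyz,
      mul_assoc]
  simp only [hp n1 n2 n5, hp n3 n4 n10, hp n1 n3 n6, hp n2 n4 n9, hp n1 n4 n7, hp n2 n3 n8]
  calc _ = (P (tri l a b) * P (tri l c d)) * (k ^ 2 * (t l ^ 2 * t a * t b * t c * t d)) := by ring
    _ = _ := by rw [h3]; ring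

/-- It suffices to reconstruct Plücker vectors in the gauge where the first four labels form a
projective frame. -/
lemma recon_of_gauge {χ : SignVector} {e : Fin 4 → Triple → ℤ}
    {Q : Triple → MvPolynomial (Fin 4) ℕ}
    (he : ∀ i (j : Fin 6), ∑ I : Triple with j ∈ I.1, e i I = 0) {S : Type} [CommSemiring S]
    (H : ∀ P : Triple → Sˣ, ThreeTerm χ (fun I => (P I : S)) →
      (∀ n ∈ ({0, 1, 2, 3, 4, 10} : Finset (Fin 20)), P (triple n) = 1) →
      ∃ t : Fin 6 → S, ∀ I,
        MvPolynomial.aeval (fun i => ((∏ J, P J ^ e i J : Sˣ) : S)) (Q I) = P I * ∏ j ∈ I.1, t j)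
    (P : Triple → Sˣ) (hP : ThreeTerm χ (fun I => (P I : S))) :
    ∃ (k : S) (t : Fin 6 → S), ∀ I,
      MvPolynomial.aeval (fun i => ((∏ J, P J ^ e i J : Sˣ) : S)) (Q I) =
        P I * k * ∏ j ∈ I.1, t j := by
  obtain ⟨k, t, hkt⟩ := exists_gauge P
  obtain ⟨t', ht'⟩ := H (fun I => P I * k * ∏ j ∈ I.1, t j) (by
    have := hP.scale (k : S) fun j => (t j : S)
    simpa only [Units.val_mul, Units.coe_prod] using this) hkt
  refine ⟨k, fun j => t j * t' j, fun I => ?_⟩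
  simp only [prod_scale_zpow (he _)] at ht'
  rw [ht', Finset.prod_mul_distrib]
  push_cast
  ring

/-- The matrix whose first four columns are the standard projective frame. -/
def frame {R : Type*} [CommRing R] (a b c d e f : R) : Matrix (Fin 3) (Fin 6) R :=
  !![1, 0, 0, 1, a, b;
     0, 1, 0, 1, c, d;
     0, 0, 1, 1, e, f]

lemma minor_frame {R : Type*} [CommRing R] (a b c d e f : R) (n : Fin 20) :
    minor (frame a b c d e f) (triple n) =
      (![1, 1, e, f, -1, -c, -d, e - c, f - d, c * f - d * e, 1, a, b, a - e, b - f, b * e - a * f,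
        c - a, d - b, a * d - b * c, c * f - d * e + (b * e - a * f) + (a * d - b * c)] :
        Fin 20 → R) n := by
  have h : minor (frame a b c d e f) (triple n) =
      det3 (frame a b c d e f) ![labels n 0, labels n 1, labels n 2] := by
    have : triple n = tri (labels n 0) (labels n 1) (labels n 2) := by revert n; decide
    rw [this]
    exact minor_tri _ (labels_lt n).1 (labels_lt n).2
  rw [h, det3, Matrix.det_fin_three]
  fin_cases n <;> simp [frame, labels] <;> ring

lemma ne_zero_of_eval_one {q : MvPolynomial (Fin 4) ℕ}
    (h : MvPolynomial.eval (fun _ => 1) q ≠ 0) : q ≠ 0 := by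
  rintro rfl
  exact h (map_zero _)

/-- A criterion for positive charts. -/
theorem PosChart.of_frame (v : Fin 20 → ℤˣ) (a b c d e f : Poly4) (E : Fin 4 → Fin 20 → ℤ)
    (q : Fin 20 → MvPolynomial (Fin 4) ℕ)
    (hminor : ∀ n, minor (frame a b c d e f) (triple n) =
      ((v n : ℤ) : Poly4) * MvPolynomial.map (Nat.castRingHom ℝ) (q n))
    (hne : ∀ n, MvPolynomial.eval (fun _ => 1) (q n) ≠ 0)
    (hbal : ∀ i (j : Fin 6), ∑ n, (if j ∈ (triple n).1 then E i n else 0) = 0)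
    (hsec : ∀ i, ∏ n, q n ^ (E i n).toNat = MvPolynomial.X i * ∏ n, q n ^ (-E i n).toNat)
    (hrecon : ∀ (S : Type) [CommSemiring S] (P : Triple → Sˣ),
      ThreeTerm (ofVec v) (fun I => (P I : S)) →
      (∀ n ∈ ({0, 1, 2, 3, 4, 10} : Finset (Fin 20)), P (triple n) = 1) →
      ∃ t : Fin 6 → S, ∀ n, MvPolynomial.aeval
        (fun i => ((∏ m, P (triple m) ^ E i m : Sˣ) : S)) (q n) =
          P (triple n) * ∏ j ∈ (triple n).1, t j)
    (hrigid : ∀ (w u : Fin 4 → ℝ) (k : ℝ) (t : Fin 6 → ℝ),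
      (∀ n, tropVal (q n) (w + u) = tropVal (q n) w + tropVal (q n) u +
        (k + (t (labels n 0) + t (labels n 1) + t (labels n 2)))) →
      k = -(t 0 + t 1 + t 2) ∧ ∀ j, t j = t 0) :
    PosChart (ofVec v) (frame a b c d e f) (fun i => ofVec (E i)) (ofVec q) := by
  have hb : ∀ i (j : Fin 6), ∑ I : Triple with j ∈ I.1, ofVec (E i) I = 0 := by
    intro i j
    rw [Finset.sum_filter, sum_eq_sum_triple]
    simpa only [ofVec_triple] using hbal i j
  refine ⟨forall_triple.mpr fun n => ?_, forall_triple.mpr fun n => ?_, hb, fun i => ?_,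
    fun i ρ => tie_of_balanced (hb i), fun S _ P hP => recon_of_gauge hb (fun P hP hg => ?_) P hP,
    fun w u k t h => ?_⟩
  · rw [hminor, ofVec_triple, ofVec_triple]
  · rw [ofVec_triple]; exact ne_zero_of_eval_one (hne n)
  · rw [prod_eq_prod_triple, prod_eq_prod_triple]
    simpa only [ofVec_triple] using hsec i
  · obtain ⟨t, ht⟩ := hrecon S P hP hg
    refine ⟨t, forall_triple.mpr fun n => ?_⟩
    simpa only [ofVec_triple, prod_eq_prod_triple] using ht n
  · obtain ⟨h1, h2⟩ := hrigid w u k t fun n => by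
      have := h (triple n)
      rwa [ofVec_triple, sum_triple] at this
    refine forall_triple.mpr fun n => ?_
    rw [sum_triple, h2 (labels n 0), h2 (labels n 1), h2 (labels n 2), h1, h2 1, h2 2]
    ring

/-! ### The base charts -/

lemma prod_zpow_eq_seed {G : Type*} [CommGroup G] {p : Fin 20 → G}
    (hp : ∀ n ∈ ({0, 1, 2, 3, 4, 10} : Finset (Fin 20)), p n = 1) {E : Fin 20 → ℤ} {m : Fin 20}
    (hE : E m = 1 ∧ ∀ n, n ≠ m → n ∉ ({0, 1, 2, 3, 4, 10} : Finset (Fin 20)) → E n = 0) :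
    ∏ n, p n ^ E n = p m := by
  rw [Finset.prod_eq_single m (fun n _ hn => ?_) (by simp), hE.1, zpow_one]
  by_cases h : n ∈ ({0, 1, 2, 3, 4, 10} : Finset (Fin 20))
  · rw [hp n h, one_zpow]
  · rw [hE.2 n hn h, zpow_zero]

lemma tropVal_mul_nat {f g : MvPolynomial (Fin 4) ℕ}
    (hf : MvPolynomial.eval (fun _ => 1) f ≠ 0) (hg : MvPolynomial.eval (fun _ => 1) g ≠ 0)
    (u : Fin 4 → ℝ) : tropVal (f * g) u = tropVal f u + tropVal g u :=
  tropVal_mul (ne_zero_of_eval_one hf) (ne_zero_of_eval_one hg) u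

/-- The signs of the base chirotope 0. -/
def baseSign0 : Fin 20 → ℤˣ :=
  ![1, 1, 1, 1, -1, 1, 1, 1, 1, -1, 1, -1, -1, -1, -1, 1, 1, 1, 1, 1]

/-- The minors of the base chart 0 up to sign. -/
def baseMinor0 {R : Type*} [CommSemiring R] (x y z w : R) : Fin 20 → R :=
  ![1, 1, x, 1, 1, x * (x + y), x, x * (1 + x + y), 1 + x, x * y, 1, (x + y) * (x + z) + w, x + z,
    (x + y) * (x + z) + w + x, 1 + x + z, x * y + (y * z + w), x * z + (y * z + w), z, x * w,
    x * w + (y * z + w)]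

/-- The exponents of the cross-ratios of the base chart 0. -/
def baseExpo0 : Fin 4 → Fin 20 → ℤ :=
  ![![0, 1, 0, -1, -1, 0, 1, 0, 0, 0, 0, 0, 0, 0, 0, 0, 0, 0, 0, 0],
    ![1, 1, -1, -1, -1, 0, 0, 0, 0, 1, 0, 0, 0, 0, 0, 0, 0, 0, 0, 0],
    ![1, 1, 0, -1, -1, 0, 0, 0, 0, 0, -1, 0, 0, 0, 0, 0, 0, 1, 0, 0],
    ![1, 2, -1, -1, -1, 0, 0, 0, 0, 0, -1, 0, 0, 0, 0, 0, 0, 0, 1, 0]]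

lemma baseRecon0 {S : Type} [CommSemiring S] (P : Triple → Sˣ)
    (hP : ThreeTerm (ofVec baseSign0) (fun I => (P I : S)))
    (hg : ∀ n ∈ ({0, 1, 2, 3, 4, 10} : Finset (Fin 20)), P (triple n) = 1) :
    ∃ t : Fin 6 → S, ∀ n, baseMinor0 (P (triple 6) : S) (P (triple 9)) (P (triple 17))
      (P (triple 18)) n = P (triple n) * ∏ j ∈ (triple n).1, t j := by
  have r035 := hP.rel 0 3 5 1 2 8 0 1 6 4 3 (by decide)
  have r024 := hP.rel 0 2 4 1 5 5 3 0 9 6 2 (by decide)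
  have r034 := hP.rel 0 3 4 1 5 7 3 1 9 8 2 (by decide)
  have r125 := hP.rel 2 1 5 0 3 12 4 0 17 10 6 (by decide)
  have r124 := hP.rel 2 1 4 0 5 11 6 0 18 12 5 (by decide)
  have r234 := hP.rel 2 3 4 0 5 16 6 4 18 17 5 (by decide)
  have r134 := hP.rel 3 1 4 0 2 13 4 1 16 10 7 (by decide)
  have r135 := hP.rel 3 1 5 0 2 14 4 1 17 10 8 (by decide)
  have r145 := hP.rel 4 1 5 0 2 15 5 2 18 11 9 (by decide)
  have r345 := hP.rel 4 3 5 0 2 19 5 7 18 16 9 (by decide)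
  have g0 := congrArg Units.val (hg 0 (by decide))
  have g1 := congrArg Units.val (hg 1 (by decide))
  have g2 := congrArg Units.val (hg 2 (by decide))
  have g3 := congrArg Units.val (hg 3 (by decide))
  have g4 := congrArg Units.val (hg 4 (by decide))
  have g10 := congrArg Units.val (hg 10 (by decide))
  obtain ⟨p, hp⟩ : ∃ p : Fin 20 → S, ∀ n, p n = P (triple n) := ⟨_, fun _ => rfl⟩
  simp only [← hp, Units.val_one] at r035 r024 r034 r125 r124 r234 r134 r135 r145 r345 g0 g1 g2 g3 g4 g10 ⊢
  simp only [g0, g1, g2, g3, g4, g10, one_mul, mul_one] at r035 r024 r034 r125 r124 r234 r134 r135 r145 r345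
  set x := p 6
  set y := p 9
  set z := p 17
  set w := p 18
  have h5 : p 5 = x + y := by rw [r024, add_comm]
  have h8 : p 8 = 1 + x := by rw [r035, add_comm]
  have h7 : p 7 = 1 + x + y := by rw [r034, h8, add_comm]
  have h12 : p 12 = x + z := by rw [r125, add_comm]
  have h14 : p 14 = 1 + x + z := by rw [r135, h8, add_comm]
  have h11 : p 11 * x = (x + y) * (x + z) + w := by rw [r124, h5, h12]; ring
  have h16 : p 16 * x = x * z + (y * z + w) := by rw [r234, h5]; ring
  have h13 : p 13 * x = (x + y) * (x + z) + w + x := by rw [r134, add_mul, h16, h7]; ring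
  have h15 : p 15 * x = x * y + (y * z + w) := by
    refine (Units.mul_right_inj (P (triple 5))).mp ?_
    simp only [← hp]
    calc p 5 * (p 15 * x) = x * (p 15 * p 5) := by ring
      _ = x * w + (p 11 * x) * y := by rw [r145]; ring
      _ = p 5 * (x * y + (y * z + w)) := by rw [h11, h5]; ring
  have h19 : p 19 * x = x * w + (y * z + w) := by
    refine (Units.mul_right_inj (P (triple 5))).mp ?_
    simp only [← hp]
    calc p 5 * (p 19 * x) = x * (p 19 * p 5) := by ring
      _ = x * p 7 * w + (p 16 * x) * y := by rw [r345]; ring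
      _ = p 5 * (x * w + (y * z + w)) := by rw [h16, h7, h5]; ring
  refine ⟨![1, 1, 1, 1, x, 1], fun n => ?_⟩
  rw [prod_triple]
  fin_cases n <;> simp only [baseMinor0, labels, Matrix.cons_val, Fin.isValue, Fin.zero_eta,
    Fin.mk_one, Fin.reduceFinMk, one_mul, mul_one, g0, g1, g2, g3, g4, g10, h5, h8, h7, h12, h14, h11, h16, h13, h15, h19] <;> ring

theorem basePosChart0 : ∃ A, PosChart (ofVec baseSign0) A (fun i => ofVec (baseExpo0 i))
    (ofVec (baseMinor0 (MvPolynomial.X 0) (MvPolynomial.X 1) (MvPolynomial.X 2)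
      (MvPolynomial.X 3))) := by
  refine ⟨_, PosChart.of_frame _ (-((MvPolynomial.X 0 + MvPolynomial.X 1) * (MvPolynomial.X 0 + MvPolynomial.X 2) + MvPolynomial.X 3)) (-(MvPolynomial.X 0 + MvPolynomial.X 2)) (-(MvPolynomial.X 0 * (MvPolynomial.X 0 + MvPolynomial.X 1))) (-MvPolynomial.X 0) (MvPolynomial.X 0) 1 _ _ (fun n => ?_) (fun n => ?_) (by decide)
    (fun i => ?_) (fun S _ P hP hg => ?_) (fun w u k t h => ?_)⟩
  · rw [minor_frame]
    fin_cases n <;> simp [baseMinor0, baseSign0] <;> ring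
  · fin_cases n <;> simp [baseMinor0]
  · fin_cases i <;> simp [Fin.prod_univ_succ, baseMinor0, baseExpo0] <;> ring
  · obtain ⟨t, ht⟩ := baseRecon0 P hP hg
    refine ⟨t, fun n => ?_⟩
    have hy : ∀ i, ∏ m, P (triple m) ^ baseExpo0 i m = ![P (triple 6), P (triple 9), P (triple 17), P (triple 18)] i := by
      intro i
      fin_cases i <;> exact prod_zpow_eq_seed (p := fun n => P (triple n)) hg (by decide)
    simp only [hy]
    rw [← ht n]
    fin_cases n <;> simp [baseMinor0]
  · have h0 := h 0
    have h1 := h 1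
    have h2 := h 2
    have h3 := h 3
    have h4 := h 4
    have h10 := h 10
    simp only [baseMinor0, labels, Matrix.cons_val, Fin.isValue, tropVal_one, tropVal_X,
      Pi.add_apply] at h0 h1 h2 h3 h4 h10
    refine ⟨by linarith, fun j => ?_⟩
    fin_cases j <;> simp only [Fin.zero_eta, Fin.mk_one, Fin.reduceFinMk] <;> linarith

/-- The signs of the base chirotope 1. -/
def baseSign1 : Fin 20 → ℤˣ :=
  ![1, 1, 1, 1, -1, -1, -1, -1, -1, -1, 1, -1, -1, -1, -1, -1, 1, 1, -1, -1]

/-- The minors of the base chart 1 up to sign. -/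
def baseMinor1 {R : Type*} [CommSemiring R] (x y z w : R) : Fin 20 → R :=
  ![1, 1, 1, y, 1, 1 + x, (1 + x) * y + ((1 + x) * z + w), x, x * y + ((1 + x) * z + w),
    (1 + x) * z + w, 1, y, y * (y + z), 1 + y, y * (1 + y + z), y * z, 1 + x + y,
    y * (1 + x + y + z) + ((1 + x) * z + w), y * w, y * (z + w) + ((1 + x) * z + w)]

/-- The exponents of the cross-ratios of the base chart 1. -/
def baseExpo1 : Fin 4 → Fin 20 → ℤ :=
  ![![1, 0, -1, 0, -1, 0, 0, 1, 0, 0, 0, 0, 0, 0, 0, 0, 0, 0, 0, 0],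
    ![0, 1, -1, 0, 0, 0, 0, 0, 0, 0, -1, 1, 0, 0, 0, 0, 0, 0, 0, 0],
    ![1, 1, -1, -1, 0, 0, 0, 0, 0, 0, -1, 0, 0, 0, 0, 1, 0, 0, 0, 0],
    ![1, 2, -1, -1, -1, 0, 0, 0, 0, 0, -1, 0, 0, 0, 0, 0, 0, 0, 1, 0]]

lemma baseRecon1 {S : Type} [CommSemiring S] (P : Triple → Sˣ)
    (hP : ThreeTerm (ofVec baseSign1) (fun I => (P I : S)))
    (hg : ∀ n ∈ ({0, 1, 2, 3, 4, 10} : Finset (Fin 20)), P (triple n) = 1) :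
    ∃ t : Fin 6 → S, ∀ n, baseMinor1 (P (triple 7) : S) (P (triple 11)) (P (triple 15))
      (P (triple 18)) n = P (triple n) * ∏ j ∈ (triple n).1, t j := by
  have r024 := hP.rel 0 2 4 1 3 5 1 0 7 4 2 (by decide)
  have r134 := hP.rel 1 3 4 0 2 13 0 1 11 10 2 (by decide)
  have r125 := hP.rel 1 2 5 0 4 12 2 0 15 11 3 (by decide)
  have r135 := hP.rel 1 3 5 0 4 14 2 1 15 13 3 (by decide)
  have r234 := hP.rel 2 3 4 0 1 16 0 4 11 10 5 (by decide)
  have r025 := hP.rel 2 0 5 1 4 6 11 0 18 5 12 (by decide)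
  have r235 := hP.rel 2 3 5 1 4 17 11 10 18 16 12 (by decide)
  have r045 := hP.rel 4 0 5 1 2 9 11 2 18 5 15 (by decide)
  have r345 := hP.rel 4 3 5 0 2 19 5 7 18 16 9 (by decide)
  have r035 := hP.rel 0 3 5 1 4 8 2 1 9 7 3 (by decide)
  have g0 := congrArg Units.val (hg 0 (by decide))
  have g1 := congrArg Units.val (hg 1 (by decide))
  have g2 := congrArg Units.val (hg 2 (by decide))
  have g3 := congrArg Units.val (hg 3 (by decide))
  have g4 := congrArg Units.val (hg 4 (by decide))
  have g10 := congrArg Units.val (hg 10 (by decide))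
  obtain ⟨p, hp⟩ : ∃ p : Fin 20 → S, ∀ n, p n = P (triple n) := ⟨_, fun _ => rfl⟩
  simp only [← hp, Units.val_one] at r024 r134 r125 r135 r234 r025 r235 r045 r345 r035 g0 g1 g2 g3 g4 g10 ⊢
  simp only [g0, g1, g2, g3, g4, g10, one_mul, mul_one] at r024 r134 r125 r135 r234 r025 r235 r045 r345 r035
  set x := p 7
  set y := p 11
  set z := p 15
  set w := p 18
  have h5 : p 5 = 1 + x := by rw [r024, add_comm]
  have h13 : p 13 = 1 + y := by rw [r134, add_comm]
  have h12 : p 12 = y + z := by rw [r125, add_comm]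
  have h14 : p 14 = 1 + y + z := by rw [r135, h13, add_comm]
  have h16 : p 16 = 1 + x + y := by rw [r234, h5, add_comm]
  have h6 : p 6 * y = (1 + x) * y + ((1 + x) * z + w) := by rw [r025, h5, h12]; ring
  have h17 : p 17 * y = y * (1 + x + y + z) + ((1 + x) * z + w) := by rw [r235, h16, h12]; ring
  have h9 : p 9 * y = (1 + x) * z + w := by rw [r045, h5]; ring
  have h8 : p 8 * y = x * y + ((1 + x) * z + w) := by rw [r035, add_mul, h9, add_comm]
  have h19 : p 19 * y = y * (z + w) + ((1 + x) * z + w) := by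
    refine (Units.mul_right_inj (P (triple 5))).mp ?_
    simp only [← hp]
    calc p 5 * (p 19 * y) = y * (p 19 * p 5) := by ring
      _ = y * (x * w) + p 16 * (p 9 * y) := by rw [r345]; ring
      _ = p 5 * (y * (z + w) + ((1 + x) * z + w)) := by rw [h9, h16, h5]; ring
  refine ⟨![1, 1, 1, 1, 1, y], fun n => ?_⟩
  rw [prod_triple]
  fin_cases n <;> simp only [baseMinor1, labels, Matrix.cons_val, Fin.isValue, Fin.zero_eta,
    Fin.mk_one, Fin.reduceFinMk, one_mul, mul_one, g0, g1, g2, g3, g4, g10, h5, h13, h12, h14, h16, h6, h17, h9, h8, h19] <;> ring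

theorem basePosChart1 : ∃ A, PosChart (ofVec baseSign1) A (fun i => ofVec (baseExpo1 i))
    (ofVec (baseMinor1 (MvPolynomial.X 0) (MvPolynomial.X 1) (MvPolynomial.X 2)
      (MvPolynomial.X 3))) := by
  refine ⟨_, PosChart.of_frame _ (-MvPolynomial.X 1) (-(MvPolynomial.X 1 * (MvPolynomial.X 1 + MvPolynomial.X 2))) (1 + MvPolynomial.X 0) ((1 + MvPolynomial.X 0) * MvPolynomial.X 1 + ((1 + MvPolynomial.X 0) * MvPolynomial.X 2 + MvPolynomial.X 3)) 1 (MvPolynomial.X 1) _ _ (fun n => ?_) (fun n => ?_) (by decide)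
    (fun i => ?_) (fun S _ P hP hg => ?_) (fun w u k t h => ?_)⟩
  · rw [minor_frame]
    fin_cases n <;> simp [baseMinor1, baseSign1] <;> ring
  · fin_cases n <;> simp [baseMinor1]
  · fin_cases i <;> simp [Fin.prod_univ_succ, baseMinor1, baseExpo1] <;> ring
  · obtain ⟨t, ht⟩ := baseRecon1 P hP hg
    refine ⟨t, fun n => ?_⟩
    have hy : ∀ i, ∏ m, P (triple m) ^ baseExpo1 i m = ![P (triple 7), P (triple 11), P (triple 15), P (triple 18)] i := by
      intro i
      fin_cases i <;> exact prod_zpow_eq_seed (p := fun n => P (triple n)) hg (by decide)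
    simp only [hy]
    rw [← ht n]
    fin_cases n <;> simp [baseMinor1]
  · have h0 := h 0
    have h1 := h 1
    have h2 := h 2
    have h3 := h 3
    have h4 := h 4
    have h10 := h 10
    simp only [baseMinor1, labels, Matrix.cons_val, Fin.isValue, tropVal_one, tropVal_X,
      Pi.add_apply] at h0 h1 h2 h3 h4 h10
    refine ⟨by linarith, fun j => ?_⟩
    fin_cases j <;> simp only [Fin.zero_eta, Fin.mk_one, Fin.reduceFinMk] <;> linarith

/-- The signs of the base chirotope 2. -/
def baseSign2 : Fin 20 → ℤˣ :=
  ![1, 1, 1, 1, -1, -1, 1, -1, 1, 1, 1, -1, 1, -1, 1, 1, 1, -1, -1, -1]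

/-- The minors of the base chart 2 up to sign. -/
def baseMinor2 {R : Type*} [CommSemiring R] (x y z w : R) : Fin 20 → R :=
  ![1, 1, 1, y, 1, 1 + y, x * y, y, (1 + x) * y, (1 + x + y) * y, 1, z,
    y + ((1 + x) * (1 + z) + w), 1 + z, (1 + x) * (1 + z) + w, y * (1 + z) + ((1 + x) * (1 + z) + w),
    1 + y + z, (1 + x) * y + ((1 + x) * (1 + z) + w),
    (2 + x + y + z + w) * y + ((1 + x) * (1 + z) + w), y * w]

/-- The exponents of the cross-ratios of the base chart 2. -/
def baseExpo2 : Fin 4 → Fin 20 → ℤ :=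
  ![![0, 1, 0, -1, -1, 0, 1, 0, 0, 0, 0, 0, 0, 0, 0, 0, 0, 0, 0, 0],
    ![1, 0, -1, 0, -1, 0, 0, 1, 0, 0, 0, 0, 0, 0, 0, 0, 0, 0, 0, 0],
    ![0, 1, -1, 0, 0, 0, 0, 0, 0, 0, -1, 1, 0, 0, 0, 0, 0, 0, 0, 0],
    ![2, 1, -1, -1, -1, 0, 0, 0, 0, 0, -1, 0, 0, 0, 0, 0, 0, 0, 0, 1]]

lemma baseRecon2 {S : Type} [CommSemiring S] (P : Triple → Sˣ)
    (hP : ThreeTerm (ofVec baseSign2) (fun I => (P I : S)))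
    (hg : ∀ n ∈ ({0, 1, 2, 3, 4, 10} : Finset (Fin 20)), P (triple n) = 1) :
    ∃ t : Fin 6 → S, ∀ n, baseMinor2 (P (triple 6) : S) (P (triple 7)) (P (triple 11))
      (P (triple 19)) n = P (triple n) * ∏ j ∈ (triple n).1, t j := by
  have r024 := hP.rel 0 2 4 1 3 5 1 0 7 4 2 (by decide)
  have r035 := hP.rel 0 3 5 1 2 8 0 1 6 4 3 (by decide)
  have r045 := hP.rel 0 4 5 1 2 9 0 2 6 5 3 (by decide)
  have r134 := hP.rel 1 3 4 0 2 13 0 1 11 10 2 (by decide)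
  have r234 := hP.rel 2 3 4 0 1 16 0 4 11 10 5 (by decide)
  have r135 := hP.rel 3 1 5 0 4 14 7 1 19 13 8 (by decide)
  have r235 := hP.rel 3 2 5 0 4 17 7 4 19 16 8 (by decide)
  have r145 := hP.rel 4 1 5 0 3 15 7 2 19 13 9 (by decide)
  have r245 := hP.rel 4 2 5 0 3 18 7 5 19 16 9 (by decide)
  have r125 := hP.rel 5 1 2 0 3 12 8 3 17 14 6 (by decide)
  have g0 := congrArg Units.val (hg 0 (by decide))
  have g1 := congrArg Units.val (hg 1 (by decide))
  have g2 := congrArg Units.val (hg 2 (by decide))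
  have g3 := congrArg Units.val (hg 3 (by decide))
  have g4 := congrArg Units.val (hg 4 (by decide))
  have g10 := congrArg Units.val (hg 10 (by decide))
  obtain ⟨p, hp⟩ : ∃ p : Fin 20 → S, ∀ n, p n = P (triple n) := ⟨_, fun _ => rfl⟩
  simp only [← hp, Units.val_one] at r024 r035 r045 r134 r234 r135 r235 r145 r245 r125 g0 g1 g2 g3 g4 g10 ⊢
  simp only [g0, g1, g2, g3, g4, g10, one_mul, mul_one] at r024 r035 r045 r134 r234 r135 r235 r145 r245 r125
  set x := p 6
  set y := p 7
  set z := p 11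
  set w := p 19
  have h5 : p 5 = 1 + y := by rw [r024, add_comm]
  have h8 : p 8 = 1 + x := by rw [r035, add_comm]
  have h9 : p 9 = 1 + x + y := by rw [r045, h5]; ring
  have h13 : p 13 = 1 + z := by rw [r134, add_comm]
  have h16 : p 16 = 1 + y + z := by rw [r234, h5]; ring
  have h14 : p 14 * y = (1 + x) * (1 + z) + w := by rw [r135, h8, h13]; ring
  have h17 : p 17 * y = (1 + x) * y + ((1 + x) * (1 + z) + w) := by rw [r235, h8, h16]; ring
  have h15 : p 15 * y = y * (1 + z) + ((1 + x) * (1 + z) + w) := by rw [r145, h9, h13]; ring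
  have h18 : p 18 * y = (2 + x + y + z + w) * y + ((1 + x) * (1 + z) + w) := by
    rw [r245, h5, h9, h16]; ring
  have h12 : p 12 * y = y + ((1 + x) * (1 + z) + w) := by
    refine (Units.mul_right_inj (P (triple 8))).mp ?_
    simp only [← hp]
    calc p 8 * (p 12 * y) = y * (p 12 * p 8) := by ring
      _ = p 17 * y + (p 14 * y) * x := by rw [r125]; ring
      _ = p 8 * (y + ((1 + x) * (1 + z) + w)) := by rw [h17, h14, h8]; ring
  refine ⟨![1, 1, 1, 1, 1, y], fun n => ?_⟩
  rw [prod_triple]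
  fin_cases n <;> simp only [baseMinor2, labels, Matrix.cons_val, Fin.isValue, Fin.zero_eta,
    Fin.mk_one, Fin.reduceFinMk, one_mul, mul_one, g0, g1, g2, g3, g4, g10, h5, h8, h9, h13, h16, h14, h17, h15, h18, h12] <;> ring

theorem basePosChart2 : ∃ A, PosChart (ofVec baseSign2) A (fun i => ofVec (baseExpo2 i))
    (ofVec (baseMinor2 (MvPolynomial.X 0) (MvPolynomial.X 1) (MvPolynomial.X 2)
      (MvPolynomial.X 3))) := by
  refine ⟨_, PosChart.of_frame _ (-MvPolynomial.X 2) (MvPolynomial.X 1 + ((1 + MvPolynomial.X 0) * (1 + MvPolynomial.X 2) + MvPolynomial.X 3)) (1 + MvPolynomial.X 1) (-(MvPolynomial.X 0 * MvPolynomial.X 1)) 1 (MvPolynomial.X 1) _ _ (fun n => ?_) (fun n => ?_) (by decide)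
    (fun i => ?_) (fun S _ P hP hg => ?_) (fun w u k t h => ?_)⟩
  · rw [minor_frame]
    fin_cases n <;> simp [baseMinor2, baseSign2] <;> ring
  · fin_cases n <;> simp [baseMinor2]
  · fin_cases i <;> simp [Fin.prod_univ_succ, baseMinor2, baseExpo2] <;> ring
  · obtain ⟨t, ht⟩ := baseRecon2 P hP hg
    refine ⟨t, fun n => ?_⟩
    have hy : ∀ i, ∏ m, P (triple m) ^ baseExpo2 i m = ![P (triple 6), P (triple 7), P (triple 11), P (triple 19)] i := by
      intro i
      fin_cases i <;> exact prod_zpow_eq_seed (p := fun n => P (triple n)) hg (by decide)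
    simp only [hy]
    rw [← ht n]
    fin_cases n <;> simp [baseMinor2]
  · have h0 := h 0
    have h1 := h 1
    have h2 := h 2
    have h3 := h 3
    have h4 := h 4
    have h10 := h 10
    simp only [baseMinor2, labels, Matrix.cons_val, Fin.isValue, tropVal_one, tropVal_X,
      Pi.add_apply] at h0 h1 h2 h3 h4 h10
    refine ⟨by linarith, fun j => ?_⟩
    fin_cases j <;> simp only [Fin.zero_eta, Fin.mk_one, Fin.reduceFinMk] <;> linarith

/-! ### The base chart with icosahedral symmetry -/

/-- The signs of the base chirotope 3. -/
def baseSign3 : Fin 20 → ℤˣ :=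
  ![1, 1, 1, 1, -1, -1, 1, -1, 1, 1, 1, -1, 1, -1, 1, 1, 1, -1, -1, 1]

/-- The exponents of the cross-ratios of the base chart 3. -/
def baseExpo3 : Fin 4 → Fin 20 → ℤ :=
  ![![1, 0, -1, 0, -1, 0, 0, 1, 0, 0, 0, 0, 0, 0, 0, 0, 0, 0, 0, 0],
    ![0, 1, 0, -1, -1, 0, 1, 0, 0, 0, 0, 0, 0, 0, 0, 0, 0, 0, 0, 0],
    ![0, 0, 0, 0, 0, 0, 0, 0, 0, 0, 0, 1, 0, -1, 0, 0, 0, 0, -1, 1],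
    ![0, 0, 0, 0, 0, 0, 0, 0, 0, 0, 1, -1, 0, 0, -1, 1, 0, 0, 0, 0]]

section Polynomials

variable {R : Type*} [CommSemiring R]

/-- Auxiliary polynomial of the base chart 3. -/
def polyD (b r : R) : R := 1 + b + r * b

/-- Auxiliary polynomial of the base chart 3. -/
def polyE (a r s : R) : R := a + r * (1 + s) * (1 + a)

/-- Auxiliary polynomial of the base chart 3. -/
def polyN (a b r s : R) : R := (1 + r) * (1 + a + b) + r * s * (1 + a)

/-- Auxiliary polynomial of the base chart 3. -/
def polyH (a b r s : R) : R := (1 + r + r * s) * (1 + a + b) + s * (1 + b)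

/-- Auxiliary polynomial of the base chart 3. -/
def polyG (a b s : R) : R := 1 + a + b + s * (1 + a) * (1 + b)

/-- The minors of the base chart 3 up to sign. -/
def baseMinor3 (a b r s : R) : Fin 20 → R :=
  ![1, 1, s * polyD b r, s * polyE a r s, 1, (1 + a) * (s * polyD b r), b * (s * polyE a r s),
    a * (s * polyD b r), (1 + b) * (s * polyE a r s),
    (1 + a + b) * ((s * polyD b r) * (s * polyE a r s)), 1, polyN a b r s,
    polyN a b r s * (1 + s), polyH a b r s, polyH a b r s, s * polyN a b r s * polyH a b r s,
    (1 + r) * polyG a b s, (1 + r + r * s) * polyG a b s, s * polyN a b r s * polyG a b s,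
    r * s * polyH a b r s * polyG a b s]

lemma map_baseMinor3 {S : Type*} [CommSemiring S] (f : R →+* S) (a b r s : R) (n : Fin 20) :
    f (baseMinor3 a b r s n) = baseMinor3 (f a) (f b) (f r) (f s) n := by
  fin_cases n <;> simp [baseMinor3, polyD, polyE, polyN, polyH, polyG]

end Polynomials

lemma baseRecon3 {S : Type} [CommSemiring S] (P : Triple → Sˣ)
    (hP : ThreeTerm (ofVec baseSign3) (fun I => (P I : S)))
    (hg : ∀ n ∈ ({0, 1, 2, 3, 4, 10} : Finset (Fin 20)), P (triple n) = 1) (r s : S)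
    (hr : r * ((P (triple 18) : S) * P (triple 13)) = P (triple 11) * P (triple 19))
    (hs : s * ((P (triple 11) : S) * P (triple 14)) = P (triple 15)) :
    ∃ t : Fin 6 → S, ∀ n, baseMinor3 (P (triple 7) : S) (P (triple 6)) r s n =
      P (triple n) * ∏ j ∈ (triple n).1, t j := by
  have r024 := hP.rel 0 2 4 1 3 5 1 0 7 4 2 (by decide)
  have r035 := hP.rel 0 3 5 1 2 8 0 1 6 4 3 (by decide)
  have r045 := hP.rel 0 4 5 1 2 9 0 2 6 5 3 (by decide)
  have r134 := hP.rel 1 3 4 0 2 13 0 1 11 10 2 (by decide)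
  have r125 := hP.rel 1 2 5 0 3 12 1 0 14 10 3 (by decide)
  have r145 := hP.rel 1 4 5 0 2 15 0 2 12 11 3 (by decide)
  have r234 := hP.rel 2 3 4 0 1 16 0 4 11 10 5 (by decide)
  have r235 := hP.rel 2 3 5 0 1 17 0 4 12 10 6 (by decide)
  have e1 := hP.rel 2 0 4 1 5 5 12 0 18 6 11 (by decide)
  have e2 := hP.rel 3 0 5 1 4 8 13 1 19 7 14 (by decide)
  have e3 := hP.rel 4 1 5 2 3 15 16 11 19 13 18 (by decide)
  have e4 := hP.rel 4 0 5 2 3 9 16 5 19 7 18 (by decide)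
  have e5 := hP.rel 5 1 4 2 3 15 17 12 19 14 18 (by decide)
  have e6 := hP.rel 5 0 4 2 3 9 17 6 19 8 18 (by decide)
  have g0 := congrArg Units.val (hg 0 (by decide))
  have g1 := congrArg Units.val (hg 1 (by decide))
  have g2 := congrArg Units.val (hg 2 (by decide))
  have g3 := congrArg Units.val (hg 3 (by decide))
  have g4 := congrArg Units.val (hg 4 (by decide))
  have g10 := congrArg Units.val (hg 10 (by decide))
  obtain ⟨p, hp⟩ : ∃ p : Fin 20 → S, ∀ n, p n = P (triple n) := ⟨_, fun _ => rfl⟩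
  have hcancel : ∀ n x y, p n * x = p n * y → x = y := fun n x y h =>
    (Units.mul_right_inj (P (triple n))).mp (by rwa [← hp n])
  simp only [← hp] at r024 r035 r045 r134 r125 r145 r234 r235 e1 e2 e3
  simp only [← hp, Units.val_one] at e4 e5 e6 hr hs g0 g1 g2 g3 g4 g10 ⊢
  simp only [g0, g1, g2, g3, g4, g10, one_mul, mul_one] at r024 r035 r045 r134 r125 r145
  simp only [g0, g1, g4, g10, one_mul, mul_one] at r234 r235 e1 e2
  set a := p 7
  set b := p 6
  set c := p 11
  set d := p 14
  set X := p 18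
  set Y := p 19
  have h5 : p 5 = 1 + a := by rw [r024, add_comm]
  have h8 : p 8 = 1 + b := by rw [r035, add_comm]
  have h9 : p 9 = 1 + a + b := by rw [r045, h5, add_comm]
  have h13 : p 13 = 1 + c := by rw [r134, add_comm]
  have h12 : p 12 = 1 + d := by rw [r125, add_comm]
  have h15 : p 15 = 1 + c + d := by rw [r145, h12]; ring
  have h16 : p 16 = 1 + a + c := by rw [r234, h5]; ring
  have h17 : p 17 = 1 + b + d := by rw [r235, h12]; ring
  have key : (1 + b) * p 13 * X + b * c * Y = (1 + a) * p 12 * Y + a * d * X := by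
    rw [← h8, ← h5, e1, e2]; ring
  have hN : c * (s * polyD b r) = polyN a b r s := by
    refine hcancel 14 _ _ (hcancel 13 _ _ (hcancel 18 _ _ ?_))
    calc X * (p 13 * (d * (c * (s * polyD b r))))
        = (s * (c * d)) * ((1 + b) * p 13 * X + b * (r * (X * p 13))) := by
          rw [polyD]; ring
      _ = p 15 * ((1 + b) * p 13 * X + b * c * Y) := by rw [hs, hr]; ring
      _ = p 15 * ((1 + a) * p 12 * Y + a * d * X) := by rw [key]
      _ = d * (p 15 * (p 5 * Y + a * X)) + (1 + a) * Y * p 15 := by rw [h5, h12]; ring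
      _ = d * p 9 * (p 15 * p 16) + (1 + a) * Y * p 15 := by rw [← e4]; ring
      _ = d * p 9 * (X * p 13 + r * (X * p 13)) + (1 + a) * Y * (s * (c * d)) := by
          rw [e3, hr, hs]; ring
      _ = d * (1 + a + b) * ((1 + r) * (X * p 13)) + (1 + a) * s * d * (r * (X * p 13)) := by
          rw [hr, h9, add_mul 1 r, hr, one_mul]; ring
      _ = X * (p 13 * (d * polyN a b r s)) := by rw [polyN]; ring
  have hH : p 13 * (s * polyD b r) = polyH a b r s := by
    calc p 13 * (s * polyD b r) = s * polyD b r + c * (s * polyD b r) := by rw [h13]; ring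
      _ = polyH a b r s := by rw [hN, polyD, polyN, polyH]; ring
  have hH' : d * (s * polyE a r s) = polyH a b r s := by
    refine hcancel 14 _ _ (hcancel 13 _ _ (hcancel 18 _ _ (hcancel 11 _ _ (hcancel 11 _ _ ?_))))
    have hcd : c * d + p 15 = p 13 * p 12 := by rw [h15, h13, h12]; ring
    calc c * (c * (X * (p 13 * (d * (d * (s * polyE a r s))))))
        = (s * (c * d)) * (a * X * p 13 * (c * d) +
            (r * (X * p 13)) * (1 + a) * (c * d + s * (c * d))) := by
          rw [polyE]; ring
      _ = p 15 * c * p 13 * ((1 + a) * p 12 * Y + a * d * X) := by rw [hs, hr, hcd]; ring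
      _ = p 15 * c * p 13 * ((1 + b) * p 13 * X + b * c * Y) := by rw [key]
      _ = p 15 * c * p 13 * (c * (b * Y + p 8 * X) + (1 + b) * X) := by rw [h8, h13]; ring
      _ = c * p 13 * (p 9 * c * (p 15 * p 17) + p 15 * (1 + b) * X) := by rw [← e6]; ring
      _ = c * (p 9 * (d * c * (X * p 13) + c * Y * (p 13 * p 12)) + p 15 * (1 + b) * (X * p 13)) := by
          rw [e5]; ring
      _ = c * (p 9 * (d * c * (X * p 13) + (r * (X * p 13)) * (c * d + s * (c * d))) +
            (s * (c * d)) * (1 + b) * (X * p 13)) := by rw [← hcd, hs, hr]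
      _ = c * (c * (X * (p 13 * (d * polyH a b r s)))) := by rw [h9, polyH]; ring
  have hG : p 16 * (s * polyD b r) = (1 + r) * polyG a b s := by
    calc p 16 * (s * polyD b r) = (1 + a) * (s * polyD b r) + c * (s * polyD b r) := by
          rw [h16]; ring
      _ = (1 + r) * polyG a b s := by rw [hN, polyD, polyN, polyG]; ring
  have hL : p 17 * (s * polyE a r s) = (1 + r + r * s) * polyG a b s := by
    calc p 17 * (s * polyE a r s) = (1 + b) * (s * polyE a r s) + d * (s * polyE a r s) := by
          rw [h17]; ring
      _ = (1 + r + r * s) * polyG a b s := by rw [hH', polyE, polyH, polyG]; ring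
  have hNs : p 12 * (s * polyE a r s) = polyN a b r s * (1 + s) := by
    calc p 12 * (s * polyE a r s) = s * polyE a r s + d * (s * polyE a r s) := by rw [h12]; ring
      _ = polyN a b r s * (1 + s) := by rw [hH', polyE, polyH, polyN]; ring
  have hNH : p 15 * ((s * polyD b r) * (s * polyE a r s)) =
      s * polyN a b r s * polyH a b r s := by
    rw [← hN, ← hH', ← hs]; ring
  have hX : (1 + r) * (X * p 13) = p 15 * p 16 := by rw [e3, add_mul, hr, one_mul]; ring
  have hNG : X * ((s * polyD b r) * (s * polyE a r s)) = s * polyN a b r s * polyG a b s := by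
    have h1 : ∀ x y, (1 + r) * (X * p 13) * x = (1 + r) * (X * p 13) * y → x = y := by
      intro x y h
      rw [hX, mul_assoc, mul_assoc] at h
      exact hcancel 16 _ _ (hcancel 15 _ _ h)
    refine h1 _ _ ?_
    calc (1 + r) * (X * p 13) * (X * ((s * polyD b r) * (s * polyE a r s)))
        = p 15 * X * (p 16 * (s * polyD b r)) * (s * polyE a r s) := by rw [hX]; ring
      _ = (s * (c * d)) * X * ((1 + r) * polyG a b s) * (s * polyE a r s) := by rw [hG, hs]
      _ = s * c * X * ((1 + r) * polyG a b s) * (d * (s * polyE a r s)) := by ring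
      _ = (1 + r) * (X * p 13) * (s * (c * (s * polyD b r)) * polyG a b s) := by
          rw [hH', ← hH]; ring
      _ = (1 + r) * (X * p 13) * (s * polyN a b r s * polyG a b s) := by rw [hN]
  have hHG : Y * ((s * polyD b r) * (s * polyE a r s)) =
      r * s * polyH a b r s * polyG a b s := by
    refine hcancel 11 _ _ ?_
    calc c * (Y * ((s * polyD b r) * (s * polyE a r s)))
        = (c * Y) * ((s * polyD b r) * (s * polyE a r s)) := by ring
      _ = r * p 13 * (X * ((s * polyD b r) * (s * polyE a r s))) := by rw [← hr]; ring
      _ = r * s * p 13 * (c * (s * polyD b r)) * polyG a b s := by rw [hNG, hN]; ring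
      _ = c * (r * s * (p 13 * (s * polyD b r)) * polyG a b s) := by ring
      _ = c * (r * s * polyH a b r s * polyG a b s) := by rw [hH]
  refine ⟨![1, 1, 1, 1, s * polyD b r, s * polyE a r s], fun n => ?_⟩
  rw [prod_triple]
  fin_cases n <;> simp only [baseMinor3, labels, Matrix.cons_val, Fin.isValue, Fin.zero_eta,
    Fin.mk_one, Fin.reduceFinMk, one_mul, mul_one, g0, g1, g2, g3, g4, g10, h5, h8, h9] <;>
  first
  | rfl
  | exact hN.symm
  | exact hH.symm
  | exact hH'.symm
  | exact hNs.symm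
  | exact hNH.symm
  | exact hG.symm
  | exact hL.symm
  | exact hNG.symm
  | exact hHG.symm

lemma rigid_mins {a b r s : ℝ × ℝ} (g : ℝ)
    (hb : min 0 (b.1 + b.2) = min 0 b.1 + min 0 b.2)
    (ha : min 0 (a.1 + a.2) = min 0 a.1 + min 0 a.2)
    (hr : min 0 (r.1 + r.2) = min 0 r.1 + min 0 r.2)
    (hs : min 0 (s.1 + s.2) = min 0 s.1 + min 0 s.2)
    (hD : min (min 0 (b.1 + b.2)) (r.1 + r.2 + (b.1 + b.2)) =
      min (min 0 b.1) (r.1 + b.1) + min (min 0 b.2) (r.2 + b.2) + g)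
    (hG : min (min (min 0 (a.1 + a.2)) (b.1 + b.2))
        (s.1 + s.2 + min 0 (a.1 + a.2) + min 0 (b.1 + b.2)) =
      min (min (min 0 a.1) b.1) (s.1 + min 0 a.1 + min 0 b.1) +
      min (min (min 0 a.2) b.2) (s.2 + min 0 a.2 + min 0 b.2) + g) : g = 0 := by
  have hmin : ∀ x y : ℝ, min x (y + x) = x + min 0 y := fun x y => by
    rw [← min_add_add_left]; congr 1 <;> ring
  have hcases : (b.1 ≤ 0 ∧ b.2 ≤ 0) ∨ (0 ≤ b.1 ∧ 0 ≤ b.2) := by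
    rcases le_total b.1 0 with h1 | h1 <;> rcases le_total b.2 0 with h2 | h2
    · exact Or.inl ⟨h1, h2⟩
    · rw [min_eq_right h1, min_eq_left h2] at hb
      rcases h2.eq_or_lt with h3 | h3
      · exact Or.inl ⟨h1, h3.ge⟩
      · rcases h1.eq_or_lt with h4 | h4
        · exact Or.inr ⟨h4.ge, h2⟩
        · rcases min_cases 0 (b.1 + b.2) with h | h <;> linarith
    · rw [min_eq_left h1, min_eq_right h2] at hb
      rcases h1.eq_or_lt with h3 | h3
      · exact Or.inl ⟨h3.ge, h2⟩
      · rcases h2.eq_or_lt with h4 | h4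
        · exact Or.inr ⟨h1, h4.ge⟩
        · rcases min_cases 0 (b.1 + b.2) with h | h <;> linarith
    · exact Or.inr ⟨h1, h2⟩
  rcases hcases with ⟨h1, h2⟩ | ⟨h1, h2⟩
  · rw [min_eq_right h1, min_eq_right h2, min_eq_right (add_nonpos h1 h2), hmin, hmin, hmin] at hD
    linarith
  · have h3 : ∀ x y z : ℝ, 0 ≤ y → min (min (min 0 x) y) (z + min 0 x + min 0 y) =
        min 0 x + min 0 z := by
      intro x y z hy
      rw [min_eq_left hy, add_zero, min_eq_left ((min_le_left 0 x).trans hy), hmin]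
    rw [h3 _ _ _ h1, h3 _ _ _ h2, h3 _ _ _ (add_nonneg h1 h2)] at hG
    linarith

lemma tropVal_add_nat' {f g : MvPolynomial (Fin 4) ℕ}
    (hf : MvPolynomial.eval (fun _ => 1) f ≠ 0) (hg : MvPolynomial.eval (fun _ => 1) g ≠ 0)
    (u : Fin 4 → ℝ) : tropVal (f + g) u = min (tropVal f u) (tropVal g u) :=
  tropVal_add_nat (ne_zero_of_eval_one hf) (ne_zero_of_eval_one hg) u

lemma baseRigid3 (w u : Fin 4 → ℝ) (k : ℝ) (t : Fin 6 → ℝ)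
    (h : ∀ n, tropVal (baseMinor3 (MvPolynomial.X 0) (MvPolynomial.X 1) (MvPolynomial.X 2)
        (MvPolynomial.X 3) n : MvPolynomial (Fin 4) ℕ) (w + u) =
      tropVal (baseMinor3 (MvPolynomial.X 0) (MvPolynomial.X 1) (MvPolynomial.X 2)
        (MvPolynomial.X 3) n : MvPolynomial (Fin 4) ℕ) w +
      tropVal (baseMinor3 (MvPolynomial.X 0) (MvPolynomial.X 1) (MvPolynomial.X 2)
        (MvPolynomial.X 3) n : MvPolynomial (Fin 4) ℕ) u +
        (k + (t (labels n 0) + t (labels n 1) + t (labels n 2)))) :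
    k = -(t 0 + t 1 + t 2) ∧ ∀ j, t j = t 0 := by
  obtain ⟨a, ha⟩ : ∃ a : MvPolynomial (Fin 4) ℕ, a = MvPolynomial.X 0 := ⟨_, rfl⟩
  obtain ⟨b, hb⟩ : ∃ b : MvPolynomial (Fin 4) ℕ, b = MvPolynomial.X 1 := ⟨_, rfl⟩
  obtain ⟨r, hr⟩ : ∃ r : MvPolynomial (Fin 4) ℕ, r = MvPolynomial.X 2 := ⟨_, rfl⟩
  obtain ⟨s, hs⟩ : ∃ s : MvPolynomial (Fin 4) ℕ, s = MvPolynomial.X 3 := ⟨_, rfl⟩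
  rw [← ha, ← hb, ← hr, ← hs] at h
  have ea : MvPolynomial.eval (fun _ => 1) a = 1 := by simp [ha]
  have eb : MvPolynomial.eval (fun _ => 1) b = 1 := by simp [hb]
  have er : MvPolynomial.eval (fun _ => 1) r = 1 := by simp [hr]
  have es : MvPolynomial.eval (fun _ => 1) s = 1 := by simp [hs]
  have va : ∀ v, tropVal a v = v 0 := by rw [ha]; exact tropVal_X 0
  have vb : ∀ v, tropVal b v = v 1 := by rw [hb]; exact tropVal_X 1
  have vr : ∀ v, tropVal r v = v 2 := by rw [hr]; exact tropVal_X 2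
  have vs : ∀ v, tropVal s v = v 3 := by rw [hs]; exact tropVal_X 3
  have va1 : ∀ v, tropVal (1 + a) v = min 0 (v 0) := fun v => by
    rw [tropVal_add_nat' (by simp) (by simp [ea]), tropVal_one, va]
  have vb1 : ∀ v, tropVal (1 + b) v = min 0 (v 1) := fun v => by
    rw [tropVal_add_nat' (by simp) (by simp [eb]), tropVal_one, vb]
  have vr1 : ∀ v, tropVal (1 + r) v = min 0 (v 2) := fun v => by
    rw [tropVal_add_nat' (by simp) (by simp [er]), tropVal_one, vr]
  have vs1 : ∀ v, tropVal (1 + s) v = min 0 (v 3) := fun v => by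
    rw [tropVal_add_nat' (by simp) (by simp [es]), tropVal_one, vs]
  have vD : ∀ v, tropVal (polyD b r) v = min (min 0 (v 1)) (v 2 + v 1) := fun v => by
    rw [polyD, tropVal_add_nat' (by simp [eb]) (by simp [er, eb]), vb1,
      tropVal_mul_nat (by simp [er]) (by simp [eb]), vr, vb]
  have vG : ∀ v, tropVal (polyG a b s) v =
      min (min (min 0 (v 0)) (v 1)) (v 3 + min 0 (v 0) + min 0 (v 1)) := fun v => by
    rw [polyG, tropVal_add_nat' (by simp [ea, eb]) (by simp [ea, es, eb]),
      tropVal_add_nat' (by simp [ea]) (by simp [eb]), va1, vb,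
      tropVal_mul_nat (by simp [ea, es]) (by simp [eb]),
      tropVal_mul_nat (by simp [es]) (by simp [ea]), vs, va1, vb1]
  have eD : MvPolynomial.eval (fun _ => 1) (polyD b r) = 3 := by simp [polyD, eb, er]
  have eE : MvPolynomial.eval (fun _ => 1) (polyE a r s) = 5 := by simp [polyE, ea, er, es]
  have eN : MvPolynomial.eval (fun _ => 1) (polyN a b r s) = 8 := by
    simp [polyN, ea, eb, er, es]
  have eH : MvPolynomial.eval (fun _ => 1) (polyH a b r s) = 11 := by
    simp [polyH, ea, eb, er, es]
  have eG : MvPolynomial.eval (fun _ => 1) (polyG a b s) = 7 := by simp [polyG, ea, eb, es]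
  have m2 := fun v => tropVal_mul_nat (f := s) (g := polyD b r) (by simp [es]) (by simp [eD]) v
  have m3 := fun v => tropVal_mul_nat (f := s) (g := polyE a r s) (by simp [es]) (by simp [eE]) v
  have m5 := fun v => tropVal_mul_nat (f := 1 + a) (g := s * polyD b r) (by simp [ea])
    (by simp [es, eD]) v
  have m8 := fun v => tropVal_mul_nat (f := 1 + b) (g := s * polyE a r s) (by simp [eb])
    (by simp [es, eE]) v
  have m12 := fun v => tropVal_mul_nat (f := polyN a b r s) (g := 1 + s) (by simp [eN])
    (by simp [es]) v
  have m16 := fun v => tropVal_mul_nat (f := 1 + r) (g := polyG a b s) (by simp [er])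
    (by simp [eG]) v
  have m18 := fun v => tropVal_mul_nat (f := s * polyN a b r s) (g := polyG a b s)
    (by simp [es, eN]) (by simp [eG]) v
  have m18' := fun v => tropVal_mul_nat (f := s) (g := polyN a b r s)
    (by simp [es]) (by simp [eN]) v
  have h0 := h 0
  have h1 := h 1
  have h2 := h 2
  have h3 := h 3
  have h4 := h 4
  have h5 := h 5
  have h8 := h 8
  have h10 := h 10
  have h11 := h 11
  have h12 := h 12
  have h13 := h 13
  have h14 := h 14
  have h16 := h 16
  have h18 := h 18
  simp only [baseMinor3, labels, Matrix.cons_val, Fin.isValue, tropVal_one, m2, m3, m5, m8, m12,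
    m16, m18, m18', va1, vb1, vr1, vs1, vD, vG, vs, Pi.add_apply] at *
  have hrig := rigid_mins (a := (w 0, u 0)) (b := (w 1, u 1)) (r := (w 2, u 2)) (s := (w 3, u 3))
    (t 4 - t 0) (by linarith) (by linarith) (by linarith) (by linarith) (by linarith)
    (by linarith)
  refine ⟨by linarith, fun j => ?_⟩
  fin_cases j <;> simp only [Fin.zero_eta, Fin.mk_one, Fin.reduceFinMk] <;> linarith

theorem mul_inv_mul_inv_mul_mul {G : Type*} [CommGroup G] (x y z w : G) :
    x * (y⁻¹ * (z⁻¹ * w)) * (z * y) = x * w := by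
  have : x * (y⁻¹ * (z⁻¹ * w)) * (z * y) = x * ((y⁻¹ * y) * (z⁻¹ * z)) * w := by ac_rfl
  rw [this, inv_mul_cancel, inv_mul_cancel, one_mul, mul_one]

theorem basePosChart3 : ∃ A, PosChart (ofVec baseSign3) A (fun i => ofVec (baseExpo3 i))
    (ofVec (baseMinor3 (MvPolynomial.X 0) (MvPolynomial.X 1) (MvPolynomial.X 2)
      (MvPolynomial.X 3))) := by
  obtain ⟨a, ha⟩ : ∃ a : Poly4, a = MvPolynomial.X 0 := ⟨_, rfl⟩
  obtain ⟨b, hb⟩ : ∃ b : Poly4, b = MvPolynomial.X 1 := ⟨_, rfl⟩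
  obtain ⟨r, hr⟩ : ∃ r : Poly4, r = MvPolynomial.X 2 := ⟨_, rfl⟩
  obtain ⟨s, hs⟩ : ∃ s : Poly4, s = MvPolynomial.X 3 := ⟨_, rfl⟩
  refine ⟨_, PosChart.of_frame _ (-polyN a b r s) (polyN a b r s * (1 + s))
    ((1 + a) * (s * polyD b r)) (-(b * (s * polyE a r s))) (s * polyD b r) (s * polyE a r s) _ _
    (fun n => ?_) (fun n => ?_) (by decide) (fun i => ?_) (fun S _ P hP hg => ?_) baseRigid3⟩
  · rw [minor_frame, map_baseMinor3]
    simp only [MvPolynomial.map_X, ← ha, ← hb, ← hr, ← hs]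
    fin_cases n <;> simp [baseMinor3, baseSign3, polyD, polyE, polyN, polyH, polyG] <;> ring
  · rw [map_baseMinor3]
    simp only [MvPolynomial.eval_X]
    revert n
    decide
  · fin_cases i <;> simp [Fin.prod_univ_succ, baseMinor3, baseExpo3] <;> ring
  · have hg' : ∀ n ∈ ({0, 1, 2, 3, 4, 10} : Finset (Fin 20)),
        (fun n => P (triple n)) n = 1 := hg
    have y0 : ∏ m, P (triple m) ^ baseExpo3 0 m = P (triple 7) :=
      prod_zpow_eq_seed hg' (by decide)
    have y1 : ∏ m, P (triple m) ^ baseExpo3 1 m = P (triple 6) :=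
      prod_zpow_eq_seed hg' (by decide)
    have y2 : (∏ m, P (triple m) ^ baseExpo3 2 m) * (P (triple 18) * P (triple 13)) =
        P (triple 11) * P (triple 19) := by
      simp only [Fin.prod_univ_succ, baseExpo3]
      simp
      exact mul_inv_mul_inv_mul_mul _ _ _ _
    have y3 : (∏ m, P (triple m) ^ baseExpo3 3 m) * (P (triple 11) * P (triple 14)) =
        P (triple 15) := by
      simp only [Fin.prod_univ_succ, baseExpo3]
      simp
      rw [mul_comm (P (triple 11)) (P (triple 14)), mul_inv_mul_inv_mul_mul, hg 10 (by decide),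
        one_mul]
    obtain ⟨t, ht⟩ := baseRecon3 P hP hg _ _ (congrArg Units.val y2) (congrArg Units.val y3)
    refine ⟨t, fun n => ?_⟩
    rw [← ht n]
    refine (map_baseMinor3 (MvPolynomial.aeval _).toRingHom _ _ _ _ n).trans ?_
    simp only [AlgHom.toRingHom_eq_coe, RingHom.coe_coe, MvPolynomial.aeval_X, y0, y1]

/-! ### Numerical codes of sign vectors -/

/-- The sign encoded by a bit. -/
def boolSign (b : Bool) : ℤˣ := bif b then -1 else 1

lemma boolSign_xor (a b : Bool) : boolSign (a ^^ b) = boolSign a * boolSign b := by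
  cases a <;> cases b <;> rfl

lemma boolSign_injective : Function.Injective boolSign := by decide

lemma exists_boolSign (u : ℤˣ) : ∃ b, boolSign b = u := by
  rcases Int.units_eq_one_or u with rfl | rfl
  exacts [⟨false, rfl⟩, ⟨true, rfl⟩]

/-- The sign vector with code `N`: the bit at position `2 ^ a + 2 ^ b + 2 ^ c` is set when the sign
of `{a, b, c}` is negative. -/
def signOf (N : ℕ) : SignVector := fun I => boolSign (N.testBit (∑ j ∈ I.1, 2 ^ (j : ℕ)))

/-- The orientation of three labels in the sign vector with code `N`. -/
def orientBit (N a b c : ℕ) : Bool :=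
  N.testBit (2 ^ a + 2 ^ b + 2 ^ c) ^^ (Nat.blt b a ^^ (Nat.blt c a ^^ Nat.blt c b))

lemma sgn3_eq_boolSign : ∀ a b c : Fin 6,
    a ≠ b → a ≠ c → b ≠ c → sgn3 a b c = boolSign (Nat.blt b a ^^ (Nat.blt c a ^^ Nat.blt c b)) := by
  decide

lemma signOf_tri (N : ℕ) {a b c : Fin 6} (hab : a ≠ b) (hac : a ≠ c) (hbc : b ≠ c) :
    signOf N (tri a b c) = boolSign (N.testBit (2 ^ (a : ℕ) + 2 ^ (b : ℕ) + 2 ^ (c : ℕ))) := by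
  rw [signOf, tri_val hab hac hbc, Finset.sum_insert (by simp [hab, hac]), Finset.sum_pair hbc,
    add_assoc]

lemma ochi_signOf (N : ℕ) {a b c : Fin 6} (hab : a ≠ b) (hac : a ≠ c) (hbc : b ≠ c) :
    ochi (signOf N) a b c = boolSign (orientBit N a b c) := by
  rw [ochi, signOf_tri N hab hac hbc, sgn3_eq_boolSign a b c hab hac hbc, orientBit,
    boolSign_xor (N.testBit _), mul_comm]

/-- The position of the sign of the `n`-th triple in a code. -/
def bitPos (n : Fin 20) : ℕ := ∑ j ∈ (triple n).1, 2 ^ (j : ℕ)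

lemma signOf_triple (N : ℕ) (n : Fin 20) : signOf N (triple n) = boolSign (N.testBit (bitPos n)) :=
  rfl

lemma ochi_of_lt (χ : SignVector) {a b c : Fin 6} (hab : a < b) (hbc : b < c) :
    ochi χ a b c = χ (tri a b c) := by rw [ochi, sgn3_of_lt hab hbc, one_mul]

lemma reoriented_one {s : Fin 6 → ℤˣ} {χ χ' : SignVector}
    (h : ∀ I, χ' I = χ I * ∏ j ∈ I.1, s j) : Reoriented 1 s χ χ' := by
  intro a b c hab hac hbc
  rw [ochi, h, tri_val hab hac hbc, Finset.prod_insert (by simp [hab, hac]), Finset.prod_pair hbc,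
    ochi]
  simp only [Equiv.Perm.coe_one, id_eq]
  ac_rfl

lemma Reoriented.trans {σ τ : Equiv.Perm (Fin 6)} {s t : Fin 6 → ℤˣ} {χ χ' χ'' : SignVector}
    (h : Reoriented σ s χ χ') (h' : Reoriented τ t χ' χ'') :
    Reoriented (σ * τ) (fun j => t j * s (τ j)) χ χ'' := by
  intro a b c hab hac hbc
  rw [h' a b c hab hac hbc, h _ _ _ (τ.injective.ne hab) (τ.injective.ne hac) (τ.injective.ne hbc)]
  simp only [Equiv.Perm.coe_mul, Function.comp_apply]
  ac_rfl

lemma Reoriented.symm {σ : Equiv.Perm (Fin 6)} {s : Fin 6 → ℤˣ} {χ χ' : SignVector}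
    (h : Reoriented σ s χ χ') : Reoriented σ⁻¹ (fun j => s (σ⁻¹ j)) χ' χ := by
  intro a b c hab hac hbc
  rw [h _ _ _ (σ⁻¹.injective.ne hab) (σ⁻¹.injective.ne hac) (σ⁻¹.injective.ne hbc)]
  have hσ : ∀ j, σ (σ⁻¹ j) = j := σ.apply_symm_apply
  rw [hσ, hσ, hσ, ← mul_assoc, Int.units_mul_self, one_mul]

lemma Reoriented.realizationSpace_eq {s : Fin 6 → ℤˣ} {χ χ' : SignVector}
    (h : Reoriented 1 s χ χ') : realizationSpace χ = realizationSpace χ' := by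
  refine TopologicalSpace.Opens.ext (Set.Subset.antisymm (fun x hx => ?_) fun x hx => ?_)
  · have := h.relabel_mem hx; rwa [relabel_one] at this
  · have := h.symm.relabel_mem hx; rwa [inv_one, relabel_one] at this

/-- The codes of the base sign vectors. -/
def baseCode : ℕ → ℕ
  | 0 => 567622949150720
  | 1 => 78257053019152384
  | 2 => 76578785958305792
  | _ => 4521191920377856

/-- The codes of all uniform chirotopes whose signs at the triples `0, 1, 2, 3, 10` are positive and
at the triple `4` are negative.  Each code is listed with the index of a base sign vector, the
decimal digits of a permutation, and the bits of the signs of a reorientation that produce it. -/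
def chirotopeTable : List (ℕ × ℕ × ℕ × ℕ) :=
  [(4672995729408, 1, 235410, 62), (4672997826560, 2, 452130, 26), (4673031380992, 1, 134520, 1),
   (4810436780032, 1, 543120, 63), (4810470334464, 2, 125430, 36), (7009493590016, 1, 453210, 0),
   (17592257355776, 0, 142530, 32), (17592259452928, 1, 134250, 30), (17592293007360, 2, 452310, 3),
   (17592454488064, 1, 325140, 49), (17592521596928, 2, 215403, 43), (17592525791232, 1, 341520, 2),
   (21990303866880, 1, 431250, 11), (21990305964032, 0, 241530, 53),
   (21990339518464, 1, 520413, 11), (21990568108032, 1, 153420, 63),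
   (21990572302336, 2, 542103, 22), (22265181773824, 2, 125043, 18),
   (22265183870976, 1, 502413, 45), (22265217425408, 0, 214530, 19),
   (22265450209280, 1, 513240, 48), (565286451290112, 0, 325410, 0),
   (565286684073984, 1, 142350, 35), (565286686171136, 2, 423510, 62),
   (565286719725568, 1, 215430, 34), (565286751182848, 2, 510243, 6),
   (565286753280000, 1, 415203, 57), (565286755377152, 1, 425130, 17),
   (567622949150720, 0, 543210, 0), (580542210777088, 1, 25413, 30),
   (580542407909376, 0, 453120, 15), (580542475018240, 1, 214053, 20),
   (580542479212544, 2, 524130, 49), (580679649730560, 2, 251043, 33),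
   (580679846862848, 1, 241053, 49), (580679848960000, 2, 415203, 49),
   (580679913971712, 0, 435120, 42), (580679916068864, 1, 125340, 43),
   (580679918166016, 1, 352410, 61), (582878672986112, 1, 241503, 30),
   (582878870118400, 2, 251403, 14), (582878872215552, 3, 532410, 61),
   (582878905769984, 2, 145023, 14), (582878937227264, 1, 352140, 20),
   (582878939324416, 2, 243150, 1), (582878941421568, 0, 435210, 3),
   (584940257288192, 2, 254310, 62), (584940521529344, 2, 142530, 14),
   (584940525723648, 3, 345210, 61), (585077696241664, 1, 142530, 10),
   (585077960482816, 1, 425310, 62), (585077962579968, 0, 253410, 0),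
   (585077964677120, 2, 510423, 41), (585215135195136, 1, 124503, 45),
   (585215403630592, 2, 412350, 1), (1128236404711424, 2, 324150, 1),
   (1128236673146880, 1, 125403, 46), (1130435427966976, 2, 514023, 38),
   (1130435461521408, 0, 254310, 3), (1130435495075840, 1, 423510, 61),
   (1130435696402432, 1, 145230, 5), (1130572866920448, 0, 432510, 0),
   (1130572900474880, 2, 241350, 2), (1130572902572032, 2, 51423, 50),
   (1130572904669184, 3, 534210, 62), (1130572934029312, 1, 351240, 27),
   (1130572938223616, 2, 254103, 13), (1130573135355904, 1, 245103, 29),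
   (1130710305873920, 1, 354210, 62), (1130710339428352, 1, 123540, 36),
   (1130710343622656, 2, 412503, 50), (1130710372982784, 0, 154320, 26),
   (1130710377177088, 1, 240153, 50), (1130710574309376, 2, 250143, 34),
   (1132634451222528, 3, 253410, 61), (1132634518331392, 2, 145230, 13),
   (1132634719657984, 2, 253410, 61), (1132909329129472, 2, 521430, 50),
   (1132909396238336, 1, 42153, 36), (1132909400432640, 0, 451320, 12),
   (1132909597564928, 1, 24513, 29), (1145828859191296, 0, 542310, 3),
   (1148165052964864, 1, 421530, 18), (1148165086519296, 1, 412503, 54),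
   (1148165088616448, 1, 214530, 33), (1148165090713600, 2, 425310, 61),
   (1148165120073728, 2, 512043, 9), (1148165124268032, 1, 143250, 32),
   (1148165357051904, 0, 324510, 3), (1691186358132736, 1, 512340, 51),
   (1691186590916608, 0, 215430, 16), (1691186593013760, 1, 504213, 46),
   (1691186626568192, 2, 120543, 17), (1695584404643840, 2, 541203, 25),
   (1695584471752704, 1, 154320, 60), (1695584637427712, 1, 524013, 4),
   (1695584639524864, 0, 245130, 58), (1695584673079296, 1, 432150, 4),
   (1695859282550784, 1, 345120, 1), (1695859349659648, 2, 214503, 36),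
   (1695859353853952, 1, 321540, 50), (1695859515334656, 2, 453210, 0),
   (1695859517431808, 1, 132450, 29), (1695859550986240, 0, 145230, 35),
   (1706442314752000, 1, 452310, 3), (1706579753705472, 2, 124530, 43),
   (1706579755802624, 1, 541320, 60), (1708778776961024, 1, 135420, 2),
   (1708778779058176, 2, 451230, 21), (1708778812612608, 1, 234510, 61),
   (4508135182049280, 2, 325410, 61), (4508135186243584, 1, 402513, 45),
   (4508135215603712, 1, 243150, 4), (4508135219798016, 0, 514230, 19),
   (4508410064150528, 0, 541230, 53), (4508410097704960, 1, 420513, 11),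
   (4510334238859264, 0, 524130, 58), (4510334243053568, 1, 213450, 45),
   (4510609120960512, 2, 52143, 52), (4521191882629120, 1, 351420, 2),
   (4521191886823424, 2, 245103, 43), (4521191916183552, 2, 241530, 27),
   (4521191920377856, 3, 543210, 0), (4521192081858560, 2, 501243, 59),
   (4521192083955712, 1, 245013, 4), (4521192148967424, 1, 124350, 30),
   (4521192151064576, 0, 152430, 32), (4521329321582592, 2, 514230, 37),
   (4521329325776896, 1, 204153, 20), (4521329355137024, 1, 415320, 60),
   (4521329359331328, 2, 421503, 20), (4521329522909184, 0, 452130, 58),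
   (4521329590018048, 1, 45213, 30), (4525589929140224, 2, 512403, 22),
   (4525589933334528, 1, 143520, 63), (4525589962694656, 1, 412053, 41),
   (4525589966888960, 2, 425130, 36), (4525590195478528, 0, 251430, 53),
   (4525590197575680, 1, 421350, 11), (4525727368093696, 3, 325410, 61),
   (4525727372288000, 2, 152430, 26), (4525727401648128, 2, 154203, 41),
   (4525727405842432, 1, 534120, 1), (4525727636529152, 2, 234510, 62),
   (5071085135470592, 1, 514230, 5), (5071085137567744, 1, 524103, 45),
   (5071085139664896, 2, 25143, 18), (5071222576521216, 1, 542130, 10),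
   (5071360015474688, 2, 354210, 62), (5071360017571840, 1, 231450, 11),
   (5084279275003904, 1, 342510, 61), (5084279277101056, 1, 135240, 43),
   (5084279279198208, 0, 415320, 42), (5084279476330496, 1, 324150, 4),
   (5084279543439360, 2, 201543, 33), (5086478298259456, 0, 425310, 3),
   (5086478300356608, 2, 124350, 2), (5086478302453760, 1, 312540, 20),
   (5086478499586048, 2, 532410, 61), (5086478533140480, 1, 451230, 5),
   (5086478566694912, 1, 251403, 30), (5088677321515008, 2, 451023, 22),
   (5088677323612160, 0, 243510, 0), (5088677325709312, 1, 435210, 62),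
   (5088677589950464, 1, 152430, 10), (5631836032081920, 1, 541203, 57),
   (5634035055337472, 1, 521430, 18), (5634035088891904, 1, 512403, 54),
   (5634035122446336, 2, 12543, 9), (5636234078593024, 2, 342510, 62),
   (5636234145701888, 1, 450213, 54), (5651489802428416, 1, 254310, 62),
   (5651489835982848, 1, 523140, 36), (5651489869537280, 0, 354120, 26),
   (5651490102321152, 1, 542013, 57), (5651490104418304, 2, 105243, 6),
   (5651627241381888, 0, 532410, 0), (5651627274936320, 2, 432150, 1),
   (5651627308490752, 1, 251340, 27), (5651627543371776, 1, 154203, 57),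
   (5651764680335360, 2, 105423, 25), (5651764713889792, 0, 354210, 3),
   (5651764747444224, 1, 523410, 61), (5651764980228096, 2, 435210, 61),
   (5651764982325248, 1, 254130, 33), (5651764984422400, 1, 452103, 54),
   (72622880489218048, 1, 451203, 57), (72622880522772480, 1, 251430, 34),
   (72622880556326912, 2, 432510, 62), (72622880789110784, 1, 524310, 62),
   (72622880791207936, 0, 352410, 0), (72622880793305088, 2, 15423, 41),
   (72625079546028032, 1, 152403, 54), (72625079812366336, 1, 253140, 20),
   (72625079814463488, 2, 342150, 1), (72625079816560640, 0, 534210, 3),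
   (72627278569283584, 2, 102543, 9), (72627278602838016, 1, 540213, 54),
   (72627278835621888, 0, 534120, 42), (72627278837719040, 1, 521340, 43),
   (72627278839816192, 1, 253410, 61), (72642534559457280, 1, 452013, 57),
   (72642534563651584, 2, 345210, 61), (72642671998410752, 2, 15243, 6),
   (72642672000507904, 1, 514203, 57), (72642672002605056, 1, 524130, 17),
   (72642809441558528, 1, 542103, 54), (73188029499449344, 1, 154230, 5),
   (73188029700775936, 1, 432510, 61), (73188029734330368, 0, 245310, 3),
   (73188029767884800, 2, 541023, 38), (73188166938402816, 1, 254103, 29),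
   (73188166940499968, 1, 452130, 10), (73188166942597120, 2, 534210, 62),
   (73188167139729408, 1, 315240, 27), (73188167173283840, 2, 214350, 2),
   (73188167206838272, 0, 423510, 0), (73188304377356288, 2, 205143, 34),
   (73188304381550592, 1, 321450, 11), (73188304578682880, 0, 145320, 26),
   (73188304612237312, 1, 132540, 36), (73188304645791744, 1, 345210, 62),
   (73201223840309248, 1, 234150, 4), (73201223873863680, 2, 352410, 61),
   (73203422897119232, 1, 541230, 5), (73205621886820352, 2, 21543, 17),
   (73205621920374784, 1, 521403, 46), (73205621953929216, 1, 512430, 10),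
   (73750979452870656, 2, 235410, 61), (73750979652100096, 1, 531420, 2),
   (73750979654197248, 2, 154230, 21), (73750979719208960, 2, 152403, 38),
   (73750979721306112, 3, 235410, 61), (73751254330777600, 1, 42513, 29),
   (73751254334971904, 0, 451230, 53), (73751254530007040, 2, 425103, 27),
   (73751254532104192, 1, 24153, 36), (73751254597115904, 1, 413520, 63),
   (73751254599213056, 2, 512430, 42), (73753178476126208, 1, 423150, 4),
   (73753178509680640, 0, 254130, 58), (73753178675355648, 2, 421530, 43),
   (73753178677452800, 1, 145320, 60), (73753178742464512, 1, 142053, 25),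
   (73753178744561664, 2, 514203, 25), (73753453354033152, 0, 154230, 35),
   (73753453358227456, 1, 240513, 11), (73753453387587584, 1, 123450, 29),
   (73753453391781888, 2, 502143, 52), (73753453553262592, 3, 453210, 0),
   (73753453555359744, 2, 241503, 36), (73753453620371456, 2, 245130, 20),
   (73753453622468608, 1, 354120, 1), (73764036352679936, 2, 51243, 59),
   (73764173791633408, 1, 425013, 4), (73764173793730560, 0, 542130, 58),
   (73768434399191040, 1, 214350, 46), (73768434466299904, 0, 521430, 53),
   (73768571838144512, 0, 512430, 16), (73768571840241664, 1, 405213, 46),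
   (73768571905253376, 1, 241350, 11), (73768571907350528, 2, 324510, 62),
   (76563530163167232, 1, 152340, 51), (76563530230276096, 2, 451203, 41),
   (76563530234470400, 1, 435120, 1), (76567928276787200, 1, 514320, 60),
   (76567928280981504, 2, 124503, 20), (76568203158888448, 1, 231540, 50),
   (76578785887002624, 0, 125430, 32), (76578785954111488, 1, 254013, 4),
   (76578785958305792, 2, 543210, 0), (76578786119786496, 1, 542310, 3),
   (76578786121883648, 2, 214530, 27), (76578786155438080, 1, 315420, 2),
   (76578923325956096, 1, 54213, 30), (76578923393064960, 0, 425130, 58),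
   (76578923397259264, 1, 312450, 45), (76578923560837120, 1, 451320, 60),
   (76578923594391552, 2, 541230, 37), (76581122349211648, 2, 210543, 33),
   (76581122416320512, 1, 342150, 4), (76581122420514816, 0, 415230, 19),
   (76581122617647104, 1, 324510, 61), (77126480116588544, 2, 234150, 1),
   (77126480150142976, 2, 154023, 22), (77126480152240128, 0, 342510, 0),
   (77126480154337280, 1, 534210, 62), (77126480183697408, 3, 523410, 61),
   (77126480187891712, 2, 251430, 50), (77126480420675584, 1, 241530, 34),
   (77128679173398528, 0, 524310, 3), (77128679175495680, 2, 421350, 2),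
   (77128679177592832, 1, 213540, 20), (77128679443931136, 1, 142503, 54),
   (77128816614449152, 2, 501423, 50), (77128816882884608, 1, 124530, 17),
   (77128954053402624, 3, 354210, 62), (77128954055499776, 2, 142503, 50),
   (77128954321838080, 2, 245310, 61), (77130878196654080, 1, 243510, 61),
   (77130878198751232, 1, 531240, 43), (77130878200848384, 0, 514320, 42),
   (77130878230208512, 2, 415230, 13), (77130878234402816, 1, 402153, 20),
   (77130878467186688, 2, 152043, 9), (77131153076658176, 2, 524103, 13),
   (77131153078755328, 1, 420153, 50), (77131153112309760, 0, 541320, 12),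
   (77131153345093632, 1, 413250, 16), (77144072302632960, 1, 215403, 30),
   (77144072336187392, 1, 415230, 5), (77144072338284544, 1, 425103, 45),
   (77144072340381696, 2, 520143, 18), (77144072369741824, 2, 523410, 61),
   (77144072373936128, 1, 204513, 45), (77144072571068416, 0, 452310, 3),
   (77146409068929024, 0, 234510, 3), (77689430070009856, 0, 235410, 0),
   (77691766567870464, 0, 453210, 0), (77691766765002752, 1, 205413, 46),
   (77691766767099904, 2, 521043, 17), (77691766800654336, 1, 421503, 46),
   (77691766832111616, 2, 524310, 62), (77691766834208768, 1, 412530, 10),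
   (77691766836305920, 1, 214503, 29), (77704685793845248, 1, 412350, 19),
   (77704686026629120, 0, 543120, 15), (77704686028726272, 1, 421053, 49),
   (77704686062280704, 2, 521403, 14), (77704823232798720, 2, 243510, 62),
   (77704823467679744, 2, 145203, 49), (77704823501234176, 3, 352410, 61),
   (77707022256054272, 1, 125430, 18), (77707022524489728, 2, 415023, 14),
   (77709083840356352, 2, 150243, 6), (77709084073140224, 1, 124053, 36),
   (77709084075237376, 0, 345120, 26), (77709084108791808, 1, 532140, 36),
   (77709084140249088, 2, 412530, 14), (77709084142346240, 1, 245310, 62),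
   (77709221279309824, 1, 145203, 57), (77709221514190848, 1, 215340, 27),
   (77709221547745280, 2, 423150, 1), (77709221581299712, 0, 523410, 0),
   (77709358718263296, 1, 245130, 33), (77709358951047168, 2, 254130, 49),
   (77709358953144320, 1, 532410, 61), (77709358986698752, 0, 345210, 3),
   (77709359018156032, 3, 435210, 61), (77709359020253184, 2, 150423, 25),
   (77709359022350336, 2, 142350, 1), (78254716521291776, 1, 325410, 62),
   (78254716718424064, 0, 412530, 16), (78254716785532928, 1, 341250, 11),
   (78254716789727232, 2, 215043, 34), (78254853960245248, 2, 542130, 42),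
   (78254853962342400, 1, 453120, 63), (78254854157377536, 1, 314250, 46),
   (78254854224486400, 0, 421530, 53), (78254854228680704, 1, 52413, 29),
   (78257052983500800, 1, 314520, 1), (78257052985597952, 2, 215430, 20),
   (78257053019152384, 1, 543210, 0), (78257053180633088, 2, 542310, 3),
   (78257053247741952, 1, 250413, 11), (78257053251936256, 0, 124530, 35),
   (78267635980050432, 1, 235140, 49), (78272034026561536, 2, 125403, 27),
   (78272034093670400, 1, 513420, 63), (78272308904468480, 1, 431520, 2),
   (78272308971577344, 2, 452103, 38), (78272308975771648, 1, 153240, 48)]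

/-- The `j`-th decimal digit. -/
def digit (d j : ℕ) : ℕ := d / 10 ^ j % 10

lemma chirotopeTable_reoriented : ∀ e ∈ chirotopeTable, e.2.1 < 4 ∧
    (∀ i < 6, digit e.2.2.1 i < 6 ∧ ∀ j < i, digit e.2.2.1 i ≠ digit e.2.2.1 j) ∧
    ∀ c < 6, ∀ b < c, ∀ a < b, orientBit e.1 a b c =
      (e.2.2.2.testBit a ^^ (e.2.2.2.testBit b ^^ (e.2.2.2.testBit c ^^
        orientBit (baseCode e.2.1) (digit e.2.2.1 a) (digit e.2.2.1 b) (digit e.2.2.1 c)))) := by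
  decide +kernel

lemma chirotopeTable_sorted : (chirotopeTable.map Prod.fst).IsChain (· < ·) := by
  decide +kernel

lemma chirotopeTable_length : chirotopeTable.length = 372 := by
  decide +kernel

lemma chirotopeTable_normalized : ∀ e ∈ chirotopeTable,
    (∀ n ∈ [0, 1, 2, 3, 10], e.1.testBit (bitPos n) = false) ∧
    e.1.testBit (bitPos 4) = true ∧
    e.1 = ∑ n, bif e.1.testBit (bitPos n) then 2 ^ bitPos n else 0 := by
  decide +kernel

/-- The sign condition of a three-term relation whose terms have the given signs. -/
def okBits (u v w : Bool) : Bool := !((u ^^ v) && (u == w))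

/-- A Boolean predicate holds for both bits. -/
def bothBits (p : Bool → Bool) : Bool := p false && p true

lemma bothBits_iff {p : Bool → Bool} : bothBits p = true ↔ ∀ b, p b = true := by
  rw [bothBits, Bool.and_eq_true, Bool.forall_bool]

lemma cond_true_iff {p q : Bool} : (bif p then q else true) = true ↔ (p = true → q = true) := by
  cases p <;> simp

set_option maxRecDepth 100000 in
lemma chirotopeTable_complete :
    (bothBits fun b5 => (bothBits fun b7 =>
    bif okBits (false ^^ (b7 ^^ false)) (false ^^ (b5 ^^ false)) (false ^^ (true ^^ false)) then
    (bothBits fun b6 => (bothBits fun b8 =>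
    bif okBits (false ^^ (b8 ^^ false)) (false ^^ (b6 ^^ false)) (false ^^ (true ^^ false)) then
    (bothBits fun b9 =>
    bif okBits (false ^^ (b9 ^^ false)) (false ^^ (b6 ^^ false)) (false ^^ (b5 ^^ false)) then
    bif okBits (false ^^ (b9 ^^ false)) (false ^^ (b8 ^^ false)) (false ^^ (b7 ^^ false)) then
    bif okBits (true ^^ (b9 ^^ false)) (b5 ^^ (b8 ^^ false)) (b6 ^^ (b7 ^^ false)) then
    (bothBits fun b11 => (bothBits fun b13 =>
    bif okBits (false ^^ (b13 ^^ true)) (false ^^ (b11 ^^ true)) (false ^^ (false ^^ true)) then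
    (bothBits fun b16 =>
    bif okBits (false ^^ (b16 ^^ false)) (true ^^ (b11 ^^ false)) (b5 ^^ (false ^^ false)) then
    bif okBits (false ^^ (b16 ^^ true)) (true ^^ (b13 ^^ true)) (b7 ^^ (false ^^ true)) then
    bif okBits (false ^^ (b16 ^^ false)) (b5 ^^ (b13 ^^ false)) (b7 ^^ (b11 ^^ false)) then
    (bothBits fun b12 => (bothBits fun b14 =>
    bif okBits (false ^^ (b14 ^^ true)) (false ^^ (b12 ^^ true)) (false ^^ (false ^^ true)) then
    (bothBits fun b15 =>
    bif okBits (false ^^ (b15 ^^ true)) (false ^^ (b12 ^^ true)) (false ^^ (b11 ^^ true)) then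
    bif okBits (false ^^ (b15 ^^ true)) (false ^^ (b14 ^^ true)) (false ^^ (b13 ^^ true)) then
    bif okBits (false ^^ (b15 ^^ false)) (b11 ^^ (b14 ^^ false)) (b12 ^^ (b13 ^^ false)) then
    (bothBits fun b17 =>
    bif okBits (false ^^ (b17 ^^ false)) (true ^^ (b12 ^^ false)) (b6 ^^ (false ^^ false)) then
    bif okBits (false ^^ (b17 ^^ true)) (true ^^ (b14 ^^ true)) (b8 ^^ (false ^^ true)) then
    bif okBits (false ^^ (b17 ^^ false)) (b6 ^^ (b14 ^^ false)) (b8 ^^ (b12 ^^ false)) then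
    (bothBits fun b18 =>
    bif okBits (false ^^ (b18 ^^ false)) (b5 ^^ (b12 ^^ false)) (b6 ^^ (b11 ^^ false)) then
    bif okBits (true ^^ (b18 ^^ true)) (b5 ^^ (b17 ^^ true)) (b6 ^^ (b16 ^^ true)) then
    bif okBits (false ^^ (b18 ^^ true)) (b11 ^^ (b17 ^^ true)) (b12 ^^ (b16 ^^ true)) then
    bif okBits (false ^^ (b18 ^^ true)) (b5 ^^ (b15 ^^ true)) (b9 ^^ (b11 ^^ true)) then
    bif okBits (false ^^ (b18 ^^ false)) (b6 ^^ (b15 ^^ false)) (b9 ^^ (b12 ^^ false)) then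
    (bothBits fun b19 =>
    bif okBits (false ^^ (b19 ^^ false)) (b7 ^^ (b14 ^^ false)) (b8 ^^ (b13 ^^ false)) then
    bif okBits (true ^^ (b19 ^^ false)) (b7 ^^ (b17 ^^ false)) (b8 ^^ (b16 ^^ false)) then
    bif okBits (false ^^ (b19 ^^ false)) (b13 ^^ (b17 ^^ false)) (b14 ^^ (b16 ^^ false)) then
    bif okBits (false ^^ (b19 ^^ true)) (b7 ^^ (b15 ^^ true)) (b9 ^^ (b13 ^^ true)) then
    bif okBits (b5 ^^ (b19 ^^ true)) (b7 ^^ (b18 ^^ true)) (b9 ^^ (b16 ^^ true)) then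
    bif okBits (b11 ^^ (b19 ^^ true)) (b13 ^^ (b18 ^^ true)) (b15 ^^ (b16 ^^ true)) then
    bif okBits (false ^^ (b19 ^^ false)) (b8 ^^ (b15 ^^ false)) (b9 ^^ (b14 ^^ false)) then
    bif okBits (b6 ^^ (b19 ^^ false)) (b8 ^^ (b18 ^^ false)) (b9 ^^ (b17 ^^ false)) then
    bif okBits (b12 ^^ (b19 ^^ false)) (b14 ^^ (b18 ^^ false)) (b15 ^^ (b17 ^^ false)) then
    (chirotopeTable.any fun e => e.1.testBit 21 == b5 && e.1.testBit 25 == b7 &&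
    e.1.testBit 37 == b6 && e.1.testBit 41 == b8 && e.1.testBit 49 == b9 && e.1.testBit 22 == b11 &&
    e.1.testBit 26 == b13 && e.1.testBit 28 == b16 && e.1.testBit 38 == b12 &&
    e.1.testBit 42 == b14 && e.1.testBit 50 == b15 && e.1.testBit 44 == b17 &&
    e.1.testBit 52 == b18 && e.1.testBit 56 == b19) else true else true else true else true
     else true else true else true else true else true) else true else true else true else true
     else true) else true else true else true) else true else true else true) else true)) else true
     else true else true) else true)) else true else true else true) else true)) else true)) = true := by
  decide +kernel

lemma okBits_of_realizable {χ : SignVector} (hχ : IsRealizable χ) {b : Fin 20 → Bool}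
    (hb : ∀ n, χ (triple n) = boolSign (b n)) (l a b' c d : Fin 6) (n₁ n₂ n₃ n₄ n₅ n₆ : Fin 20)
    (s₁ s₂ s₃ : Bool)
    (h : [l, a, b', c, d].Nodup ∧ tri l a b' = triple n₁ ∧ tri l c d = triple n₂ ∧
      tri l a c = triple n₃ ∧ tri l b' d = triple n₄ ∧ tri l a d = triple n₅ ∧
      tri l b' c = triple n₆ ∧ sgn3 l a b' * sgn3 l c d = boolSign s₁ ∧
      sgn3 l a c * sgn3 l b' d = boolSign s₂ ∧ sgn3 l a d * sgn3 l b' c = boolSign s₃) :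
    okBits (b n₁ ^^ (b n₂ ^^ s₁)) (b n₃ ^^ (b n₄ ^^ s₂)) (b n₅ ^^ (b n₆ ^^ s₃)) = true := by
  obtain ⟨h0, h1, h2, h3, h4, h5, h6, h7, h8, h9⟩ := h
  have key : ∀ (u v : ℤˣ) (x y s : Bool), u * v = boolSign s →
      u * boolSign x * (v * boolSign y) = boolSign (x ^^ (y ^^ s)) := by
    intro u v x y s h
    rw [boolSign_xor, boolSign_xor, ← h]
    ac_rfl
  have hk := hχ.not_all_same l a b' c d h0
  simp only [ochi, h1, h2, h3, h4, h5, h6, hb, key _ _ _ _ _ h7, key _ _ _ _ _ h8,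
    key _ _ _ _ _ h9] at hk
  generalize (b n₁ ^^ (b n₂ ^^ s₁)) = u at *
  generalize (b n₃ ^^ (b n₄ ^^ s₂)) = v at *
  generalize (b n₅ ^^ (b n₆ ^^ s₃)) = w at *
  revert u v w
  decide

lemma exists_normalized (χ : SignVector) : ∃ (s : Fin 6 → ℤˣ) (χ' : SignVector),
    Reoriented 1 s χ χ' ∧ (∀ n ∈ ({0, 1, 2, 3, 10} : Finset (Fin 20)), χ' (triple n) = 1) ∧
    χ' (triple 4) = -1 := by
  let v : Fin 20 → ℤˣ := fun n => if n = 4 then -1 else 1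
  obtain ⟨k, t, h⟩ := exists_gauge fun I => χ I * ofVec v I
  simp only [ofVec_triple] at h
  have hk : ∀ I : Triple, ∏ j ∈ I.1, (k * t j) = k * ∏ j ∈ I.1, t j := by
    intro I
    rw [Finset.prod_mul_distrib, Finset.prod_const, I.2, pow_succ, Int.units_sq, one_mul]
  refine ⟨fun j => k * t j, fun I => χ I * ∏ j ∈ I.1, (k * t j), reoriented_one fun I => rfl,
    fun n hn => ?_, ?_⟩
  · beta_reduce
    rw [hk]
    have := h n (by revert hn; revert n; decide)
    have hv : v n = 1 := if_neg (by rintro rfl; revert hn; decide)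
    rw [hv, mul_one] at this
    rw [← this, mul_assoc]
  · beta_reduce
    rw [hk]
    have := h 4 (by decide)
    have hv : v 4 = -1 := rfl
    rw [hv, mul_neg_one, neg_mul, neg_mul, mul_assoc] at this
    rw [← this, neg_neg]

lemma Reoriented.isRealizable {χ χ' : SignVector} {σ : Equiv.Perm (Fin 6)} {s : Fin 6 → ℤˣ}
    (h : Reoriented σ s χ χ') (hχ : IsRealizable χ) : IsRealizable χ' := by
  obtain ⟨M, hM⟩ := hχ
  obtain ⟨N, hN, -⟩ := h.relabel_mem (x := mk M hM.generic) ⟨M, hM, rfl⟩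
  exact ⟨N, hN⟩

/-- Every realizable sign vector is a reorientation of a sign vector of the table. -/
theorem exists_table_entry {χ : SignVector} (hχ : IsRealizable χ) :
    ∃ e ∈ chirotopeTable, ∃ s, Reoriented 1 s (signOf e.1) χ := by
  obtain ⟨s, χ', h1, h2, h3⟩ := exists_normalized χ
  have hχ' := h1.isRealizable hχ
  choose b hb using fun n => exists_boolSign (χ' (triple n))
  have hf : ∀ n ∈ ({0, 1, 2, 3, 10} : Finset (Fin 20)), b n = false := fun n hn =>
    boolSign_injective ((hb n).trans (h2 n hn))
  have b0 := hf 0 (by decide)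
  have b1 := hf 1 (by decide)
  have b2 := hf 2 (by decide)
  have b3 := hf 3 (by decide)
  have b10 := hf 10 (by decide)
  have b4 : b 4 = true := boolSign_injective ((hb 4).trans h3)
  have hr := okBits_of_realizable hχ' fun n => (hb n).symm
  have hc := chirotopeTable_complete
  simp only [bothBits_iff, cond_true_iff, List.any_eq_true, Bool.and_eq_true, beq_iff_eq,
    and_assoc] at hc
  obtain ⟨e, he, h⟩ := hc
    (b 5) (b 7) (by simpa only [b0, b1, b2, b3, b4, b10] using hr 0 1 2 3 4 0 7 1 5 2 4 false false false (by decide)) (b 6) (b 8)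
    (by simpa only [b0, b1, b2, b3, b4, b10] using hr 0 1 2 3 5 0 8 1 6 3 4 false false false (by decide)) (b 9)
    (by simpa only [b0, b1, b2, b3, b4, b10] using hr 0 1 2 4 5 0 9 2 6 3 5 false false false (by decide))
    (by simpa only [b0, b1, b2, b3, b4, b10] using hr 0 1 3 4 5 1 9 2 8 3 7 false false false (by decide))
    (by simpa only [b0, b1, b2, b3, b4, b10] using hr 0 2 3 4 5 4 9 5 8 6 7 false false false (by decide)) (b 11) (b 13)
    (by simpa only [b0, b1, b2, b3, b4, b10] using hr 1 0 2 3 4 0 13 1 11 2 10 true true true (by decide)) (b 16)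
    (by simpa only [b0, b1, b2, b3, b4, b10] using hr 2 0 1 3 4 0 16 4 11 5 10 false false false (by decide))
    (by simpa only [b0, b1, b2, b3, b4, b10] using hr 3 0 1 2 4 1 16 4 13 7 10 true true true (by decide))
    (by simpa only [b0, b1, b2, b3, b4, b10] using hr 4 0 1 2 3 2 16 5 13 7 11 false false false (by decide)) (b 12) (b 14)
    (by simpa only [b0, b1, b2, b3, b4, b10] using hr 1 0 2 3 5 0 14 1 12 3 10 true true true (by decide)) (b 15)
    (by simpa only [b0, b1, b2, b3, b4, b10] using hr 1 0 2 4 5 0 15 2 12 3 11 true true true (by decide))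
    (by simpa only [b0, b1, b2, b3, b4, b10] using hr 1 0 3 4 5 1 15 2 14 3 13 true true true (by decide))
    (by simpa only [b0, b1, b2, b3, b4, b10] using hr 1 2 3 4 5 10 15 11 14 12 13 false false false (by decide)) (b 17)
    (by simpa only [b0, b1, b2, b3, b4, b10] using hr 2 0 1 3 5 0 17 4 12 6 10 false false false (by decide))
    (by simpa only [b0, b1, b2, b3, b4, b10] using hr 3 0 1 2 5 1 17 4 14 8 10 true true true (by decide))
    (by simpa only [b0, b1, b2, b3, b4, b10] using hr 5 0 1 2 3 3 17 6 14 8 12 false false false (by decide)) (b 18)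
    (by simpa only [b0, b1, b2, b3, b4, b10] using hr 2 0 1 4 5 0 18 5 12 6 11 false false false (by decide))
    (by simpa only [b0, b1, b2, b3, b4, b10] using hr 2 0 3 4 5 4 18 5 17 6 16 true true true (by decide))
    (by simpa only [b0, b1, b2, b3, b4, b10] using hr 2 1 3 4 5 10 18 11 17 12 16 true true true (by decide))
    (by simpa only [b0, b1, b2, b3, b4, b10] using hr 4 0 1 2 5 2 18 5 15 9 11 true true true (by decide))
    (by simpa only [b0, b1, b2, b3, b4, b10] using hr 5 0 1 2 4 3 18 6 15 9 12 false false false (by decide)) (b 19)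
    (by simpa only [b0, b1, b2, b3, b4, b10] using hr 3 0 1 4 5 1 19 7 14 8 13 false false false (by decide))
    (by simpa only [b0, b1, b2, b3, b4, b10] using hr 3 0 2 4 5 4 19 7 17 8 16 false false false (by decide))
    (by simpa only [b0, b1, b2, b3, b4, b10] using hr 3 1 2 4 5 10 19 13 17 14 16 false false false (by decide))
    (by simpa only [b0, b1, b2, b3, b4, b10] using hr 4 0 1 3 5 2 19 7 15 9 13 true true true (by decide))
    (by simpa only [b0, b1, b2, b3, b4, b10] using hr 4 0 2 3 5 5 19 7 18 9 16 true true true (by decide))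
    (by simpa only [b0, b1, b2, b3, b4, b10] using hr 4 1 2 3 5 11 19 13 18 15 16 true true true (by decide))
    (by simpa only [b0, b1, b2, b3, b4, b10] using hr 5 0 1 3 4 3 19 8 15 9 14 false false false (by decide))
    (by simpa only [b0, b1, b2, b3, b4, b10] using hr 5 0 2 3 4 6 19 8 18 9 17 false false false (by decide))
    (by simpa only [b0, b1, b2, b3, b4, b10] using hr 5 1 2 3 4 12 19 14 18 15 17 false false false (by decide))
  obtain ⟨hn, hn4, -⟩ := chirotopeTable_normalized e he
  have hn' := fun n hm => (hn n hm).trans (hf n (by simpa using hm)).symm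
  have key : ∀ n, e.1.testBit (bitPos n) = b n := by
    obtain ⟨h5, h7, h6, h8, h9, h11, h13, h16, h12, h14, h15, h17, h18, h19⟩ := h
    intro n
    fin_cases n
    exacts [hn' 0 (by simp), hn' 1 (by simp), hn' 2 (by simp), hn' 3 (by simp), hn4.trans b4.symm,
      h5, h6, h7, h8, h9, hn' 10 (by simp), h11, h12, h13, h14, h15, h16, h17, h18, h19]
  have h4 : signOf e.1 = χ' := by
    funext I
    obtain ⟨n, rfl⟩ := triple_bijective.2 I
    rw [signOf_triple, key, hb]
  have h5 := h1.symm
  rw [inv_one] at h5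
  exact ⟨e, he, _, h4 ▸ h5⟩

lemma tri_labels : ∀ n, tri (labels n 0) (labels n 1) (labels n 2) = triple n := by decide

lemma eq_of_reoriented {e e' : ℕ × ℕ × ℕ × ℕ} (he : e ∈ chirotopeTable) (he' : e' ∈ chirotopeTable)
    {s : Fin 6 → ℤˣ} (h : Reoriented 1 s (signOf e.1) (signOf e'.1)) : e.1 = e'.1 := by
  obtain ⟨hn, hn4, hr⟩ := chirotopeTable_normalized e he
  obtain ⟨hn', hn4', hr'⟩ := chirotopeTable_normalized e' he'
  have h1 : ∀ n, signOf e'.1 (triple n) =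
      s (labels n 0) * s (labels n 1) * s (labels n 2) * signOf e.1 (triple n) := by
    intro n
    obtain ⟨h01, h12⟩ := labels_lt n
    have := h _ _ _ h01.ne (h01.trans h12).ne h12.ne
    have ht : tri (labels n 0) (labels n 1) (labels n 2) = triple n := tri_labels n
    simpa only [Equiv.Perm.coe_one, id_eq, ochi_of_lt _ h01 h12, ht] using this
  have hs : ∀ n ∈ ([0, 1, 2, 3, 10, 4] : List (Fin 20)),
      s (labels n 0) * s (labels n 1) * s (labels n 2) = 1 := by
    intro n hm
    have h2 := h1 n
    have h3 : e'.1.testBit (bitPos n) = e.1.testBit (bitPos n) := by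
      rcases List.mem_append.mp (show n ∈ [0, 1, 2, 3, 10] ++ [4] from hm) with h4 | h4
      · rw [hn n h4, hn' n h4]
      · rw [List.mem_singleton.mp h4, hn4, hn4']
    rw [signOf_triple, signOf_triple, h3] at h2
    exact right_eq_mul.mp h2
  have hs0 := hs 0 (by simp)
  have hs1 := hs 1 (by simp)
  have hs2 := hs 2 (by simp)
  have hs3 := hs 3 (by simp)
  have hs4 := hs 4 (by simp)
  have hs10 := hs 10 (by simp)
  have hone : ∀ j, s j = 1 := by
    simp only [labels, Matrix.cons_val, Fin.isValue] at hs0 hs1 hs2 hs3 hs4 hs10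
    have key : ∀ s0 s1 s2 s3 s4 s5 : ℤˣ, s0 * s1 * s2 = 1 → s0 * s1 * s3 = 1 → s0 * s1 * s4 = 1 →
        s0 * s1 * s5 = 1 → s0 * s2 * s3 = 1 → s1 * s2 * s3 = 1 →
        s0 = 1 ∧ s1 = 1 ∧ s2 = 1 ∧ s3 = 1 ∧ s4 = 1 ∧ s5 = 1 := by
      intro s0 s1 s2 s3 s4 s5
      rcases Int.units_eq_one_or s0 with rfl | rfl <;> rcases Int.units_eq_one_or s1 with rfl | rfl <;>
        rcases Int.units_eq_one_or s2 with rfl | rfl <;>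
        rcases Int.units_eq_one_or s3 with rfl | rfl <;> simp +contextual
    obtain ⟨k0, k1, k2, k3, k4, k5⟩ := key _ _ _ _ _ _ hs0 hs1 hs2 hs3 hs4 hs10
    intro j
    fin_cases j
    exacts [k0, k1, k2, k3, k4, k5]
  have hbit : ∀ n, e'.1.testBit (bitPos n) = e.1.testBit (bitPos n) := by
    intro n
    have := h1 n
    simp only [hone, one_mul] at this
    exact boolSign_injective this
  rw [hr, hr']
  simp only [hbit]

lemma exists_perm_of_digits {d : ℕ}
    (h : ∀ i < 6, digit d i < 6 ∧ ∀ j < i, digit d i ≠ digit d j) :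
    ∃ σ : Equiv.Perm (Fin 6), ∀ i, (σ i : ℕ) = digit d i := by
  have hinj : Function.Injective fun i : Fin 6 => (⟨digit d i, (h i i.2).1⟩ : Fin 6) := by
    intro i j hij
    have hij' : digit d i = digit d j := congrArg Fin.val hij
    rcases lt_trichotomy i j with hl | hl | hl
    · exact absurd hij'.symm ((h j j.2).2 i hl)
    · exact hl
    · exact absurd hij' ((h i i.2).2 j hl)
  exact ⟨Equiv.ofBijective _ (Finite.injective_iff_bijective.mp hinj), fun i => rfl⟩

lemma reoriented_of_lt {σ : Equiv.Perm (Fin 6)} {s : Fin 6 → ℤˣ} {χ χ' : SignVector}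
    (h : ∀ a b c, a < b → b < c → ochi χ' a b c = s a * s b * s c * ochi χ (σ a) (σ b) (σ c)) :
    Reoriented σ s χ χ' := by
  intro a b c hab hac hbc
  refine sorted_induction (p := fun a b c => ochi χ' a b c =
    s a * s b * s c * ochi χ (σ a) (σ b) (σ c)) ?_ ?_ h hab hac hbc
  · intro a b c h1 _ _ h
    rw [ochi_swap12 _ _ h1, h, ochi_swap12 _ _ (σ.injective.ne h1), mul_neg, mul_comm (s b)]
  · intro a b c _ _ h3 h
    rw [ochi_swap23 _ _ h3, h, ochi_swap23 _ _ (σ.injective.ne h3), mul_neg, mul_right_comm (s a)]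

/-- Every sign vector of the table is obtained from a base sign vector. -/
theorem exists_base {e : ℕ × ℕ × ℕ × ℕ} (he : e ∈ chirotopeTable) :
    e.2.1 < 4 ∧ ∃ σ s, Reoriented σ s (signOf (baseCode e.2.1)) (signOf e.1) := by
  obtain ⟨hk, hd, ho⟩ := chirotopeTable_reoriented e he
  obtain ⟨σ, hσ⟩ := exists_perm_of_digits hd
  refine ⟨hk, σ, fun j => boolSign (e.2.2.2.testBit j), reoriented_of_lt fun a b c hab hbc => ?_⟩
  have hac := hab.trans hbc
  rw [ochi_signOf _ hab.ne hac.ne hbc.ne, ochi_signOf _ (σ.injective.ne hab.ne)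
    (σ.injective.ne hac.ne) (σ.injective.ne hbc.ne), ho c c.2 b hbc a hab, boolSign_xor,
    boolSign_xor, boolSign_xor, hσ, hσ, hσ]
  ac_rfl
/-- There are exactly 372 chirotopal configuration spaces. -/
theorem ncard_realizationSpaces (hbase : ∀ k, IsRealizable (signOf (baseCode k))) :
    {S : Set X36 | ∃ χ, IsRealizable χ ∧ S = realizationSpace χ}.ncard = 372 := by
  have hreal : ∀ e ∈ chirotopeTable, IsRealizable (signOf e.1) := fun e he => by
    obtain ⟨-, σ, s, h⟩ := exists_base he
    exact h.isRealizable (hbase _)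
  have hpair := (List.isChain_iff_pairwise.mp chirotopeTable_sorted)
  have hset : {S : Set X36 | ∃ χ, IsRealizable χ ∧ S = realizationSpace χ} =
      (fun N => (realizationSpace (signOf N) : Set X36)) ''
        ((chirotopeTable.map Prod.fst).toFinset : Set ℕ) := by
    ext S
    simp only [Set.mem_image, Finset.mem_coe, List.mem_toFinset, List.mem_map]
    constructor
    · rintro ⟨χ, hχ, rfl⟩
      obtain ⟨e, he, s, h⟩ := exists_table_entry hχ
      exact ⟨e.1, ⟨e, he, rfl⟩, by rw [h.realizationSpace_eq]⟩
    · rintro ⟨_, ⟨e, he, rfl⟩, rfl⟩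
      exact ⟨_, hreal e he, rfl⟩
  rw [hset, Set.InjOn.ncard_image, Set.ncard_coe_finset, List.toFinset_card_of_nodup,
    List.length_map, chirotopeTable_length]
  · exact hpair.imp fun h => h.ne
  · intro N hN N' hN' heq
    simp only [Finset.mem_coe, List.mem_toFinset, List.mem_map] at hN hN'
    obtain ⟨e, he, rfl⟩ := hN
    obtain ⟨e', he', rfl⟩ := hN'
    obtain ⟨M, hM⟩ := hreal e he
    have hx : mk M hM.generic ∈ realizationSpace (signOf e.1) := ⟨M, hM, rfl⟩
    have hx' : relabel 1 (mk M hM.generic) ∈ realizationSpace (signOf e'.1) := by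
      rw [relabel_one]
      exact (Set.ext_iff.mp heq _).mp hx
    obtain ⟨s, hs⟩ := exists_reoriented hx hx'
    exact eq_of_reoriented he he' hs

/-! ### Logarithmic Jacobians -/

lemma hasFDerivAt_eval_exp (p : Poly4) (l : Fin 4 → ℝ) :
    HasFDerivAt (fun l : Fin 4 → ℝ => MvPolynomial.eval (fun j => Real.exp (l j)) p)
      (∑ j, (Real.exp (l j) * MvPolynomial.eval (fun j => Real.exp (l j)) (MvPolynomial.pderiv j p)) •
        (ContinuousLinearMap.proj j : (Fin 4 → ℝ) →L[ℝ] ℝ)) l := by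
  induction p using MvPolynomial.induction_on with
  | C a => simpa using hasFDerivAt_const a l
  | add p q hp hq =>
    simp only [map_add, mul_add, add_smul, Finset.sum_add_distrib]
    exact hp.add hq
  | mul_X p i hp =>
    have hX : HasFDerivAt (fun l : Fin 4 → ℝ => Real.exp (l i))
        (Real.exp (l i) • (ContinuousLinearMap.proj i : (Fin 4 → ℝ) →L[ℝ] ℝ)) l :=
      (hasFDerivAt_apply i l).exp
    simp only [map_mul, MvPolynomial.eval_X, MvPolynomial.pderiv_mul, map_add, mul_add, add_smul,
      Finset.sum_add_distrib]
    refine (hp.mul hX).congr_fderiv ?_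
    ext v
    simp only [MvPolynomial.pderiv_X, Pi.single_apply]
    simp [Finset.mul_sum, apply_ite (MvPolynomial.eval _)]
    ring_nf

/-- The logarithmic Jacobian matrix of the rational functions `P i / R i`. -/
def logJacobian (P R : Fin 4 → Poly4) (y : Fin 4 → ℝ) : Matrix (Fin 4) (Fin 4) ℝ :=
  Matrix.of fun i j => y j * (MvPolynomial.eval y (MvPolynomial.pderiv j (P i)) /
    MvPolynomial.eval y (P i) - MvPolynomial.eval y (MvPolynomial.pderiv j (R i)) /
    MvPolynomial.eval y (R i))

lemma hasFDerivAt_log_quotient {p r : Poly4} {l : Fin 4 → ℝ}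
    (hp : MvPolynomial.eval (fun j => Real.exp (l j)) p ≠ 0)
    (hr : MvPolynomial.eval (fun j => Real.exp (l j)) r ≠ 0) :
    HasFDerivAt (fun l : Fin 4 → ℝ => Real.log (MvPolynomial.eval (fun j => Real.exp (l j)) p) -
        Real.log (MvPolynomial.eval (fun j => Real.exp (l j)) r))
      (∑ j, (Real.exp (l j) * (MvPolynomial.eval (fun j => Real.exp (l j)) (MvPolynomial.pderiv j p) /
        MvPolynomial.eval (fun j => Real.exp (l j)) p -
        MvPolynomial.eval (fun j => Real.exp (l j)) (MvPolynomial.pderiv j r) /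
        MvPolynomial.eval (fun j => Real.exp (l j)) r)) •
        (ContinuousLinearMap.proj j : (Fin 4 → ℝ) →L[ℝ] ℝ)) l := by
  refine (((hasFDerivAt_eval_exp p l).log hp).sub ((hasFDerivAt_eval_exp r l).log hr)).congr_fderiv ?_
  rw [Finset.smul_sum, Finset.smul_sum, ← Finset.sum_sub_distrib]
  refine Finset.sum_congr rfl fun j _ => ?_
  rw [smul_smul, smul_smul, ← sub_smul]
  congr 1
  ring

lemma contMDiffAt_log_crossRatio (c : CrossRatio) (x : X36) :
    ContMDiffAt 𝓘(ℝ, E4) 𝓘(ℝ, ℝ) ∞ (fun z => Real.log (c.eval z)) x :=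
  (Real.contDiffAt_log.mpr (crossRatio_ne_zero c x)).contMDiffAt.comp x
    (contMDiff_crossRatio c).contMDiffAt

/-- The differential of a function on the configuration space. -/
def differential (f : X36 → ℝ) (x : X36) : E4 →L[ℝ] ℝ := mfderiv 𝓘(ℝ, E4) 𝓘(ℝ, ℝ) f x

lemma wedgeForm_comp {f : Fin 4 → X36 → ℝ} {x : X36}
    (hf : ∀ j, ContMDiffAt 𝓘(ℝ, E4) 𝓘(ℝ, ℝ) ∞ (f j) x) {g : Fin 4 → X36 → ℝ}
    {G : Fin 4 → (Fin 4 → ℝ) → ℝ} {J : Matrix (Fin 4) (Fin 4) ℝ}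
    (hg : ∀ i, g i =ᶠ[nhds x] fun z => G i fun j => f j z)
    (hG : ∀ i, HasFDerivAt (G i)
      (∑ j, J i j • (ContinuousLinearMap.proj j : (Fin 4 → ℝ) →L[ℝ] ℝ)) fun j => f j x) :
    wedgeForm g x = J.det • wedgeForm f x := by
  have hf' : MDifferentiableAt 𝓘(ℝ, E4) 𝓘(ℝ, Fin 4 → ℝ) (fun z => fun j => f j z) x :=
    (contMDiffAt_pi_space.mpr hf).mdifferentiableAt (by simp)
  have hproj : ∀ j, ∀ v : TangentSpace 𝓘(ℝ, E4) x,
      (mfderiv 𝓘(ℝ, E4) 𝓘(ℝ, Fin 4 → ℝ) (fun z => fun j => f j z) x v : Fin 4 → ℝ) j =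
        differential (f j) x v := fun j v => by
    have h1 := ((ContinuousLinearMap.proj j : (Fin 4 → ℝ) →L[ℝ] ℝ).hasFDerivAt
      (x := fun j => f j x)).hasMFDerivAt.comp x hf'.hasMFDerivAt
    exact (congrArg (fun T : TangentSpace 𝓘(ℝ, E4) x →L[ℝ] ℝ => T v) h1.mfderiv).symm
  have hgi : ∀ i, ∀ v : TangentSpace 𝓘(ℝ, E4) x, 
      differential (g i) x v =
      ∑ j, J i j * differential (f j) x v := fun i v => by
    rw [differential, (hg i).mfderiv_eq]
    have h1 := (hG i).hasMFDerivAt.comp x hf'.hasMFDerivAt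
    refine (congrArg (fun T : TangentSpace 𝓘(ℝ, E4) x →L[ℝ] ℝ => T v) h1.mfderiv).trans ?_
    have key : ∀ w : Fin 4 → ℝ,
        (∑ j, J i j • (ContinuousLinearMap.proj j : (Fin 4 → ℝ) →L[ℝ] ℝ)) w = ∑ j, J i j * w j := by
      simp
    exact (key _).trans (Finset.sum_congr rfl fun j _ => congrArg (J i j * ·) (hproj j v))
  ext v
  change Matrix.det (Matrix.of fun k i =>
      differential (g i) x (v k)) =
    J.det * Matrix.det (Matrix.of fun k i =>
      differential (f i) x (v k))
  rw [← Matrix.det_transpose J, mul_comm, ← Matrix.det_mul]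
  congr 1
  ext k i
  simp only [Matrix.of_apply, hgi, Matrix.mul_apply, Matrix.transpose_apply]
  exact Finset.sum_congr rfl fun j _ => mul_comm _ _

namespace PosChart

variable {χ : SignVector} {A : Matrix (Fin 3) (Fin 6) Poly4} {e : Fin 4 → Triple → ℤ}
  {Q : Triple → MvPolynomial (Fin 4) ℕ}

theorem preservesLogForm (h : PosChart χ A e Q) {g : Equiv.Perm (Fin 6)} {s : Fin 6 → ℤˣ}
    (hg : Reoriented g s χ χ) {P R : Fin 4 → Poly4} {ε : ℤˣ}
    (hP : ∀ y : Fin 4 → ℝ, (∀ j, 0 < y j) → ∀ i, 0 < MvPolynomial.eval y (P i))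
    (hR : ∀ y : Fin 4 → ℝ, (∀ j, 0 < y j) → ∀ i, 0 < MvPolynomial.eval y (R i))
    (hF : ∀ y : Fin 4 → ℝ, (∀ j, 0 < y j) → ∀ i,
      ∏ I, (MvPolynomial.aeval y (Q (tripleMap g I)) : ℝ) ^ e i I =
        MvPolynomial.eval y (P i) / MvPolynomial.eval y (R i))
    (hJ : ∀ y : Fin 4 → ℝ, (∀ j, 0 < y j) → (logJacobian P R y).det = ((ε : ℤ) : ℝ)) :
    PreservesLogForm χ h.crossRatio g := by
  refine ⟨fun x hx => hg.relabel_mem hx, ε, fun x hx => ?_⟩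
  rw [logForm_relabel, logForm_eq]
  have hpos := h.crossRatio_pos hx
  have hy : ∀ z ∈ realizationSpace χ, (fun j => Real.exp (Real.log ((h.crossRatio j).eval z))) =
      fun j => (h.crossRatio j).eval z := fun z hz =>
    funext fun j => Real.exp_log (h.crossRatio_pos hz j)
  rw [← hJ (fun j => (h.crossRatio j).eval x) fun j => hpos j, ← hy x hx]
  refine wedgeForm_comp (fun j => contMDiffAt_log_crossRatio (h.crossRatio j) x)
    (G := fun i l => Real.log (MvPolynomial.eval (fun j => Real.exp (l j)) (P i)) -
        Real.log (MvPolynomial.eval (fun j => Real.exp (l j)) (R i))) (fun i => ?_) fun i => ?_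
  · filter_upwards [(realizationSpace χ).isOpen.mem_nhds hx] with z hz
    have hp : 0 < MvPolynomial.eval (fun j => (h.crossRatio j).eval z) (P i) :=
      hP _ (fun j => h.crossRatio_pos hz j) i
    have hr : 0 < MvPolynomial.eval (fun j => (h.crossRatio j).eval z) (R i) :=
      hR _ (fun j => h.crossRatio_pos hz j) i
    have key : |(h.crossRatio i).eval (relabel g z)| =
        MvPolynomial.eval (fun j => (h.crossRatio j).eval z) (P i) /
          MvPolynomial.eval (fun j => (h.crossRatio j).eval z) (R i) := by
      obtain ⟨y, hyz⟩ : ∃ y, h.diffeo y = ⟨z, hz⟩ := h.diffeo.surjective _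
      have hyz' : (h.diffeo y : X36) = z := congrArg Subtype.val hyz
      have hcoord : (fun j => (h.crossRatio j).eval z) = fun j => (y : E4) j :=
        funext fun j => by rw [← hyz', h.crossRatio_diffeo]
      rw [hcoord, ← hF _ (fun j => y.2 j) i, ← hyz', h.diffeo_apply]
      refine (abs_evalMat _ ((A.map (MvPolynomial.eval fun i => (y : E4) i)).submatrix id g)).trans ?_
      refine Finset.prod_congr rfl fun I _ => ?_
      have hq : 0 < (MvPolynomial.aeval (fun i => (y : E4) i) (Q (tripleMap g I)) : ℝ) := by
        rw [← h.sign_mul_minor]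
        exact hasSigns_iff_pos.mp (h.hasSigns y.2) _
      rw [abs_minor_submatrix, h.minor_eval, abs_mul, abs_of_pos hq]
      rcases Int.units_eq_one_or (χ (tripleMap g I)) with h1 | h1 <;> simp [h1, crossRatio]
    rw [hy z hz, ← Real.log_div hp.ne' hr.ne', ← key, Real.log_abs]
  · have hp := hP _ (fun j => hpos j) i
    have hr := hR _ (fun j => hpos j) i
    refine hasFDerivAt_log_quotient ?_ ?_
    · rw [hy x hx]; exact hp.ne'
    · rw [hy x hx]; exact hr.ne'

end PosChart

/-! ### Symmetries of the base chirotopes -/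

lemma reoriented_signOf {N N' S : ℕ} {σ : Equiv.Perm (Fin 6)}
    (h : ∀ c b a : Fin 6, a < b → b < c → orientBit N' a b c =
      (S.testBit a ^^ (S.testBit b ^^ (S.testBit c ^^ orientBit N (σ a) (σ b) (σ c))))) :
    Reoriented σ (fun j => boolSign (S.testBit j)) (signOf N) (signOf N') := by
  refine reoriented_of_lt fun a b c hab hbc => ?_
  have hac := hab.trans hbc
  rw [ochi_signOf _ hab.ne hac.ne hbc.ne, ochi_signOf _ (σ.injective.ne hab.ne)
    (σ.injective.ne hac.ne) (σ.injective.ne hbc.ne), h c b a hab hbc, boolSign_xor,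
    boolSign_xor, boolSign_xor]
  ac_rfl

lemma prod_tripleMap_zpow (q : Fin 20 → MvPolynomial (Fin 4) ℕ) (E : Fin 20 → ℤ)
    {σ : Equiv.Perm (Fin 6)} {γ : Fin 20 → Fin 20} (hγ : ∀ n, tripleMap σ (triple n) = triple (γ n))
    (y : Fin 4 → ℝ) : ∏ I, (MvPolynomial.aeval y (ofVec q (tripleMap σ I)) : ℝ) ^ ofVec E I =
      ∏ n, (MvPolynomial.aeval y (q (γ n)) : ℝ) ^ E n := by
  rw [prod_eq_prod_triple]
  simp only [hγ, ofVec_triple]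

lemma ofVec_baseSign0 : ofVec baseSign0 = signOf (baseCode 0) := by
  funext I
  obtain ⟨n, rfl⟩ := triple_bijective.2 I
  rw [ofVec_triple, signOf_triple]
  revert n
  decide

lemma ofVec_baseSign1 : ofVec baseSign1 = signOf (baseCode 1) := by
  funext I
  obtain ⟨n, rfl⟩ := triple_bijective.2 I
  rw [ofVec_triple, signOf_triple]
  revert n
  decide

lemma ofVec_baseSign2 : ofVec baseSign2 = signOf (baseCode 2) := by
  funext I
  obtain ⟨n, rfl⟩ := triple_bijective.2 I
  rw [ofVec_triple, signOf_triple]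
  revert n
  decide

lemma ofVec_baseSign3 : ofVec baseSign3 = signOf (baseCode 3) := by
  funext I
  obtain ⟨n, rfl⟩ := triple_bijective.2 I
  rw [ofVec_triple, signOf_triple]
  revert n
  decide

section Generators

open MvPolynomial

lemma det_fin_four {R : Type*} [CommRing R] (M : Matrix (Fin 4) (Fin 4) R) : M.det =
    M 0 0 * (M 1 1 * (M 2 2 * M 3 3 - M 2 3 * M 3 2) - M 1 2 * (M 2 1 * M 3 3 - M 2 3 * M 3 1) +
      M 1 3 * (M 2 1 * M 3 2 - M 2 2 * M 3 1)) -
    M 0 1 * (M 1 0 * (M 2 2 * M 3 3 - M 2 3 * M 3 2) - M 1 2 * (M 2 0 * M 3 3 - M 2 3 * M 3 0) +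
      M 1 3 * (M 2 0 * M 3 2 - M 2 2 * M 3 0)) +
    M 0 2 * (M 1 0 * (M 2 1 * M 3 3 - M 2 3 * M 3 1) - M 1 1 * (M 2 0 * M 3 3 - M 2 3 * M 3 0) +
      M 1 3 * (M 2 0 * M 3 1 - M 2 1 * M 3 0)) -
    M 0 3 * (M 1 0 * (M 2 1 * M 3 2 - M 2 2 * M 3 1) - M 1 1 * (M 2 0 * M 3 2 - M 2 2 * M 3 0) +
      M 1 2 * (M 2 0 * M 3 1 - M 2 1 * M 3 0)) := by
  rw [Matrix.det_succ_row_zero]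
  simp only [Matrix.det_fin_three, Fin.sum_univ_succ, Matrix.submatrix_apply]
  simp [Fin.succAbove]
  ring

/-- A symmetry of the base chirotope 0. -/
def symm0a : Equiv.Perm (Fin 6) :=
  ⟨![0, 4, 2, 5, 1, 3], ![0, 4, 2, 5, 1, 3], by decide, by decide⟩

/-- Numerators of the cross-ratios of the base chart 0 relabelled by `symm0a`. -/
def symmNum0a : Fin 4 → Poly4 :=
    ![X 1, (X 0 + X 1) * X 1, (X 0 + X 1) * X 1 * X 2, (X 0 + X 1) * (X 1) ^ 2]

/-- Denominators of the cross-ratios of the base chart 0 relabelled by `symm0a`. -/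
def symmDen0a : Fin 4 → Poly4 :=
    ![X 0 * (1 + X 0 + X 1), X 0 * (1 + X 0 + X 1), X 0 * (1 + X 0 + X 1) * X 3,
      X 0 * (1 + X 0 + X 1) * X 3]

lemma reoriented_symm0a : Reoriented symm0a (fun j => boolSign (Nat.testBit 63 j))
    (signOf (baseCode 0)) (signOf (baseCode 0)) :=
  reoriented_signOf (by decide)

lemma symmNum0a_pos (y : Fin 4 → ℝ) (hy : ∀ j, 0 < y j) (i : Fin 4) :
    0 < eval y (symmNum0a i) := by
  have h0 := hy 0
  have h1 := hy 1
  have h2 := hy 2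
  have h3 := hy 3
  fin_cases i <;> simp [symmNum0a] <;> positivity

lemma symmDen0a_pos (y : Fin 4 → ℝ) (hy : ∀ j, 0 < y j) (i : Fin 4) :
    0 < eval y (symmDen0a i) := by
  have h0 := hy 0
  have h1 := hy 1
  have h2 := hy 2
  have h3 := hy 3
  fin_cases i <;> simp [symmDen0a] <;> positivity

lemma prod_symm0a {y : Fin 4 → ℝ} (hy : ∀ j, 0 < y j) (i : Fin 4) :
    ∏ I : Triple, (aeval y (ofVec (baseMinor0 (X 0) (X 1) (X 2) (X 3)) (tripleMap symm0a I) :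
      MvPolynomial (Fin 4) ℕ) : ℝ) ^
      ofVec (baseExpo0 i) I = eval y (symmNum0a i) / eval y (symmDen0a i) := by
  rw [prod_tripleMap_zpow (γ := ![5, 9, 2, 7, 6, 0, 4, 3, 8, 1, 18, 11, 16, 15, 19, 13, 12, 17, 10, 14]) _ _ (by decide)]
  have h0 := hy 0
  have h1 := hy 1
  have h2 := hy 2
  have h3 := hy 3
  generalize hx : y = v at *
  fin_cases i <;>
    simp [Fin.prod_univ_succ, baseExpo0, baseMinor0, symmNum0a, symmDen0a] <;>
    generalize v 0 = a at * <;> generalize v 1 = b at * <;> generalize v 2 = r at * <;>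
    generalize v 3 = s at * <;> field_simp

lemma det_symm0a {y : Fin 4 → ℝ} (hy : ∀ j, 0 < y j) :
    (logJacobian symmNum0a symmDen0a y).det = 1 := by
  have h0 := hy 0
  have h1 := hy 1
  have h2 := hy 2
  have h3 := hy 3
  rw [det_fin_four]
  simp [logJacobian, symmNum0a, symmDen0a, pderiv_X]
  generalize y 0 = a at *
  generalize y 1 = b at *
  generalize y 2 = r at *
  generalize y 3 = s at *
  field_simp
  ring

/-- A symmetry of the base chirotope 0. -/
def symm0b : Equiv.Perm (Fin 6) :=
  ⟨![1, 0, 5, 4, 3, 2], ![1, 0, 5, 4, 3, 2], by decide, by decide⟩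

/-- Numerators of the cross-ratios of the base chart 0 relabelled by `symm0b`. -/
def symmNum0b : Fin 4 → Poly4 :=
    ![X 0 * (X 0 + X 2), X 0, X 0 * X 3, X 0 * X 2]

/-- Denominators of the cross-ratios of the base chart 0 relabelled by `symm0b`. -/
def symmDen0b : Fin 4 → Poly4 :=
    ![X 0 * X 1 + (X 1 * X 2 + X 3), X 0 * X 1 + (X 1 * X 2 + X 3),
      (X 0 * X 1 + (X 1 * X 2 + X 3)) * X 1, (X 0 * X 1 + (X 1 * X 2 + X 3)) * X 1]

lemma reoriented_symm0b : Reoriented symm0b (fun j => boolSign (Nat.testBit 60 j))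
    (signOf (baseCode 0)) (signOf (baseCode 0)) :=
  reoriented_signOf (by decide)

lemma symmNum0b_pos (y : Fin 4 → ℝ) (hy : ∀ j, 0 < y j) (i : Fin 4) :
    0 < eval y (symmNum0b i) := by
  have h0 := hy 0
  have h1 := hy 1
  have h2 := hy 2
  have h3 := hy 3
  fin_cases i <;> simp [symmNum0b] <;> positivity

lemma symmDen0b_pos (y : Fin 4 → ℝ) (hy : ∀ j, 0 < y j) (i : Fin 4) :
    0 < eval y (symmDen0b i) := by
  have h0 := hy 0
  have h1 := hy 1
  have h2 := hy 2
  have h3 := hy 3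
  fin_cases i <;> simp [symmDen0b] <;> positivity

lemma prod_symm0b {y : Fin 4 → ℝ} (hy : ∀ j, 0 < y j) (i : Fin 4) :
    ∏ I : Triple, (aeval y (ofVec (baseMinor0 (X 0) (X 1) (X 2) (X 3)) (tripleMap symm0b I) :
      MvPolynomial (Fin 4) ℕ) : ℝ) ^
      ofVec (baseExpo0 i) I = eval y (symmNum0b i) / eval y (symmDen0b i) := by
  rw [prod_tripleMap_zpow (γ := ![3, 2, 1, 0, 15, 14, 12, 13, 11, 10, 9, 8, 6, 7, 5, 4, 19, 18, 17, 16]) _ _ (by decide)]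
  have h0 := hy 0
  have h1 := hy 1
  have h2 := hy 2
  have h3 := hy 3
  generalize hx : y = v at *
  fin_cases i <;>
    simp [Fin.prod_univ_succ, baseExpo0, baseMinor0, symmNum0b, symmDen0b] <;>
    generalize v 0 = a at * <;> generalize v 1 = b at * <;> generalize v 2 = r at * <;>
    generalize v 3 = s at * <;> field_simp

lemma det_symm0b {y : Fin 4 → ℝ} (hy : ∀ j, 0 < y j) :
    (logJacobian symmNum0b symmDen0b y).det = 1 := by
  have h0 := hy 0
  have h1 := hy 1
  have h2 := hy 2
  have h3 := hy 3
  rw [det_fin_four]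
  simp [logJacobian, symmNum0b, symmDen0b, pderiv_X]
  generalize y 0 = a at *
  generalize y 1 = b at *
  generalize y 2 = r at *
  generalize y 3 = s at *
  field_simp
  ring

/-- A symmetry of the base chirotope 1. -/
def symm1a : Equiv.Perm (Fin 6) :=
  ⟨![1, 2, 4, 5, 0, 3], ![4, 0, 1, 5, 2, 3], by decide, by decide⟩

/-- Numerators of the cross-ratios of the base chart 1 relabelled by `symm1a`. -/
def symmNum1a : Fin 4 → Poly4 :=
    ![X 1, (X 1 + X 2) * (1 + X 0), X 1 * (X 1 + X 2), X 1 * (X 1 + X 2) ^ 2 * X 0]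

/-- Denominators of the cross-ratios of the base chart 1 relabelled by `symm1a`. -/
def symmDen1a : Fin 4 → Poly4 :=
    ![X 2, X 3, X 3, X 2 * X 3]

lemma reoriented_symm1a : Reoriented symm1a (fun j => boolSign (Nat.testBit 50 j))
    (signOf (baseCode 1)) (signOf (baseCode 1)) :=
  reoriented_signOf (by decide)

lemma symmNum1a_pos (y : Fin 4 → ℝ) (hy : ∀ j, 0 < y j) (i : Fin 4) :
    0 < eval y (symmNum1a i) := by
  have h0 := hy 0
  have h1 := hy 1
  have h2 := hy 2
  have h3 := hy 3
  fin_cases i <;> simp [symmNum1a] <;> positivity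

lemma symmDen1a_pos (y : Fin 4 → ℝ) (hy : ∀ j, 0 < y j) (i : Fin 4) :
    0 < eval y (symmDen1a i) := by
  have h0 := hy 0
  have h1 := hy 1
  have h2 := hy 2
  have h3 := hy 3
  fin_cases i <;> simp [symmDen1a] <;> positivity

lemma prod_symm1a {y : Fin 4 → ℝ} (hy : ∀ j, 0 < y j) (i : Fin 4) :
    ∏ I : Triple, (aeval y (ofVec (baseMinor1 (X 0) (X 1) (X 2) (X 3)) (tripleMap symm1a I) :
      MvPolynomial (Fin 4) ℕ) : ℝ) ^
      ofVec (baseExpo1 i) I = eval y (symmNum1a i) / eval y (symmDen1a i) := by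
  rw [prod_tripleMap_zpow (γ := ![11, 12, 0, 10, 15, 2, 13, 3, 14, 1, 18, 5, 16, 6, 17, 4, 9, 19, 7, 8]) _ _ (by decide)]
  have h0 := hy 0
  have h1 := hy 1
  have h2 := hy 2
  have h3 := hy 3
  generalize hx : y = v at *
  fin_cases i <;>
    simp [Fin.prod_univ_succ, baseExpo1, baseMinor1, symmNum1a, symmDen1a] <;>
    generalize v 0 = a at * <;> generalize v 1 = b at * <;> generalize v 2 = r at * <;>
    generalize v 3 = s at * <;> field_simp

lemma det_symm1a {y : Fin 4 → ℝ} (hy : ∀ j, 0 < y j) :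
    (logJacobian symmNum1a symmDen1a y).det = -1 := by
  have h0 := hy 0
  have h1 := hy 1
  have h2 := hy 2
  have h3 := hy 3
  rw [det_fin_four]
  simp [logJacobian, symmNum1a, symmDen1a, pderiv_X]
  generalize y 0 = a at *
  generalize y 1 = b at *
  generalize y 2 = r at *
  generalize y 3 = s at *
  field_simp
  ring

/-- A symmetry of the base chirotope 2. -/
def symm2a : Equiv.Perm (Fin 6) :=
  ⟨![1, 0, 2, 3, 5, 4], ![1, 0, 2, 3, 5, 4], by decide, by decide⟩

/-- Numerators of the cross-ratios of the base chart 2 relabelled by `symm2a`. -/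
def symmNum2a : Fin 4 → Poly4 :=
    ![X 2, (1 + X 0) * (1 + X 2) + X 3, X 0, X 3]

/-- Denominators of the cross-ratios of the base chart 2 relabelled by `symm2a`. -/
def symmDen2a : Fin 4 → Poly4 :=
    ![1, X 1, 1, 1]

lemma reoriented_symm2a : Reoriented symm2a (fun j => boolSign (Nat.testBit 63 j))
    (signOf (baseCode 2)) (signOf (baseCode 2)) :=
  reoriented_signOf (by decide)

lemma symmNum2a_pos (y : Fin 4 → ℝ) (hy : ∀ j, 0 < y j) (i : Fin 4) :
    0 < eval y (symmNum2a i) := by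
  have h0 := hy 0
  have h1 := hy 1
  have h2 := hy 2
  have h3 := hy 3
  fin_cases i <;> simp [symmNum2a] <;> positivity

lemma symmDen2a_pos (y : Fin 4 → ℝ) (hy : ∀ j, 0 < y j) (i : Fin 4) :
    0 < eval y (symmDen2a i) := by
  have h0 := hy 0
  have h1 := hy 1
  have h2 := hy 2
  have h3 := hy 3
  fin_cases i <;> simp [symmDen2a] <;> positivity

lemma prod_symm2a {y : Fin 4 → ℝ} (hy : ∀ j, 0 < y j) (i : Fin 4) :
    ∏ I : Triple, (aeval y (ofVec (baseMinor2 (X 0) (X 1) (X 2) (X 3)) (tripleMap symm2a I) :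
      MvPolynomial (Fin 4) ℕ) : ℝ) ^
      ofVec (baseExpo2 i) I = eval y (symmNum2a i) / eval y (symmDen2a i) := by
  rw [prod_tripleMap_zpow (γ := ![0, 1, 3, 2, 10, 12, 11, 14, 13, 15, 4, 6, 5, 8, 7, 9, 17, 16, 18, 19]) _ _ (by decide)]
  have h0 := hy 0
  have h1 := hy 1
  have h2 := hy 2
  have h3 := hy 3
  generalize hx : y = v at *
  fin_cases i <;>
    simp [Fin.prod_univ_succ, baseExpo2, baseMinor2, symmNum2a, symmDen2a] <;>
    generalize v 0 = a at * <;> generalize v 1 = b at * <;> generalize v 2 = r at * <;>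
    generalize v 3 = s at * <;> field_simp

lemma det_symm2a {y : Fin 4 → ℝ} (hy : ∀ j, 0 < y j) :
    (logJacobian symmNum2a symmDen2a y).det = 1 := by
  have h0 := hy 0
  have h1 := hy 1
  have h2 := hy 2
  have h3 := hy 3
  rw [det_fin_four]
  simp [logJacobian, symmNum2a, symmDen2a, pderiv_X]
  generalize y 0 = a at *
  generalize y 1 = b at *
  generalize y 2 = r at *
  generalize y 3 = s at *
  field_simp

/-- A symmetry of the base chirotope 2. -/
def symm2b : Equiv.Perm (Fin 6) :=
  ⟨![0, 2, 1, 4, 3, 5], ![0, 2, 1, 4, 3, 5], by decide, by decide⟩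

/-- Numerators of the cross-ratios of the base chart 2 relabelled by `symm2b`. -/
def symmNum2b : Fin 4 → Poly4 :=
    ![1 + X 1, X 1, 1 + X 1, (1 + X 1) * X 3]

/-- Denominators of the cross-ratios of the base chart 2 relabelled by `symm2b`. -/
def symmDen2b : Fin 4 → Poly4 :=
    ![X 0, 1, X 2, X 0 * X 2]

lemma reoriented_symm2b : Reoriented symm2b (fun j => boolSign (Nat.testBit 33 j))
    (signOf (baseCode 2)) (signOf (baseCode 2)) :=
  reoriented_signOf (by decide)

lemma symmNum2b_pos (y : Fin 4 → ℝ) (hy : ∀ j, 0 < y j) (i : Fin 4) :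
    0 < eval y (symmNum2b i) := by
  have h0 := hy 0
  have h1 := hy 1
  have h2 := hy 2
  have h3 := hy 3
  fin_cases i <;> simp [symmNum2b] <;> positivity

lemma symmDen2b_pos (y : Fin 4 → ℝ) (hy : ∀ j, 0 < y j) (i : Fin 4) :
    0 < eval y (symmDen2b i) := by
  have h0 := hy 0
  have h1 := hy 1
  have h2 := hy 2
  have h3 := hy 3
  fin_cases i <;> simp [symmDen2b] <;> positivity

lemma prod_symm2b {y : Fin 4 → ℝ} (hy : ∀ j, 0 < y j) (i : Fin 4) :
    ∏ I : Triple, (aeval y (ofVec (baseMinor2 (X 0) (X 1) (X 2) (X 3)) (tripleMap symm2b I) :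
      MvPolynomial (Fin 4) ℕ) : ℝ) ^
      ofVec (baseExpo2 i) I = eval y (symmNum2b i) / eval y (symmDen2b i) := by
  rw [prod_tripleMap_zpow (γ := ![0, 5, 4, 6, 2, 1, 3, 7, 9, 8, 11, 10, 12, 16, 18, 17, 13, 15, 14, 19]) _ _ (by decide)]
  have h0 := hy 0
  have h1 := hy 1
  have h2 := hy 2
  have h3 := hy 3
  generalize hx : y = v at *
  fin_cases i <;>
    simp [Fin.prod_univ_succ, baseExpo2, baseMinor2, symmNum2b, symmDen2b] <;>
    generalize v 0 = a at * <;> generalize v 1 = b at * <;> generalize v 2 = r at * <;>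
    generalize v 3 = s at * <;> field_simp

lemma det_symm2b {y : Fin 4 → ℝ} (hy : ∀ j, 0 < y j) :
    (logJacobian symmNum2b symmDen2b y).det = 1 := by
  have h0 := hy 0
  have h1 := hy 1
  have h2 := hy 2
  have h3 := hy 3
  rw [det_fin_four]
  simp [logJacobian, symmNum2b, symmDen2b, pderiv_X]
  generalize y 0 = a at *
  generalize y 1 = b at *
  generalize y 2 = r at *
  generalize y 3 = s at *
  field_simp

/-- A symmetry of the base chirotope 3. -/
def symm3a : Equiv.Perm (Fin 6) :=
  ⟨![4, 1, 5, 3, 0, 2], ![4, 1, 5, 3, 0, 2], by decide, by decide⟩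

/-- Numerators of the cross-ratios of the base chart 3 relabelled by `symm3a`. -/
def symmNum3a : Fin 4 → Poly4 :=
    ![(polyN (X 0) (X 1) (X 2) (X 3)) * X 0, 1, 1, polyH (X 0) (X 1) (X 2) (X 3)]

/-- Denominators of the cross-ratios of the base chart 3 relabelled by `symm3a`. -/
def symmDen3a : Fin 4 → Poly4 :=
    ![X 2 * (polyG (X 0) (X 1) (X 3)), X 2, X 1, X 3 * (polyE (X 0) (X 2) (X 3))]

lemma reoriented_symm3a : Reoriented symm3a (fun j => boolSign (Nat.testBit 63 j))
    (signOf (baseCode 3)) (signOf (baseCode 3)) :=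
  reoriented_signOf (by decide)

lemma symmNum3a_pos (y : Fin 4 → ℝ) (hy : ∀ j, 0 < y j) (i : Fin 4) :
    0 < eval y (symmNum3a i) := by
  have h0 := hy 0
  have h1 := hy 1
  have h2 := hy 2
  have h3 := hy 3
  fin_cases i <;> simp [symmNum3a, polyN, polyH] <;> positivity

lemma symmDen3a_pos (y : Fin 4 → ℝ) (hy : ∀ j, 0 < y j) (i : Fin 4) :
    0 < eval y (symmDen3a i) := by
  have h0 := hy 0
  have h1 := hy 1
  have h2 := hy 2
  have h3 := hy 3
  fin_cases i <;> simp [symmDen3a, polyE, polyG] <;> positivity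

lemma prod_symm3a {y : Fin 4 → ℝ} (hy : ∀ j, 0 < y j) (i : Fin 4) :
    ∏ I : Triple, (aeval y (ofVec (baseMinor3 (X 0) (X 1) (X 2) (X 3)) (tripleMap symm3a I) :
      MvPolynomial (Fin 4) ℕ) : ℝ) ^
      ofVec (baseExpo3 i) I = eval y (symmNum3a i) / eval y (symmDen3a i) := by
  rw [prod_tripleMap_zpow (γ := ![15, 13, 2, 11, 19, 9, 18, 7, 16, 5, 14, 3, 12, 1, 10, 0, 8, 17, 6, 4]) _ _ (by decide)]
  have h0 := hy 0
  have h1 := hy 1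
  have h2 := hy 2
  have h3 := hy 3
  generalize hx : y = v at *
  fin_cases i <;>
    simp [Fin.prod_univ_succ, baseExpo3, baseMinor3, symmNum3a, symmDen3a, polyD, polyE, polyN, polyH, polyG] <;>
    generalize v 0 = a at * <;> generalize v 1 = b at * <;> generalize v 2 = r at * <;>
    generalize v 3 = s at * <;> field_simp

lemma det_symm3a {y : Fin 4 → ℝ} (hy : ∀ j, 0 < y j) :
    (logJacobian symmNum3a symmDen3a y).det = 1 := by
  have h0 := hy 0
  have h1 := hy 1
  have h2 := hy 2
  have h3 := hy 3
  rw [det_fin_four]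
  simp [logJacobian, symmNum3a, symmDen3a, pderiv_X, polyE, polyN, polyH, polyG]
  generalize y 0 = a at *
  generalize y 1 = b at *
  generalize y 2 = r at *
  generalize y 3 = s at *
  field_simp
  ring

/-- A symmetry of the base chirotope 3. -/
def symm3b : Equiv.Perm (Fin 6) :=
  ⟨![0, 2, 4, 1, 5, 3], ![0, 3, 1, 5, 2, 4], by decide, by decide⟩

/-- Numerators of the cross-ratios of the base chart 3 relabelled by `symm3b`. -/
def symmNum3b : Fin 4 → Poly4 :=
    ![1 + X 0, X 0, 1, 1 + X 2 + X 2 * X 3]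

/-- Denominators of the cross-ratios of the base chart 3 relabelled by `symm3b`. -/
def symmDen3b : Fin 4 → Poly4 :=
    ![X 1, 1, (1 + X 3) * X 2, X 3]

lemma reoriented_symm3b : Reoriented symm3b (fun j => boolSign (Nat.testBit 18 j))
    (signOf (baseCode 3)) (signOf (baseCode 3)) :=
  reoriented_signOf (by decide)

lemma symmNum3b_pos (y : Fin 4 → ℝ) (hy : ∀ j, 0 < y j) (i : Fin 4) :
    0 < eval y (symmNum3b i) := by
  have h0 := hy 0
  have h1 := hy 1
  have h2 := hy 2
  have h3 := hy 3
  fin_cases i <;> simp [symmNum3b] <;> positivity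

lemma symmDen3b_pos (y : Fin 4 → ℝ) (hy : ∀ j, 0 < y j) (i : Fin 4) :
    0 < eval y (symmDen3b i) := by
  have h0 := hy 0
  have h1 := hy 1
  have h2 := hy 2
  have h3 := hy 3
  fin_cases i <;> simp [symmDen3b] <;> positivity

lemma prod_symm3b {y : Fin 4 → ℝ} (hy : ∀ j, 0 < y j) (i : Fin 4) :
    ∏ I : Triple, (aeval y (ofVec (baseMinor3 (X 0) (X 1) (X 2) (X 3)) (tripleMap symm3b I) :
      MvPolynomial (Fin 4) ℕ) : ℝ) ^
      ofVec (baseExpo3 i) I = eval y (symmNum3b i) / eval y (symmDen3b i) := by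
  rw [prod_tripleMap_zpow (γ := ![5, 0, 6, 4, 2, 9, 7, 3, 1, 8, 11, 18, 16, 12, 10, 17, 15, 13, 19, 14]) _ _ (by decide)]
  have h0 := hy 0
  have h1 := hy 1
  have h2 := hy 2
  have h3 := hy 3
  generalize hx : y = v at *
  fin_cases i <;>
    simp [Fin.prod_univ_succ, baseExpo3, baseMinor3, symmNum3b, symmDen3b, polyD, polyE, polyN, polyH, polyG] <;>
    generalize v 0 = a at * <;> generalize v 1 = b at * <;> generalize v 2 = r at * <;>
    generalize v 3 = s at * <;> field_simp

lemma det_symm3b {y : Fin 4 → ℝ} (hy : ∀ j, 0 < y j) :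
    (logJacobian symmNum3b symmDen3b y).det = 1 := by
  have h0 := hy 0
  have h1 := hy 1
  have h2 := hy 2
  have h3 := hy 3
  rw [det_fin_four]
  simp [logJacobian, symmNum3b, symmDen3b, pderiv_X]
  generalize y 0 = a at *
  generalize y 1 = b at *
  generalize y 2 = r at *
  generalize y 3 = s at *
  field_simp
  ring

end Generators

/-- Generators of the symmetry group of each base chirotope. -/
def symmGen : ℕ → Bool → Equiv.Perm (Fin 6)
  | 0, false => symm0a
  | 0, true => symm0b
  | 1, _ => symm1a
  | 2, false => symm2a
  | 2, true => symm2b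
  | _, false => symm3a
  | _, true => symm3b

/-- Words in the generators that represent all symmetries of each base chirotope; the binary digits
of a number below its leading digit are the letters, starting from the lowest one. -/
def symmWords : ℕ → List ℕ
  | 0 =>
    [1, 2, 3, 5, 6, 10, 13, 21, 26, 42, 53, 106]
  | 1 =>
    [1, 2, 4, 8]
  | 2 =>
    [1, 2, 3, 5, 6, 10]
  | _ =>
    [1, 2, 3, 5, 6, 7, 10, 11, 13, 14, 15, 21, 22, 23, 26, 27, 29, 30, 31, 43, 45, 46, 54, 55, 58,
     59, 61, 86, 87, 90, 91, 93, 110, 118, 119, 122, 123, 174, 182, 183, 186, 187, 221, 238, 246,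
     247, 366, 374, 442, 443, 477, 494, 733, 886, 954, 955, 989, 1466, 1910, 1978]

/-- The letters of a word. -/
def letters (n : ℕ) : List Bool := (List.range n.log2).map n.testBit

/-- The image of a label under a word. -/
def applyWord (k n : ℕ) (j : Fin 6) : Fin 6 := (letters n).foldr (fun i x => symmGen k i x) j

lemma prod_apply_eq_foldr (g : Bool → Equiv.Perm (Fin 6)) (w : List Bool) (j : Fin 6) :
    (w.map g).prod j = w.foldr (fun i x => g i x) j := by
  induction w with
  | nil => rfl
  | cons i w ih => rw [List.map_cons, List.prod_cons, Equiv.Perm.mul_apply, ih, List.foldr_cons]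

/-- A product of four orientations in which each label occurs an even number of times. -/
def pairBit (N l a b c d : ℕ) : Bool :=
  (orientBit N l a b ^^ orientBit N l c d) ^^ (orientBit N l a c ^^ orientBit N l b d)

/-- Indices of products of orientations that suffice to recognize the symmetries. -/
def symmTests : List (Fin 6 × Fin 6 × Fin 6 × Fin 6 × Fin 6) :=
  [(0, 2, 3, 5, 4), (5, 0, 1, 2, 4), (2, 1, 3, 4, 5), (3, 0, 1, 4, 5), (1, 2, 3, 4, 5),
   (1, 0, 2, 4, 5), (1, 0, 3, 5, 4)]

/-- If the relabelling `p` matches the sign vectors `k` and `k'` up to reorientation, then `k = k'`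
and `p` is given by a listed word. -/
def symmCheck (k k' : ℕ) (p : Fin 6 → ℕ) : Bool :=
  bif symmTests.all fun t => pairBit (baseCode k) (p t.1) (p t.2.1) (p t.2.2.1) (p t.2.2.2.1)
      (p t.2.2.2.2) == pairBit (baseCode k') t.1 t.2.1 t.2.2.1 t.2.2.2.1 t.2.2.2.2
  then k == k' && (symmWords k).any fun n => (List.finRange 6).all fun j => p j == applyWord k n j
  else true

set_option maxRecDepth 100000 in
lemma symmCheck_all : ((List.range 4).all fun k => (List.range 4).all fun k' =>
    (List.range 6).all fun a => (List.range 6).all fun b => bif a == b then true else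
    (List.range 6).all fun c => bif a == c || b == c then true else
    (List.range 6).all fun d => bif a == d || (b == d || c == d) then true else
    (List.range 6).all fun e => bif a == e || (b == e || (c == e || d == e)) then true else
    (List.range 6).all fun f => bif a == f || (b == f || (c == f || (d == f || e == f))) then true
    else symmCheck k k' ![a, b, c, d, e, f]) = true := by
  decide +kernel
lemma cond_true_else_iff {p q : Bool} :
    (bif p then true else q) = true ↔ (p = false → q = true) := by
  cases p <;> simp

lemma pairBit_of_reoriented {N N' : ℕ} {σ : Equiv.Perm (Fin 6)} {s : Fin 6 → ℤˣ}
    (h : Reoriented σ s (signOf N) (signOf N')) {l a b c d : Fin 6} (hn : [l, a, b, c, d].Nodup) :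
    pairBit N (σ l) (σ a) (σ b) (σ c) (σ d) = pairBit N' l a b c d := by
  obtain ⟨⟨h1, h2, h3, h4⟩, ⟨h5, h6, h7⟩, ⟨h8, h9⟩, h10⟩ := nodup_five hn
  have key : ∀ {x y z : Fin 6}, x ≠ y → x ≠ z → y ≠ z →
      boolSign (orientBit N' x y z) = s x * s y * s z * boolSign (orientBit N (σ x) (σ y) (σ z)) :=
    fun hxy hxz hyz => by
      rw [← ochi_signOf N' hxy hxz hyz, h _ _ _ hxy hxz hyz, ochi_signOf N (σ.injective.ne hxy)
        (σ.injective.ne hxz) (σ.injective.ne hyz)]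
  apply boolSign_injective
  simp only [pairBit, boolSign_xor]
  rw [key h1 h2 h5, key h3 h4 h10, key h1 h3 h6, key h2 h4 h9]
  generalize s l = u, s a = v, s b = w, s c = x, s d = y
  generalize boolSign _ = D, boolSign _ = C, boolSign _ = B, boolSign _ = A
  have e : ∀ z : ℤˣ, z * z = 1 := Int.units_mul_self
  calc A * B * (C * D) = (u * u) * (u * u) * (v * v) * (w * w) * (x * x) * (y * y) *
        (A * B * (C * D)) := by simp only [e, one_mul]
    _ = _ := by ac_rfl

lemma symmTests_nodup : ∀ t ∈ symmTests, [t.1, t.2.1, t.2.2.1, t.2.2.2.1, t.2.2.2.2].Nodup := by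
  simp [symmTests]

/-- The base chirotopes are inequivalent, and their symmetries are generated by `symmGen`. -/
theorem symm_of_reoriented {k k' : ℕ} (hk : k < 4) (hk' : k' < 4) {σ : Equiv.Perm (Fin 6)}
    {s : Fin 6 → ℤˣ} (h : Reoriented σ s (signOf (baseCode k)) (signOf (baseCode k'))) :
    k = k' ∧ ∃ w : List Bool, σ = (w.map (symmGen k)).prod := by
  have hall := symmCheck_all
  simp only [List.all_eq_true, List.mem_range, cond_true_else_iff, Bool.or_eq_false_iff,
    beq_eq_false_iff_ne] at hall
  have hne : ∀ i j : Fin 6, i ≠ j → (σ i : ℕ) ≠ σ j := fun i j hij he =>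
    hij (σ.injective (Fin.ext he))
  have h1 := hall k hk k' hk' (σ 0) (σ 0).2 (σ 1) (σ 1).2 (hne _ _ (by decide)) (σ 2) (σ 2).2
    ⟨hne _ _ (by decide), hne _ _ (by decide)⟩ (σ 3) (σ 3).2
    ⟨hne _ _ (by decide), hne _ _ (by decide), hne _ _ (by decide)⟩ (σ 4) (σ 4).2
    ⟨hne _ _ (by decide), hne _ _ (by decide), hne _ _ (by decide), hne _ _ (by decide)⟩
    (σ 5) (σ 5).2 ⟨hne _ _ (by decide), hne _ _ (by decide), hne _ _ (by decide),
      hne _ _ (by decide), hne _ _ (by decide)⟩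
  have hp : ![(σ 0 : ℕ), σ 1, σ 2, σ 3, σ 4, σ 5] = fun j => (σ j : ℕ) := by
    funext j
    fin_cases j <;> rfl
  rw [hp, symmCheck, cond_true_iff] at h1
  have h2 := h1 (List.all_eq_true.mpr fun t ht => by
    rw [beq_iff_eq]
    exact pairBit_of_reoriented h (symmTests_nodup t ht))
  rw [Bool.and_eq_true, beq_iff_eq, List.any_eq_true] at h2
  obtain ⟨rfl, n, -, hn⟩ := h2
  refine ⟨rfl, letters n, Equiv.ext fun j => ?_⟩
  have h3 := List.all_eq_true.mp hn j (List.mem_finRange j)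
  rw [prod_apply_eq_foldr]
  exact Fin.ext (beq_iff_eq.mp h3)

/-! ### The base charts and their symmetries -/

lemma PreservesLogForm.list_prod {χ : SignVector} {c : Fin 4 → CrossRatio}
    {g : Bool → Equiv.Perm (Fin 6)} (hg : ∀ i, PreservesLogForm χ c (g i)) (w : List Bool) :
    PreservesLogForm χ c (w.map g).prod := by
  induction w with
  | nil => exact preservesLogForm_one χ c
  | cons i w ih => rw [List.map_cons, List.prod_cons]; exact (hg i).mul ih

/-- Each base chirotope has a positive chart whose logarithmic form is preserved by the generating
symmetries. -/
theorem exists_baseChart {k : ℕ} (hk : k < 4) : ∃ A e Q, ∃ h : PosChart (signOf (baseCode k)) A e Q,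
    ∀ i, PreservesLogForm (signOf (baseCode k)) h.crossRatio (symmGen k i) := by
  interval_cases k
  · obtain ⟨A, h⟩ := basePosChart0
    rw [ofVec_baseSign0] at h
    refine ⟨A, _, _, h, fun i => ?_⟩
    cases i
    · exact h.preservesLogForm reoriented_symm0a (ε := 1) (symmNum0a_pos · ·) (symmDen0a_pos · ·)
        (fun _ hy i => prod_symm0a hy i) fun _ hy => (det_symm0a hy).trans (by simp)
    · exact h.preservesLogForm reoriented_symm0b (ε := 1) (symmNum0b_pos · ·) (symmDen0b_pos · ·)
        (fun _ hy i => prod_symm0b hy i) fun _ hy => (det_symm0b hy).trans (by simp)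
  · obtain ⟨A, h⟩ := basePosChart1
    rw [ofVec_baseSign1] at h
    refine ⟨A, _, _, h, fun i => ?_⟩
    exact h.preservesLogForm reoriented_symm1a (ε := -1) (symmNum1a_pos · ·) (symmDen1a_pos · ·)
        (fun _ hy i => prod_symm1a hy i) fun _ hy => (det_symm1a hy).trans (by simp)
  · obtain ⟨A, h⟩ := basePosChart2
    rw [ofVec_baseSign2] at h
    refine ⟨A, _, _, h, fun i => ?_⟩
    cases i
    · exact h.preservesLogForm reoriented_symm2a (ε := 1) (symmNum2a_pos · ·) (symmDen2a_pos · ·)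
        (fun _ hy i => prod_symm2a hy i) fun _ hy => (det_symm2a hy).trans (by simp)
    · exact h.preservesLogForm reoriented_symm2b (ε := 1) (symmNum2b_pos · ·) (symmDen2b_pos · ·)
        (fun _ hy i => prod_symm2b hy i) fun _ hy => (det_symm2b hy).trans (by simp)
  · obtain ⟨A, h⟩ := basePosChart3
    rw [ofVec_baseSign3] at h
    refine ⟨A, _, _, h, fun i => ?_⟩
    cases i
    · exact h.preservesLogForm reoriented_symm3a (ε := 1) (symmNum3a_pos · ·) (symmDen3a_pos · ·)
        (fun _ hy i => prod_symm3a hy i) fun _ hy => (det_symm3a hy).trans (by simp)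
    · exact h.preservesLogForm reoriented_symm3b (ε := 1) (symmNum3b_pos · ·) (symmDen3b_pos · ·)
        (fun _ hy i => prod_symm3b hy i) fun _ hy => (det_symm3b hy).trans (by simp)

/-- Every realizable sign vector is equivalent to a base chirotope. -/
theorem exists_reoriented_base {χ : SignVector} (hχ : IsRealizable χ) :
    ∃ k < 4, ∃ σ s, Reoriented σ s (signOf (baseCode k)) χ := by
  obtain ⟨e, he, s, hs⟩ := exists_table_entry hχ
  obtain ⟨hk, σ, s', hs'⟩ := exists_base he
  exact ⟨_, hk, _, _, hs'.trans hs⟩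

lemma IsRealizable.base (k : ℕ) : IsRealizable (signOf (baseCode k)) := by
  have key : ∀ k < 4, IsRealizable (signOf (baseCode k)) := fun k hk => by
    obtain ⟨A, e, Q, h, -⟩ := exists_baseChart hk
    exact ⟨_, h.hasSigns (y := fun _ => 1) fun _ => one_pos⟩
  rcases lt_or_ge k 4 with hk | hk
  · exact key k hk
  · obtain ⟨n, rfl⟩ := Nat.exists_eq_add_of_le' hk
    exact key 3 (by norm_num)

lemma IsRealizable.nonempty {χ : SignVector} (hχ : IsRealizable χ) :
    ∃ x, x ∈ realizationSpace χ := by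
  obtain ⟨M, hM⟩ := hχ
  exact ⟨_, M, hM, rfl⟩

/-- The chosen cross-ratios of the base charts. -/
def baseCrossRatio {k : ℕ} (hk : k < 4) : Fin 4 → CrossRatio :=
  (exists_baseChart hk).choose_spec.choose_spec.choose_spec.choose.crossRatio

lemma preservesLogForm_base {k : ℕ} (hk : k < 4) (i : Bool) :
    PreservesLogForm (signOf (baseCode k)) (baseCrossRatio hk) (symmGen k i) :=
  (exists_baseChart hk).choose_spec.choose_spec.choose_spec.choose_spec i

/-- The data of a positive chart of `χ` obtained from a base chart. -/
def IsTransported (χ : SignVector) (A : Matrix (Fin 3) (Fin 6) Rat4) (c : Fin 4 → CrossRatio) :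
    Prop :=
  (∃ A' e Q, ∃ h : PosChart χ A' e Q, A = PosChart.ratMatrix A' ∧ c = h.crossRatio) ∧
  ∃ (k : ℕ) (hk : k < 4) (σ : Equiv.Perm (Fin 6)) (s : Fin 6 → ℤˣ),
    Reoriented σ s (signOf (baseCode k)) χ ∧
    ∀ i I, (c i).expo I = (baseCrossRatio hk i).expo (tripleMap σ I)

lemma exists_isTransported (χ : SignVector) : ∃ A c, IsRealizable χ → IsTransported χ A c := by
  by_cases hχ : IsRealizable χ
  · obtain ⟨k, hk, σ, s, hs⟩ := exists_reoriented_base hχ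
    have h := (exists_baseChart hk).choose_spec.choose_spec.choose_spec.choose.reorient hs
    exact ⟨_, _, fun _ => ⟨⟨_, _, _, h, rfl, rfl⟩, k, hk, σ, s, hs, fun _ _ => rfl⟩⟩
  · exact ⟨0, fun _ => ⟨1, 0, by simp⟩, fun h => absurd h hχ⟩

lemma IsTransported.canonical {χ χ' : SignVector} {A A' : Matrix (Fin 3) (Fin 6) Rat4}
    {c c' : Fin 4 → CrossRatio} (h : IsTransported χ A c) (h' : IsTransported χ' A' c')
    (hχ : IsRealizable χ) {σ : Equiv.Perm (Fin 6)}
    (hσ : relabel σ '' realizationSpace χ = realizationSpace χ') :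
    ∃ ε : ℤˣ, ∀ x ∈ realizationSpace χ,
      (logForm c' (relabel σ x)).compLinearMap
        (mfderiv 𝓘(ℝ, E4) 𝓘(ℝ, E4) (relabel σ) x).toLinearMap =
      ((ε : ℤ) : ℝ) • logForm c x := by
  obtain ⟨-, k, hk, σ₁, s₁, hr₁, he₁⟩ := h
  obtain ⟨-, k', hk', σ₂, s₂, hr₂, he₂⟩ := h'
  obtain ⟨x, hx⟩ := hχ.nonempty
  have hx' : relabel σ x ∈ realizationSpace χ' := by
    rw [← SetLike.mem_coe, ← hσ]
    exact Set.mem_image_of_mem _ hx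
  have hinv : ∀ x, relabel σ₁ (relabel σ₁⁻¹ x) = x := fun x => by
    rw [relabel_relabel, inv_mul_cancel, relabel_one]
  have hz' : relabel (σ₁ * σ * σ₂⁻¹) (relabel σ₁⁻¹ x) ∈ realizationSpace (signOf (baseCode k')) := by
    rw [← relabel_relabel, ← relabel_relabel, hinv]
    exact hr₂.symm.relabel_mem hx'
  obtain ⟨t, ht⟩ := exists_reoriented (hr₁.symm.relabel_mem hx) hz'
  obtain ⟨rfl, w, hw⟩ := symm_of_reoriented hk hk' ht
  have hτ := PreservesLogForm.list_prod (preservesLogForm_base hk) w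
  rw [← hw] at hτ
  obtain ⟨ε, hε⟩ := logForm_canonical hτ he₁ he₂
  refine ⟨ε, fun x hx => ?_⟩
  have := hε _ (hr₁.symm.relabel_mem hx)
  rwa [hinv] at this

end Chirotopal

end

open Chirotopal in
theorem mainTheorem3 :
    {S : Set X36 | ∃ χ, IsRealizable χ ∧ S = realizationSpace χ}.ncard = 372 ∧
    ∃ (A : SignVector → Matrix (Fin 3) (Fin 6) Rat4) (c : SignVector → Fin 4 → CrossRatio),
      ∀ χ, IsRealizable χ →
        IsBirationalPair (A χ) (c χ) ∧
        (∃ Φ : posOrthant ≃ₘ^∞⟮𝓘(ℝ, E4), 𝓘(ℝ, E4)⟯ realizationSpace χ,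
          (∀ y : posOrthant, ∃ h : (y : E4) ∈ paramDomain (A χ),
            (Φ y : X36) = paramMap (A χ) ⟨y, h⟩) ∧
          (∀ x : realizationSpace χ, (Φ.symm x : E4) = crossRatioMap (c χ) x) ∧
          ∀ y : posOrthant,
            (logForm (c χ) (Φ y)).compLinearMap
              (mfderiv 𝓘(ℝ, E4) 𝓘(ℝ, E4) (fun z : posOrthant => (Φ z : X36)) y).toLinearMap =
            orthantForm y) ∧
        (∀ χ', IsRealizable χ' → ∀ σ : Equiv.Perm (Fin 6),
          relabel σ '' realizationSpace χ = realizationSpace χ' →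
          ∃ ε : ℤˣ, ∀ x ∈ realizationSpace χ,
            (logForm (c χ') (relabel σ x)).compLinearMap
              (mfderiv 𝓘(ℝ, E4) 𝓘(ℝ, E4) (relabel σ) x).toLinearMap =
            ((ε : ℤ) : ℝ) • logForm (c χ) x) ∧
        ∃ F : Finset Poly4, ListsFactors (A χ) F ∧
          Nonempty (realizationSpace χ ≃ₘ^∞⟮𝓘(ℝ, E4), 𝓘(ℝ, E4)⟯
            interiorOpens (newtonPolytope (∏ f ∈ F, f))) ∧
          Nonempty (normalFan (newtonPolytope (∏ f ∈ F, f)) ≃o chiroFan χ) := by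
  refine ⟨ncard_realizationSpaces IsRealizable.base, ?_⟩
  choose A c hAc using exists_isTransported
  refine ⟨A, c, fun χ hχ => ?_⟩
  obtain ⟨A', e, Q, h, hA, hc⟩ := (hAc χ hχ).1
  refine ⟨?_, ?_, fun χ' hχ' σ hσ => (hAc χ hχ).canonical (hAc χ' hχ') hχ hσ, ?_⟩
  · rw [hA, hc]
    exact h.isBirationalPair
  · rw [hA, hc]
    exact ⟨h.diffeo, fun y => ⟨h.mem_paramDomain_of_pos y.2, h.diffeo_eq_paramMap y⟩,
      fun x => rfl, h.logForm_diffeo⟩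
  · rw [hA]
    exact h.exists_factors
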